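/- **Theorem 3.6.** Let $n\ge 3$ and let $R$ be $\mathbb Z[t]$ or $\mathbb Z[t,t^{-1}]$. Let $\mathfrak m_R$ be the ideal $(t)$ if $R=\mathbb Z[t]$ and $(t-1)$ if $R=\mathbb Z[t,t^{-1}]$, let $K(R)$ be the kernel of the homomorphism $SL_n(R)\to SL_n(R/\mathfrak m_R)=SL_n(\mathbb Z)$ (that is, $t\mapsto 0$, respectively $t\mapsto 1$), and let $$\mathcal U=\ker\bigl(SL_n(\mathbb Q[[T]])\xrightarrow{\,T=0\,}SL_n(\mathbb Q)\bigr),$$ a group whose regular functions are the polynomials over $\mathbb Q$ in the coefficients of the power series entries of a matrix. Then the homomorphism $\iota:K(R)\to\mathcal U$ induced by $t\mapsto T$ (respectively $t\mapsto 1+T$) is injective and is the Malcev completion of $K(R)$. Explicitly: 1. (Universal property.) $\mathcal U$ is a prounipotent group over $\mathbb Q$, and for every homomorphism $\psi:K(R)\to\mathcal Q$ to (the $\mathbb Q$-points of) a prounipotent group $\mathcal Q$ over $\mathbb Q$ there is a unique morphism of prounipotent groups $\Phi:\mathcal U\to\mathcal Q$ with $\Phi\circ\iota=\psi$. 2. (Inverse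 limit.) $\iota$ identifies $\mathcal U$ with $\varprojlim_r \widehat{G_r}$, where $G_r=K(R)/\Gamma^rK(R)$, $\Gamma^\bullet$ is the lower central series ($\Gamma^1G=G$), and $j_r: G_r\to\widehat{G_r}$ is the Malcev completion of the nilpotent group $G_r$: $\widehat{G_r}$ is nilpotent and uniquely divisible, $\ker j_r$ is the set of torsion elements of $G_r$, and every element of $\widehat{G_r}$ has a nonzero power in the image of $j_r$. Moreover, for every $r\ge1$ the congruence subgroup $K^r(R)=\{X\in K(R): X\equiv I \bmod \mathfrak m_R^r\}$ is the isolator of $\Gamma^rK(R)$: an element $X\in K(R)$ lies in $K^r(R)$ if and only if $X^m\in\Gamma^rK(R)$ for some integer $m>0$. -/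

import Mathlib

open scoped Polynomial LaurentPolynomial PowerSeries

noncomputable section

/-! ### Prounipotent groups over `ℚ` and the universal property

A prounipotent group over `ℚ` is an affine group scheme, and (in characteristic zero) it is
determined by its group `P` of `ℚ`-rational points together with the algebra of regular functions
on `P`.  So it is presented here as an abstract group `P` with a `ℚ`-algebra `A` of functions
`P → ℚ`. -/

section Prounipotent

universe u v w

/-- `KilledByDifferences N f`: every `N`-fold right difference
`(g₁ - 1) (g₂ - 1) ⋯ (g_N - 1) f` vanishes, where `(g · f) x = f (x * g)`. -/
def KilledByDifferences {P : Type u} [Group P] : ℕ → (P → ℚ) → Prop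
  | 0, f => f = 0
  | N + 1, f => ∀ g : P, KilledByDifferences N (fun x => f (x * g) - f x)

/-- `P`, with `A` as its algebra of regular functions, is a prounipotent group over `ℚ`:
* `A` is stable under the comultiplication and the antipode coming from `P`, so that it is a
  commutative Hopf algebra, i.e. the coordinate ring of an affine group scheme over `ℚ`;
* `P` is the group of `ℚ`-points of this group scheme;
* the (locally finite) representation of `P` on `A` by translations is locally unipotent. -/
structure IsProunipotent {P : Type u} [Group P] (A : Subalgebra ℚ (P → ℚ)) : Prop where
  comul : ∀ f ∈ A, ∃ (m : ℕ) (a b : Fin m → P → ℚ), (∀ i, a i ∈ A) ∧ (∀ i, b i ∈ A) ∧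
    ∀ x y : P, f (x * y) = ∑ i, a i x * b i y
  antipode : ∀ f ∈ A, (fun x : P => f x⁻¹) ∈ A
  points : ∀ χ : A →ₐ[ℚ] ℚ, ∃! x : P, ∀ f : A, χ f = (f : P → ℚ) x
  unipotent : ∀ f ∈ A, ∃ N : ℕ, KilledByDifferences N f

/-- A homomorphism of abstract groups is a morphism of proalgebraic groups if it pulls regular
functions back to regular functions. -/
def IsRegularHom {P : Type u} {Q : Type v} [Group P] [Group Q]
    (A : Subalgebra ℚ (P → ℚ)) (B : Subalgebra ℚ (Q → ℚ)) (Φ : P →* Q) : Prop :=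
  ∀ f ∈ B, f ∘ Φ ∈ A

/-- `φ : Γ → P` is the Malcev completion of `Γ`: the group `P` (with regular functions `A`) is
prounipotent over `ℚ`, and every homomorphism of `Γ` to a prounipotent group over `ℚ` factors
uniquely through `φ` by a morphism of prounipotent groups. -/
def IsMalcevCompletion {Γ : Type u} {P : Type v} [Group Γ] [Group P]
    (A : Subalgebra ℚ (P → ℚ)) (φ : Γ →* P) : Prop :=
  IsProunipotent A ∧
    ∀ (Q : Type w) [Group Q] (B : Subalgebra ℚ (Q → ℚ)), IsProunipotent B →
      ∀ ψ : Γ →* Q, ∃! Φ : P →* Q, IsRegularHom A B Φ ∧ Φ.comp φ = ψ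

end Prounipotent

/-! ### The construction as an inverse limit -/

section Limit

universe u v

/-- `j : G → H` is the Malcev completion of the nilpotent group `G`. -/
structure IsNilpotentMalcevCompletion {G : Type u} {H : Type v} [Group G] [Group H]
    (j : G →* H) : Prop where
  nilpotent : Group.IsNilpotent H
  uniquely_divisible : ∀ m : ℕ, m ≠ 0 → Function.Bijective (fun h : H => h ^ m)
  ker_eq_torsion : ∀ g : G, j g = 1 ↔ IsOfFinOrder g
  exists_pow_mem_range : ∀ h : H, ∃ m : ℕ, m ≠ 0 ∧ h ^ m ∈ j.range

/-- `lowerCentral G r` is `Γ^{r+1} G`, where `Γ^1 G = G` and `Γ^{r+1} G = [Γ^r G, G]`. -/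
abbrev lowerCentral (G : Type u) [Group G] (r : ℕ) : Subgroup G :=
  (⊤ : Subgroup G).lowerCentralSeries r

/-- `φ : G → M` identifies `M` with the inverse limit of the Malcev completions `H r` of the
nilpotent quotients `G / Γ^{r+1} G`.  Here `j r` are the completion maps, `p r` the transition
maps of the inverse system and `π r` the projections from `M`. -/
def IsMalcevLimit {G : Type u} {M : Type v} [Group G] [Group M] (φ : G →* M) : Prop :=
  ∃ (H : ℕ → Type v) (_ : ∀ r, Group (H r))
    (j : ∀ r, G ⧸ lowerCentral G r →* H r)
    (p : ∀ r, H (r + 1) →* H r)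
    (π : ∀ r, M →* H r),
    (∀ r, IsNilpotentMalcevCompletion (j r)) ∧
    (∀ (r : ℕ) (g : G), p r (j (r + 1) (g : G ⧸ lowerCentral G (r + 1))) =
      j r (g : G ⧸ lowerCentral G r)) ∧
    (∀ (r : ℕ) (m : M), p r (π (r + 1) m) = π r m) ∧
    (∀ (r : ℕ) (g : G), π r (φ g) = j r (g : G ⧸ lowerCentral G r)) ∧
    (∀ h : ∀ r, H r, (∀ r, p r (h (r + 1)) = h r) → ∃! m : M, ∀ r, π r m = h r)

end Limit

/-! ### The groups -/

/-- The kernel of `SL_n(R) → SL_n(S)` induced by a ring homomorphism `R → S`. -/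
def slKer (n : ℕ) {R S : Type} [CommRing R] [CommRing S] (f : R →+* S) :
    Subgroup (Matrix.SpecialLinearGroup (Fin n) R) :=
  (Matrix.SpecialLinearGroup.map f).ker

/-- `ℤ[t] → ℤ`, `t ↦ 0`. -/
def polyAug : ℤ[X] →+* ℤ := Polynomial.evalRingHom 0

/-- `ℤ[t, t⁻¹] → ℤ`, `t ↦ 1`. -/
def laurentAug : ℤ[T;T⁻¹] →+* ℤ := LaurentPolynomial.eval₂ (RingHom.id ℤ) 1

/-- `ℤ[t] → ℚ[[T]]`, `t ↦ T`. -/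
def polyExpand : ℤ[X] →+* ℚ⟦X⟧ := Polynomial.eval₂RingHom (Int.castRingHom ℚ⟦X⟧) PowerSeries.X

theorem isUnit_one_add_X : IsUnit (1 + PowerSeries.X : ℚ⟦X⟧) := by
  rw [PowerSeries.isUnit_iff_constantCoeff]
  simp

/-- `ℤ[t, t⁻¹] → ℚ[[T]]`, `t ↦ 1 + T`. -/
def laurentExpand : ℤ[T;T⁻¹] →+* ℚ⟦X⟧ :=
  LaurentPolynomial.eval₂ (Int.castRingHom ℚ⟦X⟧) isUnit_one_add_X.unit

/-- `U = ker (SL_n(ℚ[[T]]) → SL_n(ℚ))`, `T ↦ 0`. -/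
abbrev seriesKer (n : ℕ) : Subgroup (Matrix.SpecialLinearGroup (Fin n) ℚ⟦X⟧) :=
  slKer n (PowerSeries.constantCoeff (R := ℚ))

/-- The regular functions on `U`: polynomials with rational coefficients in the coordinates
`X ↦ (coefficient of T^k in the (i, j) entry of X)`. -/
def seriesKerFunctions (n : ℕ) : Subalgebra ℚ (seriesKer n → ℚ) :=
  Algebra.adjoin ℚ (Set.range fun (c : Fin n × Fin n × ℕ) (X : seriesKer n) =>
    PowerSeries.coeff c.2.2 (X.1 c.1 c.2.1))

/-- A ring homomorphism `e : R → ℚ[[T]]` over an augmentation `a : R → ℤ` induces a homomorphism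
from the kernel of `SL_n(R) → SL_n(ℤ)` to `U`. -/
def kerToSeriesKer (n : ℕ) {R : Type} [CommRing R] (a : R →+* ℤ) (e : R →+* ℚ⟦X⟧)
    (h : ∀ x, PowerSeries.constantCoeff (e x) = (a x : ℚ)) : slKer n a →* seriesKer n :=
  ((Matrix.SpecialLinearGroup.map e).comp (slKer n a).subtype).codRestrict (seriesKer n) (by
    rintro ⟨x, hx⟩
    change Matrix.SpecialLinearGroup.map a x = 1 at hx
    change Matrix.SpecialLinearGroup.map _ (Matrix.SpecialLinearGroup.map e x) = 1
    ext i j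
    have h1 : a (x i j) = (1 : Matrix.SpecialLinearGroup (Fin n) ℤ) i j := by
      rw [← hx]; rfl
    change PowerSeries.constantCoeff (e (x i j)) = _
    rw [h, h1]
    by_cases hij : i = j <;> simp [hij])

theorem constantCoeff_polyExpand (x : ℤ[X]) :
    PowerSeries.constantCoeff (polyExpand x) = (polyAug x : ℚ) := by
  have : (PowerSeries.constantCoeff (R := ℚ)).comp polyExpand =
      (Int.castRingHom ℚ).comp polyAug := by
    ext <;> simp [polyExpand, polyAug]
  exact DFunLike.congr_fun this x

theorem constantCoeff_laurentExpand (x : ℤ[T;T⁻¹]) :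
    PowerSeries.constantCoeff (laurentExpand x) = (laurentAug x : ℚ) := by
  have : (PowerSeries.constantCoeff (R := ℚ)).comp laurentExpand =
      (Int.castRingHom ℚ).comp laurentAug := by
    refine IsLocalization.ringHom_ext (Submonoid.powers (Polynomial.X : ℤ[X])) ?_
    refine Polynomial.ringHom_ext' (Subsingleton.elim _ _) ?_
    simp only [RingHom.comp_apply, LaurentPolynomial.algebraMap_eq_toLaurent, laurentExpand,
      laurentAug, LaurentPolynomial.eval₂_toLaurent]
    simp
  exact DFunLike.congr_fun this x

/-- `K(ℤ[t])`. -/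
abbrev polyKer (n : ℕ) := slKer n polyAug

/-- `K(ℤ[t, t⁻¹])`. -/
abbrev laurentKer (n : ℕ) := slKer n laurentAug

/-- The inclusion `K(ℤ[t]) → U` given by `t ↦ T`. -/
def polyIncl (n : ℕ) : polyKer n →* seriesKer n :=
  kerToSeriesKer n polyAug polyExpand constantCoeff_polyExpand

/-- The inclusion `K(ℤ[t, t⁻¹]) → U` given by `t ↦ 1 + T`. -/
def laurentIncl (n : ℕ) : laurentKer n →* seriesKer n :=
  kerToSeriesKer n laurentAug laurentExpand constantCoeff_laurentExpand

/-- `K^r(ℤ[t])`: the matrices in `K(ℤ[t])` congruent to `I` modulo `(t)^r`. -/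
def polyCongr (n r : ℕ) : Subgroup (polyKer n) :=
  (slKer n (Ideal.Quotient.mk
    ((Ideal.span {(Polynomial.X : ℤ[X])}) ^ r))).subgroupOf (polyKer n)

/-- `K^r(ℤ[t, t⁻¹])`: the matrices in `K(ℤ[t, t⁻¹])` congruent to `I` modulo `(t - 1)^r`. -/
def laurentCongr (n r : ℕ) : Subgroup (laurentKer n) :=
  (slKer n (Ideal.Quotient.mk
    ((Ideal.span {(LaurentPolynomial.T 1 - 1 : ℤ[T;T⁻¹])}) ^ r))).subgroupOf (laurentKer n)

end

universe w

/-! ### Elementary matrices and Mennicke symbols -/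

section Elementary

open Matrix

set_option linter.unusedSectionVars false

variable {ι : Type*} [Fintype ι] [DecidableEq ι] {R : Type*} [CommRing R]

/-! The proof compares the lower central series of `K` with the `T`-adic filtration of `𝒰`. The
graded pieces of the latter are the trace-zero rational matrices, read off as leading coefficients,
and `Γ^r K` lands in level `r` because commutators add levels. Rationally nothing is lost: every
homomorphism `Γ^r K / Γ^(r+1) K → ℚ` is a linear form in the leading coefficient matrix
(`char_eq_sum`). An element of an abelian group killed by all homomorphisms to `ℚ` is torsion, so
induction on `r` shows that `K^r` is the isolator of `Γ^r K` (`map_mem_seriesCongr_iff`).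

To control the characters one needs generators of `K`, hence Suslin's theorem that `SL_n = E_n` over
`ℤ[t]` and `ℤ[t, t⁻¹]` for `n ≥ 3`. Mennicke symbols settle polynomials over a discrete valuation
ring, Quillen patching descends from the localizations of `ℤ`, and the Laurent case follows by
clearing powers of `t`. So `K` is generated by the `SL_n(ℤ)`-conjugates of elementary matrices with
coefficients in the augmentation ideal.

After subtraction of a linear form, a character vanishes on all transvections `1 + τ^r v uᵀ` along
orthogonal integral pairs (`exists_eq_sum`). What might survive are the values on commutators of
opposite root elements; these are antisymmetric and satisfy a cyclic relation coming from Hall–Witt,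
and such functions vanish (`eq_zero_of_cyclic`). Commuting with an elementary matrix lowers the
degree of a character, and induction then shows that the character itself is zero
(`char_eq_zero_of_kill`).

For the inverse limit, trace-zero matrices over `ℚ` are uniquely divisible, so roots exist uniquely
modulo each level, and clearing denominators level by level brings a power of any element into `K`.

For the universal property, a homomorphism to a prounipotent group pulls regular functions back to
functions on `K` killed by iterated differences. These are invariant under some `Γ^N K`, hence under
its isolator, and extend to regular functions on `𝒰` by admitting one matrix coefficient at a time
(`exists_extension`). The extension is unique because `K` is Zariski dense (`eq_of_comp_eq`).
Evaluating extensions at a point of `𝒰` gives a character of the target algebra, that is, a point of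
the target. -/

/-- The monoid (in fact group) of products of elementary matrices with indices in `s`. -/
def elemMonoid (R : Type*) [CommRing R] (s : Finset ι) : Submonoid (Matrix ι ι R) :=
  Submonoid.closure {M | ∃ i ∈ s, ∃ j ∈ s, i ≠ j ∧ ∃ c : R, M = transvection i j c}

theorem transvection_mem_elemMonoid {s : Finset ι} {i j : ι} (hi : i ∈ s) (hj : j ∈ s)
    (hij : i ≠ j) (c : R) : transvection i j c ∈ elemMonoid R s :=
  Submonoid.subset_closure ⟨i, hi, j, hj, hij, c, rfl⟩

theorem elemMonoid_mono {s t : Finset ι} (h : s ⊆ t) : elemMonoid R s ≤ elemMonoid R t :=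
  Submonoid.closure_mono fun _ ⟨i, hi, j, hj, hij⟩ => ⟨i, h hi, j, h hj, hij⟩

theorem elemMonoid_exists_inv {s : Finset ι} {A : Matrix ι ι R} (hA : A ∈ elemMonoid R s) :
    ∃ B ∈ elemMonoid R s, A * B = 1 ∧ B * A = 1 := by
  induction hA using Submonoid.closure_induction with
  | mem M hM =>
    obtain ⟨i, hi, j, hj, hij, c, rfl⟩ := hM
    exact ⟨_, transvection_mem_elemMonoid hi hj hij (-c),
      by simp [transvection_mul_transvection_same _ _ hij],
      by simp [transvection_mul_transvection_same _ _ hij]⟩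
  | one => exact ⟨1, one_mem _, by simp, by simp⟩
  | mul A A' _ _ h h' =>
    obtain ⟨B, hB, h1, h2⟩ := h
    obtain ⟨B', hB', h1', h2'⟩ := h'
    refine ⟨B' * B, mul_mem hB' hB, ?_, ?_⟩
    · rw [mul_assoc, ← mul_assoc A', h1', one_mul, h1]
    · rw [mul_assoc, ← mul_assoc B, h2, one_mul, h2']

theorem elemMonoid_mul_mem_cancel_left {s : Finset ι} {A B : Matrix ι ι R}
    (hA : A ∈ elemMonoid R s) : A * B ∈ elemMonoid R s ↔ B ∈ elemMonoid R s := by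
  refine ⟨fun h => ?_, fun h => mul_mem hA h⟩
  obtain ⟨A', hA', -, h2⟩ := elemMonoid_exists_inv hA
  simpa [← mul_assoc, h2] using mul_mem hA' h

theorem elemMonoid_mul_mem_cancel_right {s : Finset ι} {A B : Matrix ι ι R}
    (hB : B ∈ elemMonoid R s) : A * B ∈ elemMonoid R s ↔ A ∈ elemMonoid R s := by
  refine ⟨fun h => ?_, fun h => mul_mem h hB⟩
  obtain ⟨B', hB', h1, -⟩ := elemMonoid_exists_inv hB
  simpa [mul_assoc, h1] using mul_mem h hB'

theorem elemMonoid_det {s : Finset ι} {A : Matrix ι ι R} (hA : A ∈ elemMonoid R s) :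
    A.det = 1 := by
  induction hA using Submonoid.closure_induction with
  | mem M hM =>
    obtain ⟨i, hi, j, hj, hij, c, rfl⟩ := hM
    exact det_transvection_of_ne _ _ hij _
  | one => simp
  | mul A A' _ _ h h' => rw [det_mul, h, h', one_mul]

theorem transvection_map_ringHom {S : Type*} [CommRing S] (f : R →+* S) (i j : ι) (c : R) :
    (transvection i j c).map f = transvection i j (f c) := by
  rw [transvection, transvection, Matrix.map_add _ (map_add f),
    Matrix.map_one _ (map_zero f) (map_one f), Matrix.map_single]

theorem elemMonoid_map {S : Type*} [CommRing S] (f : R →+* S) {s : Finset ι} {A : Matrix ι ι R}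
    (hA : A ∈ elemMonoid R s) : A.map f ∈ elemMonoid S s := by
  induction hA using Submonoid.closure_induction with
  | mem M hM =>
    obtain ⟨i, hi, j, hj, hij, c, rfl⟩ := hM
    rw [transvection_map_ringHom]
    exact transvection_mem_elemMonoid hi hj hij (f c)
  | one => rw [Matrix.map_one _ (map_zero f) (map_one f)]; exact one_mem _
  | mul A A' _ _ h h' => rw [Matrix.map_mul]; exact mul_mem h h'

theorem elemMonoid_exists_map_eq {S : Type*} [CommRing S] (f : R →+* S)
    (hf : Function.Surjective f) {s : Finset ι} {A : Matrix ι ι S}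
    (hA : A ∈ elemMonoid S s) : ∃ B ∈ elemMonoid R s, B.map f = A := by
  induction hA using Submonoid.closure_induction with
  | mem M hM =>
    obtain ⟨i, hi, j, hj, hij, c, rfl⟩ := hM
    obtain ⟨c, rfl⟩ := hf c
    exact ⟨_, transvection_mem_elemMonoid hi hj hij c, transvection_map_ringHom f i j c⟩
  | one => exact ⟨1, one_mem _, Matrix.map_one _ (map_zero f) (map_one f)⟩
  | mul A A' _ _ h h' =>
    obtain ⟨B, hB, rfl⟩ := h
    obtain ⟨B', hB', rfl⟩ := h'
    exact ⟨B * B', mul_mem hB hB', Matrix.map_mul⟩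

/-- The matrix acting by `(a, b; c, d)` on the coordinates `i`, `j` and trivially on the others. -/
def planar (i j : ι) (a b c d : R) : Matrix ι ι R := Matrix.of fun r s =>
  if r = i then (if s = i then a else if s = j then b else 0)
  else if r = j then (if s = i then c else if s = j then d else 0)
  else if r = s then 1 else 0

theorem planar_mul_apply {i j : ι} (hij : i ≠ j) (a b c d : R) (X : Matrix ι ι R) (r s : ι) :
    (planar i j a b c d * X) r s = if r = i then a * X i s + b * X j s
      else if r = j then c * X i s + d * X j s else X r s := by
  have key : ∀ u v : R, ∑ x, (if x = i then u else if x = j then v else 0) * X x s =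
      u * X i s + v * X j s := by
    intro u v
    have : ∀ x, (if x = i then u else if x = j then v else 0) * X x s =
        (if x = i then u * X x s else 0) + (if x = j then v * X x s else 0) := by
      intro x
      by_cases h : x = i
      · subst h; simp [hij]
      · simp [h]
    simp [this, Finset.sum_add_distrib]
  rw [mul_apply]
  simp only [planar, of_apply]
  by_cases hr : r = i
  · simp only [hr, if_true]; exact key a b
  · by_cases hr' : r = j
    · simp only [hr', if_true, if_false, hij.symm]; exact key c d
    · simp [hr, hr']

theorem planar_swap {i j : ι} (hij : i ≠ j) (a b c d : R) :
    planar i j a b c d = planar j i d c b a := by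
  ext r s
  simp only [planar, of_apply]
  split_ifs <;> simp_all

theorem planar_mul_transvection {i j : ι} (hij : i ≠ j) (a b c d l : R) :
    planar i j a b c d * transvection i j l = planar i j a (b + l * a) c (d + l * c) := by
  ext r s
  by_cases hs : s = j
  · subst hs
    rw [mul_transvection_apply_same]
    simp only [planar, of_apply]
    split_ifs <;> simp_all
  · rw [mul_transvection_apply_of_ne _ _ _ _ hs]
    simp [planar, hs]

theorem planar_mul_transvection' {i j : ι} (hij : i ≠ j) (a b c d l : R) :
    planar i j a b c d * transvection j i l = planar i j (a + l * b) b (c + l * d) d := by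
  rw [planar_swap hij, planar_mul_transvection hij.symm, planar_swap hij.symm]

theorem transvection_mul_planar {i j : ι} (hij : i ≠ j) (a b c d l : R) :
    transvection i j l * planar i j a b c d = planar i j (a + l * c) (b + l * d) c d := by
  ext r s
  by_cases hr : r = i
  · subst hr
    simp only [transvection_mul_apply_same, planar, of_apply]
    split_ifs <;> simp_all
  · rw [transvection_mul_apply_of_ne _ _ _ _ hr]
    simp [planar, hr]

theorem transvection_mul_planar' {i j : ι} (hij : i ≠ j) (a b c d l : R) :
    transvection j i l * planar i j a b c d = planar i j a b (c + l * a) (d + l * b) := by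
  rw [planar_swap hij, transvection_mul_planar hij.symm, planar_swap hij.symm]

theorem planar_one {i j : ι} (hij : i ≠ j) : planar i j (1 : R) 0 0 1 = 1 := by
  ext r s
  simp only [planar, of_apply, one_apply]
  split_ifs <;> simp_all

/-- The Mennicke symbol of `(a, b)` in `SL_n / E_n` is trivial. -/
def TrivialSymbol (ι : Type*) [Fintype ι] [DecidableEq ι] {R : Type*} [CommRing R]
    (a b : R) : Prop :=
  ∀ i j : ι, i ≠ j → ∀ c d : R, a * d - b * c = 1 → planar i j a b c d ∈ elemMonoid R .univ

local notation "E" => elemMonoid R (Finset.univ : Finset ι)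

theorem transvection_mem_elem {i j : ι} (hij : i ≠ j) (l : R) : transvection i j l ∈ E :=
  transvection_mem_elemMonoid (Finset.mem_univ _) (Finset.mem_univ _) hij l

namespace TrivialSymbol

theorem add_right {a b : R} (h : TrivialSymbol ι a b) (l : R) : TrivialSymbol ι a (b + l * a) := by
  intro i j hij c d hd
  have := h i j hij c (d - l * c) (by linear_combination hd)
  rw [← elemMonoid_mul_mem_cancel_right (transvection_mem_elem hij l),
    planar_mul_transvection hij] at this
  simpa using this

theorem add_left {a b : R} (h : TrivialSymbol ι a b) (l : R) : TrivialSymbol ι (a + l * b) b := by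
  intro i j hij c d hd
  have := h i j hij (c - l * d) d (by linear_combination hd)
  rw [← elemMonoid_mul_mem_cancel_right (transvection_mem_elem hij.symm l),
    planar_mul_transvection' hij] at this
  simpa using this

theorem of_add_right {a b : R} (l : R) (h : TrivialSymbol ι a (b + l * a)) :
    TrivialSymbol ι a b := by
  convert h.add_right (-l) using 1; ring

theorem of_add_left {a b : R} (l : R) (h : TrivialSymbol ι (a + l * b) b) :
    TrivialSymbol ι a b := by
  convert h.add_left (-l) using 1; ring

/-- Adding the bottom row to the top is a left transvection. The bottom row is immaterial: two rows
completing `(a, b)` to determinant one differ by a multiple of `(a, b)`, here `c' * d - d' * c`. -/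
theorem of_add_row {a b c d : R} (hd : a * d - b * c = 1) (l : R)
    (h : TrivialSymbol ι (a + l * c) (b + l * d)) : TrivialSymbol ι a b := by
  intro i j hij c' d' hd'
  have := h i j hij c d (by linear_combination hd)
  rw [← transvection_mul_planar hij,
    elemMonoid_mul_mem_cancel_left (transvection_mem_elem hij l),
    ← elemMonoid_mul_mem_cancel_left (transvection_mem_elem hij.symm (c' * d - d' * c)),
    transvection_mul_planar' hij] at this
  convert this using 2
  · linear_combination (-c') * hd + c * hd'
  · linear_combination (-d') * hd + d * hd'

theorem one_left (b : R) : TrivialSymbol ι 1 b := by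
  refine of_add_right (-b) ?_
  intro i j hij c d hd
  have : planar i j (1 : R) (b + -b * 1) c d = transvection j i c * planar i j 1 0 0 1 := by
    rw [transvection_mul_planar' hij]
    congr 1 <;> first | ring1 | linear_combination hd
  rw [this, planar_one hij, mul_one]
  exact transvection_mem_elem hij.symm _

theorem unit_left {u : R} (hu : IsUnit u) (b : R) : TrivialSymbol ι u b := by
  obtain ⟨u, rfl⟩ := hu
  have h1 : TrivialSymbol ι (u : R) 1 := by
    refine of_add_left (1 - u) ?_
    convert one_left (ι := ι) (1 : R) using 1; ring
  convert h1.add_right ((b - 1) * ((u⁻¹ : Rˣ) : R)) using 1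
  rw [mul_assoc]; simp

/-- Three alternating transvections act as a Weyl element: `(a, b) → (a, a + b) → (-b, a + b) → (-b,
a)`. -/
theorem neg_swap {a b : R} (h : TrivialSymbol ι a b) : TrivialSymbol ι (-b) a := by
  have h1 := ((h.add_right 1).add_left (-1)).add_right 1
  convert h1 using 1 <;> ring

section Mul

variable (hι : 3 ≤ Fintype.card ι)

theorem exists_third (hι : 3 ≤ Fintype.card ι) (i j : ι) : ∃ k, k ≠ i ∧ k ≠ j := by
  by_contra! h
  have : (Finset.univ : Finset ι) ⊆ {i, j} := fun k _ => by
    by_cases hk : k = i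
    · simp [hk]
    · simp [h k hk]
  have := (Finset.card_le_card this).trans Finset.card_le_two
  rw [Finset.card_univ] at this
  omega

/-- Mennicke's relation. -/
theorem mennicke {i j k : ι} (hij : i ≠ j) (hik : i ≠ k) (hjk : j ≠ k)
    {a₁ a₂ b c₁ d₁ c₂ d₂ : R} (h₁ : a₁ * d₁ - b * c₁ = 1) (h₂ : a₂ * d₂ - b * c₂ = 1) :
    ∃ A ∈ E, ∃ B ∈ E, A * (planar i k a₂ b c₂ d₂ * planar i j a₁ b c₁ d₁) * B =
      planar i k (a₁ * a₂) b (c₁ + d₁ * c₂ * a₁) (d₁ * d₂) := by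
  have hw : planar j k (0 : R) (-1) 1 0 ∈ E := by
    have : planar j k (0 : R) (-1) 1 0 =
        transvection j k (-1) * (transvection k j 1 * (transvection j k (-1) *
          planar j k 1 0 0 1)) := by
      rw [transvection_mul_planar hjk, transvection_mul_planar' hjk, transvection_mul_planar hjk]
      congr 1 <;> ring
    rw [this, planar_one hjk]
    exact mul_mem (transvection_mem_elem hjk _) (mul_mem (transvection_mem_elem hjk.symm _)
      (mul_mem (transvection_mem_elem hjk _) (one_mem _)))
  -- Subtracting `a₂` times column `k` from column `j` makes the `(k, j)` entry `-1`, by `a₂ d₂ - b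
  -- c₂ = 1`. That entry clears the rest of row `k` and of column `j`, and the Weyl element
  -- exchanges rows `j` and `k` up to sign.
  refine ⟨planar j k 0 (-1) 1 0 * transvection j k d₁,
    mul_mem hw (transvection_mem_elem hjk _),
    transvection k j (-a₂) * (transvection j k d₂ * transvection j i (c₂ * a₁)),
    mul_mem (transvection_mem_elem hjk.symm _)
      (mul_mem (transvection_mem_elem hjk _) (transvection_mem_elem hij.symm _)), ?_⟩
  have e1 : ∀ r s, (planar i k a₂ b c₂ d₂ * planar i j a₁ b c₁ d₁) r s =
      if r = i then (if s = i then a₁ * a₂ else if s = j then a₂ * b else if s = k then b else 0)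
      else if r = j then (if s = i then c₁ else if s = j then d₁ else 0)
      else if r = k then (if s = i then c₂ * a₁ else if s = j then c₂ * b
        else if s = k then d₂ else 0)
      else if r = s then 1 else 0 := by
    intro r s
    rw [planar_mul_apply hik]
    simp only [planar, of_apply]
    grind
  generalize planar i k a₂ b c₂ d₂ * planar i j a₁ b c₁ d₁ = M at e1
  have e2 : ∀ r s, (M * transvection k j (-a₂)) r s =
      if r = i then (if s = i then a₁ * a₂ else if s = k then b else 0)
      else if r = j then (if s = i then c₁ else if s = j then d₁ else 0)
      else if r = k then (if s = i then c₂ * a₁ else if s = j then -1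
        else if s = k then d₂ else 0)
      else if r = s then 1 else 0 := by
    intro r s
    by_cases hs : s = j
    · subst hs
      rw [mul_transvection_apply_same, e1, e1]
      grind
    · rw [mul_transvection_apply_of_ne _ _ _ _ hs, e1]
      simp [hs]
  have e3 : ∀ r s, (transvection j k d₁ * (M * transvection k j (-a₂))) r s =
      if r = i then (if s = i then a₁ * a₂ else if s = k then b else 0)
      else if r = j then (if s = i then c₁ + d₁ * c₂ * a₁ else if s = k then d₁ * d₂ else 0)
      else if r = k then (if s = i then c₂ * a₁ else if s = j then -1
        else if s = k then d₂ else 0)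
      else if r = s then 1 else 0 := by
    intro r s
    by_cases hr : r = j
    · subst hr
      rw [transvection_mul_apply_same, e2, e2]
      grind
    · rw [transvection_mul_apply_of_ne _ _ _ _ hr, e2]
      simp [hr]
  generalize hN : transvection j k d₁ * (M * transvection k j (-a₂)) = N at e3
  have e4 : ∀ r s, (N * transvection j k d₂) r s =
      if r = i then (if s = i then a₁ * a₂ else if s = k then b else 0)
      else if r = j then (if s = i then c₁ + d₁ * c₂ * a₁ else if s = k then d₁ * d₂ else 0)
      else if r = k then (if s = i then c₂ * a₁ else if s = j then -1 else 0)
      else if r = s then 1 else 0 := by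
    intro r s
    by_cases hs : s = k
    · subst hs
      rw [mul_transvection_apply_same, e3, e3]
      grind
    · rw [mul_transvection_apply_of_ne _ _ _ _ hs, e3]
      simp [hs]
  have e5 : ∀ r s, (N * transvection j k d₂ * transvection j i (c₂ * a₁)) r s =
      if r = i then (if s = i then a₁ * a₂ else if s = k then b else 0)
      else if r = j then (if s = i then c₁ + d₁ * c₂ * a₁ else if s = k then d₁ * d₂ else 0)
      else if r = k then (if s = j then -1 else 0)
      else if r = s then 1 else 0 := by
    intro r s
    by_cases hs : s = i
    · subst hs
      rw [mul_transvection_apply_same, e4, e4]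
      grind
    · rw [mul_transvection_apply_of_ne _ _ _ _ hs, e4]
      simp [hs]
  have e6 : planar j k 0 (-1) 1 0 * transvection j k d₁ * M *
      (transvection k j (-a₂) * (transvection j k d₂ * transvection j i (c₂ * a₁))) =
      planar j k 0 (-1) 1 0 * (N * transvection j k d₂ * transvection j i (c₂ * a₁)) := by
    rw [← hN]; simp only [mul_assoc]
  rw [e6]
  ext r s
  rw [planar_mul_apply hjk, e5, e5, e5]
  simp only [planar, of_apply]
  grind

/-- The single equation `a₁ a₂ d - b c = 1` completes both `(a₁, b)` and `(a₂, b)` with the same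
`c`, so Mennicke's relation applies. The bottom row it returns differs from `(c, d)` by a multiple
of the top row. -/
theorem mul_left (hι : 3 ≤ Fintype.card ι) {a₁ a₂ b : R} (h₁ : TrivialSymbol ι a₁ b)
    (h₂ : TrivialSymbol ι a₂ b) : TrivialSymbol ι (a₁ * a₂) b := by
  intro i k hik c d hd
  obtain ⟨j, hji, hjk⟩ := exists_third hι i k
  have e₁ : a₁ * (a₂ * d) - b * c = 1 := by linear_combination hd
  have e₂ : a₂ * (a₁ * d) - b * c = 1 := by linear_combination hd
  obtain ⟨A, hA, B, hB, h⟩ := mennicke hji.symm hik hjk e₁ e₂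
  have h3 : planar i k (a₁ * a₂) b (c + a₂ * d * c * a₁) (a₂ * d * (a₁ * d)) ∈ E := by
    rw [← h]
    exact mul_mem (mul_mem hA (mul_mem (h₂ _ _ hik _ _ e₂) (h₁ _ _ hji.symm _ _ e₁))) hB
  rw [← elemMonoid_mul_mem_cancel_left (transvection_mem_elem hik.symm (- (d * c))),
    transvection_mul_planar' hik] at h3
  convert h3 using 2
  · ring
  · linear_combination (-d) * hd

/-- Coprimality supplies a matrix with top row `(a₁, b)`. In Mennicke's relation this matrix and the
product matrix are elementary, hence so is the remaining factor. -/
theorem of_mul_left (hι : 3 ≤ Fintype.card ι) {a₁ a₂ b : R} (h₁ : TrivialSymbol ι a₁ b)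
    (h : TrivialSymbol ι (a₁ * a₂) b) (hc : IsCoprime a₁ b) : TrivialSymbol ι a₂ b := by
  intro i k hik c₂ d₂ e₂
  obtain ⟨j, hji, hjk⟩ := exists_third hι i k
  obtain ⟨x, y, hxy⟩ := hc
  have e₁ : a₁ * x - b * (-y) = 1 := by linear_combination hxy
  obtain ⟨A, hA, B, hB, h3⟩ := mennicke hji.symm hik hjk e₁ e₂
  have h4 := h i k hik (-y + x * c₂ * a₁) (x * d₂) (by
    linear_combination e₁ + (x * a₁) * e₂)
  rw [← h3, elemMonoid_mul_mem_cancel_right hB, elemMonoid_mul_mem_cancel_left hA,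
    elemMonoid_mul_mem_cancel_right (h₁ _ _ hji.symm _ _ e₁)] at h4
  exact h4

theorem swap (hι : 3 ≤ Fintype.card ι) {a b : R} (h : TrivialSymbol ι a b) :
    TrivialSymbol ι b a := by
  simpa using mul_left hι (unit_left isUnit_one.neg a) h.neg_swap

theorem mul_right (hι : 3 ≤ Fintype.card ι) {a b₁ b₂ : R} (h₁ : TrivialSymbol ι a b₁)
    (h₂ : TrivialSymbol ι a b₂) : TrivialSymbol ι a (b₁ * b₂) :=
  ((h₁.swap hι).mul_left hι (h₂.swap hι)).swap hι

theorem of_mul_right (hι : 3 ≤ Fintype.card ι) {a b₁ b₂ : R} (h₁ : TrivialSymbol ι a b₁)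
    (h : TrivialSymbol ι a (b₁ * b₂)) (hc : IsCoprime a b₁) : TrivialSymbol ι a b₂ :=
  ((h₁.swap hι).of_mul_left hι (h.swap hι) hc.symm).swap hι

theorem unit_right (hι : 3 ≤ Fintype.card ι) {u : R} (hu : IsUnit u) (a : R) :
    TrivialSymbol ι a u :=
  (unit_left hu a).swap hι

end Mul

end TrivialSymbol

end Elementary

/-! ### Elementary reduction; Euclidean domains -/

section Reduction

open Matrix

set_option linter.unusedSectionVars false

variable {ι : Type*} [Fintype ι] [DecidableEq ι] {R : Type*} [CommRing R]

/-- The matrix agrees with the identity outside `s × s`. -/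
def SupportedOn (s : Finset ι) (X : Matrix ι ι R) : Prop :=
  ∀ i j, i ∉ s ∨ j ∉ s → X i j = (1 : Matrix ι ι R) i j

theorem SupportedOn.mul {s : Finset ι} {X Y : Matrix ι ι R} (hX : SupportedOn s X)
    (hY : SupportedOn s Y) : SupportedOn s (X * Y) := by
  intro i j h
  rw [mul_apply]
  rcases h with h | h
  · simp only [hX i _ (Or.inl h), one_apply, ite_mul, one_mul, zero_mul, Finset.sum_ite_eq,
      Finset.mem_univ, if_true]
    exact hY i j (Or.inl h)
  · simp only [hY _ j (Or.inr h), one_apply, mul_ite, mul_one, mul_zero, Finset.sum_ite_eq',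
      Finset.mem_univ, if_true]
    exact hX i j (Or.inr h)

theorem supportedOn_of_mem {s : Finset ι} {X : Matrix ι ι R} (hX : X ∈ elemMonoid R s) :
    SupportedOn s X := by
  induction hX using Submonoid.closure_induction with
  | mem M hM =>
    obtain ⟨i, hi, j, hj, hij, c, rfl⟩ := hM
    intro a b h
    rw [transvection, Matrix.add_apply, single_apply, if_neg, add_zero]
    rintro ⟨rfl, rfl⟩
    tauto
  | one => exact fun _ _ _ => rfl
  | mul A A' _ _ h h' => exact h.mul h'

theorem supportedOn_univ (X : Matrix ι ι R) : SupportedOn Finset.univ X := by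
  intro i j h; simp at h

theorem vecMul_transvection_apply (w : ι → R) (i j : ι) (c : R) (k : ι) :
    (w ᵥ* transvection i j c) k = if k = j then w j + c * w i else w k := by
  have h : (w ᵥ* transvection i j c) k = (Matrix.of (fun _ : Unit => w) * transvection i j c) () k := by
    simp [vecMul, dotProduct, mul_apply]
  rw [h]
  by_cases hk : k = j
  · subst hk; simp
  · rw [mul_transvection_apply_of_ne _ _ _ _ hk]; simp [hk]

theorem exists_clear_row {s t : Finset ι} {i : ι} (hi : i ∈ s) (ht : t ⊆ s.erase i)
    {X : Matrix ι ι R} (h1 : X i i = 1) :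
    ∃ A ∈ elemMonoid R s, (X * A) i i = 1 ∧ ∀ j ∈ t, (X * A) i j = 0 := by
  induction t using Finset.induction_on with
  | empty => exact ⟨1, one_mem _, by simpa using h1, by simp⟩
  | insert j t hj ih =>
    obtain ⟨A, hA, h1, h2⟩ := ih ((Finset.subset_insert _ _).trans ht)
    have hj' := ht (Finset.mem_insert_self j t)
    have hji := Finset.ne_of_mem_erase hj'
    refine ⟨A * transvection i j (-(X * A) i j), mul_mem hA (transvection_mem_elemMonoid hi
      (Finset.mem_of_mem_erase hj') hji.symm _), ?_, ?_⟩
    · rw [← mul_assoc, mul_transvection_apply_of_ne _ _ _ _ hji.symm, h1]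
    · intro k hk
      rw [← mul_assoc]
      by_cases hkj : k = j
      · subst hkj; rw [mul_transvection_apply_same, h1]; ring
      · rw [mul_transvection_apply_of_ne _ _ _ _ hkj]
        exact h2 k (Finset.mem_of_mem_insert_of_ne hk hkj)

theorem exists_clear_col {s t : Finset ι} {i : ι} (hi : i ∈ s) (ht : t ⊆ s.erase i)
    {X : Matrix ι ι R} (h1 : X i = (1 : Matrix ι ι R) i) :
    ∃ A ∈ elemMonoid R s, (A * X) i = (1 : Matrix ι ι R) i ∧ ∀ j ∈ t, (A * X) j i = 0 := by
  induction t using Finset.induction_on with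
  | empty => exact ⟨1, one_mem _, by simpa using h1, by simp⟩
  | insert j t hj ih =>
    obtain ⟨A, hA, h1, h2⟩ := ih ((Finset.subset_insert _ _).trans ht)
    have hj' := ht (Finset.mem_insert_self j t)
    have hji := Finset.ne_of_mem_erase hj'
    refine ⟨transvection j i (-(A * X) j i) * A, mul_mem (transvection_mem_elemMonoid
      (Finset.mem_of_mem_erase hj') hi hji _) hA, ?_, ?_⟩
    · ext k
      rw [mul_assoc, transvection_mul_apply_of_ne _ _ _ _ hji.symm, h1]
    · intro k hk
      rw [mul_assoc]
      by_cases hkj : k = j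
      · subst hkj; rw [transvection_mul_apply_same, h1, one_apply_eq]; ring
      · rw [transvection_mul_apply_of_ne _ _ _ _ hkj]
        exact h2 k (Finset.mem_of_mem_insert_of_ne hk hkj)

/-- The off-diagonal `1` is used to make the diagonal entry `1`, which then serves as pivot for
clearing row and column `i`. -/
theorem exists_supportedOn_erase {s : Finset ι} {i j : ι} (hi : i ∈ s) (hj : j ∈ s) (hij : i ≠ j)
    {X : Matrix ι ι R} (hX : SupportedOn s X) (h1 : X i j = 1) :
    ∃ A ∈ elemMonoid R s, ∃ B ∈ elemMonoid R s, SupportedOn (s.erase i) (A * X * B) := by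
  have hB₁ := transvection_mem_elemMonoid hj hi hij.symm (1 - X i i)
  set B₁ := transvection j i (1 - X i i) with hB₁'
  have h2 : (X * B₁) i i = 1 := by
    rw [hB₁', mul_transvection_apply_same, h1]; ring
  obtain ⟨B₂, hB₂, h3, h4⟩ := exists_clear_row hi subset_rfl h2
  have h5 : SupportedOn s (X * B₁ * B₂) :=
    (hX.mul (supportedOn_of_mem hB₁)).mul (supportedOn_of_mem hB₂)
  have h6 : (X * B₁ * B₂) i = (1 : Matrix ι ι R) i := by
    ext k
    by_cases hk : k = i
    · rw [hk, h3, one_apply_eq]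
    · by_cases hks : k ∈ s
      · rw [h4 k (Finset.mem_erase.2 ⟨hk, hks⟩), one_apply_ne (Ne.symm hk)]
      · exact h5 _ _ (Or.inr hks)
  obtain ⟨A, hA, h7, h8⟩ := exists_clear_col hi subset_rfl h6
  refine ⟨A, hA, B₁ * B₂, mul_mem hB₁ hB₂, ?_⟩
  rw [mul_assoc, ← mul_assoc X]
  have h9 := (supportedOn_of_mem hA).mul h5
  intro a b hab
  by_cases ha : a = i
  · rw [ha, h7]
  · by_cases hb : b = i
    · subst hb
      by_cases has : a ∈ s
      · rw [h8 a (Finset.mem_erase.2 ⟨ha, has⟩), one_apply_ne ha]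
      · exact h9 _ _ (Or.inl has)
    · apply h9
      simpa [ha, hb] using hab

theorem eq_one_of_supportedOn {s : Finset ι} (hs : s.card ≤ 1) {X : Matrix ι ι R}
    (hX : SupportedOn s X) (hdet : X.det = 1) : X = 1 := by
  rcases Nat.lt_or_ge s.card 1 with h0 | h1
  · have : s = ∅ := Finset.card_eq_zero.1 (by omega)
    subst this
    ext i j
    exact hX i j (by simp)
  · obtain ⟨i, rfl⟩ := Finset.card_eq_one.1 (le_antisymm hs h1)
    have h : X = diagonal (Function.update 1 i (X i i)) := by
      ext a b
      by_cases hab : a = b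
      · subst hab
        by_cases ha : a = i
        · subst ha; simp
        · rw [hX a a (by simp [ha])]; simp [ha]
      · rw [diagonal_apply_ne _ hab, hX a b, one_apply_ne hab]
        by_contra! h
        simp at h
        exact hab (h.1.trans h.2.symm)
    rw [h, det_diagonal, Finset.prod_update_of_mem (Finset.mem_univ i)] at hdet
    simp at hdet
    rw [h, hdet]
    ext a b
    by_cases hab : a = b
    · subst hab
      by_cases ha : a = i <;> simp
    · rw [diagonal_apply_ne _ hab, one_apply_ne hab]

theorem isUnit_of_row_eq_zero {X : Matrix ι ι R} (hdet : X.det = 1) {i : ι}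
    (h : ∀ j, j ≠ i → X i j = 0) : IsUnit (X i i) := by
  have h1 : (X * X.adjugate) i i = 1 := by rw [mul_adjugate, hdet]; simp
  rw [mul_apply, Finset.sum_eq_single i (fun j _ hj => by rw [h j hj, zero_mul]) (by simp)] at h1
  exact IsUnit.of_mul_eq_one _ h1

end Reduction

/-! ### Row reduction over Euclidean domains. -/

section Euclidean

open Matrix

variable {ι : Type*} [Fintype ι] [DecidableEq ι] {R : Type*} [EuclideanDomain R]

/-- The Euclidean algorithm by column operations, recursing with the two positions exchanged; `h0`
then moves the surviving entry back to position `i`. -/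
theorem exists_vecMul_pair_eq_zero {i j : ι} (hij : i ≠ j) (w : ι → R) :
    ∃ A ∈ elemMonoid R {i, j}, (w ᵥ* A) j = 0 ∧ ∀ k, k ≠ i → k ≠ j → (w ᵥ* A) k = w k := by
  have h0 : ∀ (w : ι → R) (i j : ι), i ≠ j → w i = 0 →
      ∃ A ∈ elemMonoid R {i, j}, (w ᵥ* A) j = 0 ∧ ∀ k, k ≠ i → k ≠ j → (w ᵥ* A) k = w k := by
    intro w i j hij hw
    refine ⟨transvection j i 1 * transvection i j (-1), mul_mem
      (transvection_mem_elemMonoid (by simp) (by simp) hij.symm _)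
      (transvection_mem_elemMonoid (by simp) (by simp) hij _), ?_, ?_⟩
    · rw [← vecMul_vecMul]
      simp only [vecMul_transvection_apply, hij.symm, hw]
      simp
    · intro k hk hk'
      rw [← vecMul_vecMul]
      simp [vecMul_transvection_apply, hk, hk']
  have key : ∀ a b : R, ∀ (w : ι → R) (i j : ι), i ≠ j → w i = a → w j = b →
      ∃ A ∈ elemMonoid R {i, j}, (w ᵥ* A) j = 0 ∧ ∀ k, k ≠ i → k ≠ j → (w ᵥ* A) k = w k := by
    intro a b
    induction a, b using EuclideanDomain.GCD.induction with
    | H0 x => intro w i j hij hi _; exact h0 w i j hij hi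
    | H1 a b ha ih =>
      intro w i j hij hi hj
      have hT := transvection_mem_elemMonoid (R := R) (s := {i, j}) (i := i) (j := j) (by simp)
        (by simp) hij (-(b / a))
      set T := transvection i j (-(b / a)) with hTdef
      obtain ⟨A, hA, h1, h2⟩ := ih (w ᵥ* T) j i hij.symm
        (by rw [hTdef, vecMul_transvection_apply, if_pos rfl, hi, hj, EuclideanDomain.mod_eq_sub_mul_div]
            ring)
        (by rw [hTdef, vecMul_transvection_apply, if_neg hij, hi])
      obtain ⟨B, hB, h3, h4⟩ := h0 _ i j hij h1
      refine ⟨T * A * B, mul_mem (mul_mem hT (by rwa [Finset.pair_comm])) hB, ?_, ?_⟩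
      · rwa [← vecMul_vecMul, ← vecMul_vecMul]
      · intro k hk hk'
        rw [← vecMul_vecMul, ← vecMul_vecMul, h4 k hk hk', h2 k hk' hk, hTdef,
          vecMul_transvection_apply, if_neg hk']
  exact key _ _ w i j hij rfl rfl

theorem exists_vecMul_eq_zero {s : Finset ι} {i : ι} (hi : i ∈ s) (w : ι → R) :
    ∃ A ∈ elemMonoid R s, ∀ j ∈ s, j ≠ i → (w ᵥ* A) j = 0 := by
  have key : ∀ t ⊆ s.erase i, ∃ A ∈ elemMonoid R s, ∀ j ∈ t, (w ᵥ* A) j = 0 := by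
    intro t
    induction t using Finset.induction_on with
    | empty => exact fun _ => ⟨1, one_mem _, by simp⟩
    | insert j t hj ih =>
      intro ht
      obtain ⟨A, hA, h⟩ := ih ((Finset.subset_insert _ _).trans ht)
      have hj' := ht (Finset.mem_insert_self j t)
      have hji := Finset.ne_of_mem_erase hj'
      obtain ⟨B, hB, h1, h2⟩ := exists_vecMul_pair_eq_zero hji.symm (w ᵥ* A)
      refine ⟨A * B, mul_mem hA (elemMonoid_mono ?_ hB), ?_⟩
      · intro x hx
        simp only [Finset.mem_insert, Finset.mem_singleton] at hx
        rcases hx with rfl | rfl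
        exacts [hi, Finset.mem_of_mem_erase hj']
      · intro k hk
        rw [← vecMul_vecMul]
        by_cases hkj : k = j
        · rw [hkj, h1]
        · have hkt := Finset.mem_of_mem_insert_of_ne hk hkj
          rw [h2 k (Finset.ne_of_mem_erase (ht (Finset.mem_insert_of_mem hkt))) hkj, h k hkt]
  obtain ⟨A, hA, h⟩ := key _ subset_rfl
  exact ⟨A, hA, fun j hj hji => h j (Finset.mem_erase.2 ⟨hji, hj⟩)⟩

/-- Euclid leaves a single entry in row `i`, necessarily a unit `u`; adding `u⁻¹` times column `i`
to column `j` creates the off-diagonal `1` from which the support shrinks. -/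
theorem mem_elemMonoid_of_euclidean {s : Finset ι} {X : Matrix ι ι R} (hX : SupportedOn s X)
    (hdet : X.det = 1) : X ∈ elemMonoid R s := by
  induction s using Finset.strongInduction generalizing X with
  | H s ih =>
    rcases Nat.lt_or_ge 1 s.card with hs | hs
    · obtain ⟨i, hi, j, hj, hij⟩ := Finset.one_lt_card.1 hs
      obtain ⟨A, hA, h⟩ := exists_vecMul_eq_zero hi (X i)
      have hXA := hX.mul (supportedOn_of_mem hA)
      have hd : (X * A).det = 1 := by rw [det_mul, hdet, elemMonoid_det hA, one_mul]
      have h' : ∀ k, k ≠ i → (X * A) i k = 0 := by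
        intro k hk
        by_cases hks : k ∈ s
        · exact h k hks hk
        · rw [hXA i k (Or.inr hks), one_apply_ne hk.symm]
      obtain ⟨u, hu⟩ := isUnit_of_row_eq_zero hd h'
      have hT := transvection_mem_elemMonoid hi hj hij ((u⁻¹ : Rˣ) : R)
      have h1 : (X * A * transvection i j ((u⁻¹ : Rˣ) : R)) i j = 1 := by
        rw [mul_transvection_apply_same, h' j hij.symm, ← hu]; simp
      obtain ⟨B, hB, C, hC, hsup⟩ := exists_supportedOn_erase hi hj hij
        (hXA.mul (supportedOn_of_mem hT)) h1
      have := ih _ (Finset.erase_ssubset hi) hsup (by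
        rw [det_mul, det_mul, det_mul, hd, elemMonoid_det hB, elemMonoid_det hC,
          elemMonoid_det hT]; simp)
      have := elemMonoid_mono (Finset.erase_subset i s) this
      rwa [elemMonoid_mul_mem_cancel_right hC, elemMonoid_mul_mem_cancel_left hB,
        elemMonoid_mul_mem_cancel_right hT, elemMonoid_mul_mem_cancel_right hA] at this
    · rw [eq_one_of_supportedOn hs hX hdet]; exact one_mem _

end Euclidean

/-! ### Polynomials over a discrete valuation ring -/

section LocalRing

open Polynomial IsLocalRing

variable {ι : Type*} [Fintype ι] [DecidableEq ι] (hι : 3 ≤ Fintype.card ι)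
  {A : Type*} [CommRing A] [IsLocalRing A]

include hι

/-- Induction on the degree of `f`. If `g` has smaller degree and unit constant term, a multiple of
`g` kills the constant term of `f`, so `f` becomes `X * f'`: the symbol of `X` and `g` is trivial,
and `f'` has smaller degree. If `g(0)` is not a unit, a bottom row of small degree is added to the
top row; the determinant at `0`, taken in the residue field, forces the new constant term to be a
unit. -/
theorem TrivialSymbol.of_monic {f g : A[X]} (hf : f.Monic) (h : IsCoprime f g) :
    TrivialSymbol ι f g := by
  induction hd : f.natDegree generalizing f g with
  | zero =>
    rw [hf.natDegree_eq_zero.1 hd]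
    exact one_left g
  | succ d ih =>
    have hdeg : f.degree = (d + 1 : ℕ) := by rw [degree_eq_natDegree hf.ne_zero, hd]
    have h1 : ∀ f g : A[X], f.Monic → f.natDegree = d + 1 → IsCoprime f g →
        g.degree < f.degree → IsUnit (g.coeff 0) → TrivialSymbol ι f g := by
      intro f g hf hd h hlt hu
      obtain ⟨u, hu⟩ := hu
      set l : A := -(f.coeff 0 * ((u⁻¹ : Aˣ) : A)) with hl
      refine of_add_left (C l) ?_
      have hm : (f + C l * g).Monic :=
        hf.add_of_left ((C_mul' l g ▸ degree_smul_le l g).trans_lt hlt)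
      have h0 : (f + C l * g).coeff 0 = 0 := by
        simp [hl, ← hu]
      have hn : (f + C l * g).natDegree = d + 1 := by
        rw [natDegree_eq_of_degree_eq (degree_add_eq_left_of_degree_lt
          ((C_mul' l g ▸ degree_smul_le l g).trans_lt hlt)), hd]
      have hc : IsCoprime (f + C l * g) g := by
        simpa using h.add_mul_right_left (C l)
      have hX : f + C l * g = X * (f + C l * g).divX := by
        conv_lhs => rw [← X_mul_divX_add (f + C l * g), h0]
        simp
      set f' := (f + C l * g).divX with hf'
      rw [hX] at hm hn hc ⊢
      have hm' : f'.Monic := monic_X.of_mul_monic_left hm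
      refine mul_left hι ?_ (ih hm' hc.of_mul_left_right ?_)
      · refine of_add_right (-g.divX) ?_
        have : g + -g.divX * X = C (g.coeff 0) := by
          linear_combination -divX_mul_X_add g
        rw [this, ← hu]
        exact unit_right hι (u.isUnit.map C) X
      · rw [natDegree_X_mul hm'.ne_zero] at hn
        omega
    have h2 : ∀ g : A[X], IsCoprime f g → g.degree < f.degree → TrivialSymbol ι f g := by
      intro g h hlt
      by_cases hu : IsUnit (g.coeff 0)
      · exact h1 f g hf hd h hlt hu
      obtain ⟨a, b, hab⟩ := h
      have hbf := modByMonic_add_div (-b) f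
      set r := (-b) %ₘ f with hr
      set q := (-b) /ₘ f with hq
      have hrdeg : r.degree < f.degree := degree_modByMonic_lt _ hf
      set s := a - g * q with hs
      have hrs : f * s - g * r = 1 := by
        rw [hs]; linear_combination hab - g * hbf
      -- `f * s = g * r + 1` has degree at most `2 d`, while `f` is monic of degree `d + 1`.
      have hsdeg : s.degree < f.degree := by
        by_cases hs0 : s = 0
        · rw [hs0, degree_zero, hdeg]; exact WithBot.bot_lt_coe _
        have e1 : (f * s).natDegree = d + 1 + s.natDegree := by
          rw [hf.natDegree_mul' hs0, hd]
        have e2 : (f * s).natDegree ≤ d + d := by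
          rw [show f * s = g * r + 1 by linear_combination hrs]
          refine (natDegree_add_le _ _).trans (max_le ?_ (by simp))
          have hg : g.natDegree ≤ d := by
            rw [hdeg] at hlt
            exact natDegree_le_of_degree_le (Order.lt_succ_iff.1 hlt : g.degree ≤ (d : ℕ))
          have hr' : r.natDegree ≤ d := by
            rw [hdeg] at hrdeg
            exact natDegree_le_of_degree_le (Order.lt_succ_iff.1 hrdeg : r.degree ≤ (d : ℕ))
          exact natDegree_mul_le.trans (by omega)
        rw [hdeg]
        refine degree_le_natDegree.trans_lt ?_
        exact_mod_cast (by omega : s.natDegree < d + 1)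
      refine of_add_row hrs 1 ?_
      rw [one_mul, one_mul]
      refine h1 _ _ (hf.add_of_left hrdeg) ?_ ⟨s, -r, by linear_combination hrs⟩ ?_ ?_
      · rw [natDegree_eq_of_degree_eq (degree_add_eq_left_of_degree_lt hrdeg), hd]
      · rw [degree_add_eq_left_of_degree_lt hrdeg]
        exact (degree_add_le _ _).trans_lt (max_lt hlt hsdeg)
      · have e0 := congrArg (fun p : A[X] => residue A (p.coeff 0)) hrs
        simp only [coeff_sub, mul_coeff_zero, coeff_one_zero, map_sub, map_mul, map_one] at e0
        have hg0 : residue A (g.coeff 0) = 0 := by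
          by_contra hne
          exact hu ((residue_ne_zero_iff_isUnit _).1 hne)
        rw [← residue_ne_zero_iff_isUnit, coeff_add, map_add, hg0, zero_add]
        intro hs0
        rw [hg0, hs0] at e0
        simp at e0
    refine of_add_right (-(g /ₘ f)) ?_
    have : g + -(g /ₘ f) * f = g %ₘ f := by
      linear_combination -modByMonic_add_div g f
    rw [this]
    refine h2 _ ?_ (degree_modByMonic_lt _ hf)
    rw [← this]
    exact h.add_mul_right_right _

theorem TrivialSymbol.of_isUnit_leadingCoeff {f g : A[X]} (hf : IsUnit f.leadingCoeff)
    (h : IsCoprime f g) : TrivialSymbol ι f g := by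
  obtain ⟨u, hu⟩ := hf
  have hm : (C ((u⁻¹ : Aˣ) : A) * f).Monic := by
    refine monic_C_mul_of_mul_leadingCoeff_eq_one ?_
    rw [← hu]; simp
  have hC : IsUnit (C ((u⁻¹ : Aˣ) : A)) := (u⁻¹).isUnit.map C
  exact of_mul_left hι (unit_left hC g) (of_monic hι hm
    ((isCoprime_mul_unit_left_left hC f g).2 h)) ⟨C (u : A), 0, by rw [zero_mul, add_zero, ← C_mul]; simp⟩

end LocalRing

section DVR

open Polynomial IsLocalRing

variable {A : Type*} [CommRing A] [IsDomain A] [IsDiscreteValuationRing A]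

/-- The polynomial is a nonzero constant modulo the maximal ideal. -/
def UnitConstMod {A : Type*} [CommRing A] [IsLocalRing A] (x : A[X]) : Prop :=
  ∃ v : ResidueField A, v ≠ 0 ∧ x.map (residue A) = C v

theorem C_dvd_of_map_residue_eq_zero {p : A} (hp : Irreducible p) {y : A[X]}
    (h : y.map (residue A) = 0) : C p ∣ y := by
  rw [C_dvd_iff_dvd_coeff]
  intro i
  have : residue A (y.coeff i) = 0 := by rw [← coeff_map, h, coeff_zero]
  rw [residue_eq_zero_iff, hp.maximalIdeal_eq, Ideal.mem_span_singleton] at this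
  exact this

theorem UnitConstMod.exists_eq {p : A} (hp : Irreducible p) {x : A[X]} (hx : UnitConstMod x) :
    ∃ u : A, IsUnit u ∧ ∃ h : A[X], x = C u + C p * h := by
  obtain ⟨v, hv, hxv⟩ := hx
  obtain ⟨u, rfl⟩ := residue_surjective v
  obtain ⟨h, hh⟩ := C_dvd_of_map_residue_eq_zero hp (y := x - C u) (by simp [hxv])
  exact ⟨u, (residue_ne_zero_iff_isUnit _).1 hv, h, by rw [← hh]; ring⟩

theorem UnitConstMod.isCoprime_C {x : A[X]} (hx : UnitConstMod x) {c : A} (hc : c ≠ 0) :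
    IsCoprime x (C c) := by
  obtain ⟨p, hp⟩ := IsDiscreteValuationRing.exists_irreducible A
  obtain ⟨u, ⟨u, rfl⟩, h, hxu⟩ := hx.exists_eq hp
  obtain ⟨n, w, rfl⟩ := IsDiscreteValuationRing.eq_unit_mul_pow_irreducible hc hp
  rw [C_mul, C_pow, isCoprime_mul_unit_left_right (w.isUnit.map C)]
  refine IsCoprime.pow_right ⟨C ((u⁻¹ : Aˣ) : A), - C ((u⁻¹ : Aˣ) : A) * h, ?_⟩
  have : C ((u⁻¹ : Aˣ) : A) * C (u : A) = 1 := by rw [← C_mul]; simp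
  rw [hxu]
  linear_combination this

theorem UnitConstMod.isUnit_coeff_zero {x : A[X]} (hx : UnitConstMod x) :
    IsUnit (x.coeff 0) := by
  obtain ⟨v, hv, hxv⟩ := hx
  rw [← residue_ne_zero_iff_isUnit, ← coeff_map, hxv, coeff_C_zero]
  exact hv

theorem UnitConstMod.isCoprime_X {x : A[X]} (hx : UnitConstMod x) : IsCoprime x X := by
  obtain ⟨u, hu⟩ := hx.isUnit_coeff_zero
  refine ⟨C ((u⁻¹ : Aˣ) : A), - C ((u⁻¹ : Aˣ) : A) * x.divX, ?_⟩
  have : C ((u⁻¹ : Aˣ) : A) * C (u : A) = 1 := by rw [← C_mul]; simp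
  conv_lhs => rw [← divX_mul_X_add x, ← hu]
  have h2 : (divX x * X + C (u : A)).divX = divX x := by
    rw [hu, divX_mul_X_add]
  rw [h2]
  linear_combination this

variable {ι : Type*} [Fintype ι] [DecidableEq ι] (hι : 3 ≤ Fintype.card ι)

include hι

/-- By multiplicativity `c` may be taken to be a uniformizer, modulo which `x` is a unit constant.
-/
theorem UnitConstMod.trivialSymbol_C {x : A[X]} (hx : UnitConstMod x) {c : A} (hc : c ≠ 0) :
    TrivialSymbol ι x (C c) := by
  obtain ⟨p, hp⟩ := IsDiscreteValuationRing.exists_irreducible A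
  obtain ⟨u, hu, h, hxu⟩ := hx.exists_eq hp
  obtain ⟨n, w, rfl⟩ := IsDiscreteValuationRing.eq_unit_mul_pow_irreducible hc hp
  rw [C_mul, C_pow]
  refine .mul_right hι (.unit_right hι (w.isUnit.map C) x) ?_
  induction n with
  | zero => rw [pow_zero]; exact .unit_right hι isUnit_one x
  | succ n ih =>
    rw [pow_succ]
    refine .mul_right hι (ih ?_) ?_
    · exact mul_ne_zero w.ne_zero (pow_ne_zero _ hp.ne_zero)
    · refine .of_add_left (-h) ?_
      rw [show x + -h * C p = C u by rw [hxu]; ring]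
      exact .unit_left (hu.map C) _

theorem UnitConstMod.trivialSymbol_X {x : A[X]} (hx : UnitConstMod x) :
    TrivialSymbol ι x X := by
  refine .of_add_left (-x.divX) ?_
  have : x + -x.divX * X = C (x.coeff 0) := by
    linear_combination -divX_mul_X_add x
  rw [this]
  exact .unit_left (hx.isUnit_coeff_zero.map C) _

/-- Induction on the degree `e` of `x`. Pseudo-division by `x` brings `g` below degree `e`; the
constants multiplied in are harmless by `trivialSymbol_C`, and powers of the uniformizer are split
off. In `loop` the degree of the reduction of `r` is raised until it reaches `e - 1`, where `r` has
a unit leading coefficient and the monic case applies. If this is obstructed, `x` is traded for a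
polynomial of smaller degree. -/
theorem UnitConstMod.trivialSymbol {x g : A[X]} (hx : UnitConstMod x) (h : IsCoprime x g) :
    TrivialSymbol ι x g := by
  induction he : x.natDegree using Nat.strong_induction_on generalizing x g with
  | _ e IH =>
  rcases Nat.eq_zero_or_pos e with rfl | hpos
  · rw [eq_C_of_natDegree_eq_zero he]
    exact .unit_left (hx.isUnit_coeff_zero.map C) _
  have hx0 : x.coeff e ≠ 0 := by
    rw [← he, coeff_natDegree, leadingCoeff_ne_zero]
    rintro rfl
    simp at he; omega
  -- a polynomial of smaller degree which is nonzero modulo the maximal ideal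
  have loop : ∀ k, ∀ r : A[X], r.natDegree ≤ e - 1 → r.map (residue A) ≠ 0 →
      e - 1 - (r.map (residue A)).natDegree = k → IsCoprime x r → TrivialSymbol ι x r := by
    intro k
    induction k with
    | zero =>
      intro r hr hr0 hk hc
      have hle : (r.map (residue A)).natDegree ≤ r.natDegree := natDegree_map_le
      have hn : (r.map (residue A)).natDegree = r.natDegree := by omega
      refine (TrivialSymbol.of_isUnit_leadingCoeff hι ?_ hc.symm).swap hι
      rw [← residue_ne_zero_iff_isUnit, leadingCoeff, ← coeff_map, ← hn, coeff_natDegree,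
        leadingCoeff_ne_zero]
      exact hr0
    | succ k ih =>
      intro r hr hr0 hk hc
      have hXr : IsCoprime x (X * r) := hx.isCoprime_X.mul_right hc
      have hXdeg : (X * r).natDegree ≤ e :=
        natDegree_mul_le.trans (by rw [natDegree_X]; omega)
      have hXe : (X * r).coeff e = r.coeff (e - 1) := by
        conv_lhs => rw [show e = (e - 1) + 1 by omega]
        rw [coeff_X_mul]
      have hρ := ValuationRing.dvd_total (x.coeff e) (r.coeff (e - 1))
      by_cases hdvd : x.coeff e ∣ r.coeff (e - 1)
      -- `X * r - q x` again has degree below `e`, and its reduction has gained a degree because `x`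
      -- reduces to a constant.
      · obtain ⟨q, hq⟩ := hdvd
        refine .of_mul_right hι (hx.trivialSymbol_X hι) (.of_add_right (-C q) ?_) hx.isCoprime_X
        obtain ⟨v, hv, hxv⟩ := hx
        have hmap : (X * r + -C q * x).map (residue A) =
            X * r.map (residue A) - C (residue A q * v) := by
          simp [hxv]; ring
        have hnd : ((X * r + -C q * x).map (residue A)).natDegree =
            (r.map (residue A)).natDegree + 1 := by
          rw [hmap, natDegree_sub_C, natDegree_X_mul hr0]
        refine ih _ ?_ ?_ (by rw [hnd]; omega) ?_
        · refine natDegree_le_pred ?_ ?_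
          · refine (natDegree_add_le _ _).trans (max_le hXdeg ?_)
            rw [← C_neg]
            exact (natDegree_C_mul_le _ _).trans he.le
          · rw [coeff_add, hXe, ← C_neg, coeff_C_mul, hq]; ring
        · intro h0; rw [h0] at hnd; simp at hnd
        · exact hXr.add_mul_right_right (-C q)
      -- Here `y` lies in the maximal ideal, so `y X r - x` has degree below `e` and reduces to a
      -- nonzero constant: the outer induction applies with the entries exchanged.
      · obtain ⟨y, hy⟩ := hρ.resolve_left hdvd
        have hyu : ¬ IsUnit y := by
          rintro ⟨u, rfl⟩
          exact hdvd ⟨((u⁻¹ : Aˣ) : A), by rw [hy, mul_assoc]; simp⟩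
        have hy0 : y ≠ 0 := by rintro rfl; rw [mul_zero] at hy; exact hx0 hy
        have hyr : residue A y = 0 := by
          by_contra hne
          exact hyu ((residue_ne_zero_iff_isUnit _).1 hne)
        have hyX : IsCoprime x (C y * X) := (hx.isCoprime_C hy0).mul_right hx.isCoprime_X
        refine .of_mul_right hι (b₁ := C y * X) (.mul_right hι (hx.trivialSymbol_C hι hy0)
          (hx.trivialSymbol_X hι)) (.of_add_right (-1) ?_) hyX
        have hc' : IsCoprime x (C y * X * r + -1 * x) := (hyX.mul_right hc).add_mul_right_right _
        have hdeg : (C y * X * r + -1 * x).natDegree ≤ e - 1 := by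
          refine natDegree_le_pred ?_ ?_
          · refine (natDegree_add_le _ _).trans (max_le ?_ ?_)
            · rw [mul_assoc]
              exact (natDegree_C_mul_le _ _).trans hXdeg
            · rw [neg_one_mul, natDegree_neg]; exact he.le
          · rw [coeff_add, mul_assoc, coeff_C_mul, hXe, neg_one_mul, coeff_neg, hy]; ring
        refine (IH _ (by omega) ?_ hc'.symm rfl).swap hι
        obtain ⟨v, hv, hxv⟩ := hx
        exact ⟨-v, neg_ne_zero.2 hv, by simp [hxv, hyr]⟩
  induction hm : g.natDegree using Nat.strong_induction_on generalizing g with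
  | _ m IHm =>
  rcases Nat.lt_or_ge m e with hme | hme
  · obtain ⟨p, hp⟩ := IsDiscreteValuationRing.exists_irreducible A
    have hg0 : g ≠ 0 := by
      rintro rfl
      have := natDegree_eq_zero_of_isUnit (isCoprime_zero_right.1 h)
      omega
    have hCp : Irreducible (C p : A[X]) := (prime_C_iff.2 hp.prime).irreducible
    obtain ⟨k, r, hr, rfl⟩ := WfDvdMonoid.max_power_factor hg0 hCp
    have hr0 : r ≠ 0 := by rintro rfl; simp at hr
    rw [← C_pow] at hm h ⊢
    have hp0 : p ^ k ≠ 0 := pow_ne_zero _ hp.ne_zero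
    rw [natDegree_C_mul hp0] at hm
    refine .mul_right hι (hx.trivialSymbol_C hι hp0) (loop _ r (by omega) ?_ rfl
      h.of_mul_right_right)
    exact fun h0 => hr (C_dvd_of_map_residue_eq_zero hp h0)
  · refine .of_mul_right hι (hx.trivialSymbol_C hι hx0)
      (.of_add_right (-(C g.leadingCoeff * X ^ (m - e))) ?_) (hx.isCoprime_C hx0)
    refine IHm _ ?_ (((hx.isCoprime_C hx0).mul_right h).add_mul_right_right _) rfl
    have : (C (x.coeff e) * g + -(C g.leadingCoeff * X ^ (m - e)) * x).natDegree ≤ m - 1 := by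
      refine natDegree_le_pred ?_ ?_
      · refine (natDegree_add_le _ _).trans (max_le ((natDegree_C_mul_le _ _).trans hm.le) ?_)
        rw [neg_mul, natDegree_neg, mul_assoc]
        refine (natDegree_C_mul_le _ _).trans (natDegree_mul_le.trans ?_)
        rw [natDegree_X_pow, he]; omega
      · rw [coeff_add, coeff_C_mul, neg_mul, coeff_neg, mul_assoc, coeff_C_mul,
          coeff_X_pow_mul', if_pos (by omega), show m - (m - e) = e by omega, leadingCoeff, hm]
        ring
    omega

/-- The Euclidean algorithm for the reductions, with quotients lifted to `A[X]`, ends with one entry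
reducing to zero; coprimality makes the other a unit constant modulo the maximal ideal. -/
theorem TrivialSymbol.of_isCoprime {a b : A[X]} (h : IsCoprime a b) : TrivialSymbol ι a b := by
  have key : ∀ p q : (ResidueField A)[X], ∀ a b : A[X], a.map (residue A) = p →
      b.map (residue A) = q → IsCoprime a b → TrivialSymbol ι a b := by
    intro p q
    induction p, q using EuclideanDomain.GCD.induction with
    | H0 q =>
      intro a b ha hb h
      refine (UnitConstMod.trivialSymbol hι ?_ h.symm).swap hι
      have h1 := h.map (mapRingHom (residue A))
      simp only [coe_mapRingHom, ha, isCoprime_zero_left] at h1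
      obtain ⟨v, hv, hv'⟩ := Polynomial.isUnit_iff.1 h1
      exact ⟨v, hv.ne_zero, hv'.symm⟩
    | H1 p q hp ih =>
      intro a b ha hb h
      obtain ⟨l, hl⟩ := map_surjective _ (residue_surjective (R := A)) (q / p)
      refine .of_add_right (-l) ((ih _ _ ?_ ha ?_).swap hι)
      · rw [EuclideanDomain.mod_eq_sub_mul_div]
        simp [ha, hb, hl]; ring
      · exact (h.add_mul_right_right (-l)).symm
  exact key _ _ a b rfl rfl h

end DVR

/-! ### `SL_n = E_n` for polynomials over a discrete valuation ring -/

section DVR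

open Polynomial IsLocalRing Matrix

set_option linter.unusedSectionVars false

theorem det_planar {ι : Type*} [Fintype ι] [DecidableEq ι] {R : Type*} [CommRing R] {i j : ι}
    (hij : i ≠ j) (a b c d : R) : (planar i j a b c d).det = a * d - b * c := by
  rw [twoBlockTriangular_det _ (fun k => k = i ∨ k = j)]
  · have h2 : toSquareBlockProp (planar i j a b c d) (fun k => ¬(k = i ∨ k = j)) = 1 := by
      ext ⟨r, hr⟩ ⟨s, hs⟩
      push Not at hr
      simp [toSquareBlockProp, planar, hr, one_apply]
    rw [h2, det_one, mul_one]
    let f : Fin 2 → {k // k = i ∨ k = j} := ![⟨i, Or.inl rfl⟩, ⟨j, Or.inr rfl⟩]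
    have hf : Function.Bijective f := by
      constructor
      · intro x y h
        fin_cases x <;> fin_cases y <;> simp_all [f]
      · rintro ⟨k, rfl | rfl⟩
        exacts [⟨0, rfl⟩, ⟨1, rfl⟩]
    rw [← det_submatrix_equiv_self (Equiv.ofBijective f hf), det_fin_two]
    simp [f, toSquareBlockProp, planar, hij.symm]
  · intro r hr s hs
    push Not at hr
    simp only [planar, of_apply, hr.1, hr.2, if_false]
    rw [if_neg]
    rintro rfl
    tauto

theorem SupportedOn.eq_planar {ι : Type*} [Fintype ι] [DecidableEq ι] {R : Type*} [CommRing R]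
    {i j : ι} {X : Matrix ι ι R} (hX : SupportedOn {i, j} X) :
    X = planar i j (X i i) (X i j) (X j i) (X j j) := by
  ext r s
  simp only [planar, of_apply]
  by_cases hr : r = i
  · by_cases hs : s = i
    · simp [hr, hs]
    · by_cases hs' : s = j
      · subst hr; subst hs'; simp [hs]
      · rw [hX r s (Or.inr (by simp [hs, hs']))]; subst hr; simp [hs, hs', one_apply_ne (Ne.symm hs)]
  · by_cases hr' : r = j
    · by_cases hs : s = i
      · subst hs; subst hr'; simp [hr]
      · by_cases hs' : s = j
        · subst hs'; subst hr'; simp [hr]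
        · rw [hX r s (Or.inr (by simp [hs, hs']))]; subst hr'
          simp [hs, hs', hr, one_apply_ne (Ne.symm hs')]
    · rw [hX r s (Or.inl (by simp [hr, hr']))]; simp [hr, hr', one_apply]

/-- Take the product of the prime factors of `x` not dividing `g`. A prime factor of `x` dividing `g
+ l * h` then divides both `g` and `h`, which is how common factors are removed from a row. -/
theorem exists_prime_dvd_iff {K : Type*} [Field K] {x g : K[X]} (hx : x ≠ 0) :
    ∃ l : K[X], ∀ π : K[X], Prime π → π ∣ x → (π ∣ l ↔ ¬ π ∣ g) := by
  classical
  refine ⟨∏ π ∈ (UniqueFactorizationMonoid.normalizedFactors x).toFinset with ¬ π ∣ g, π, ?_⟩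
  intro π hπ hπx
  rw [hπ.dvd_finsetProd_iff]
  constructor
  · rintro ⟨ρ, hρ, hd⟩
    rw [Finset.mem_filter, Multiset.mem_toFinset] at hρ
    have hρp := UniqueFactorizationMonoid.prime_of_normalized_factor ρ hρ.1
    intro hg
    exact hρ.2 ((hπ.associated_of_dvd hρp hd).symm.dvd.trans hg)
  · intro hg
    obtain ⟨q, hq, hassoc⟩ := UniqueFactorizationMonoid.exists_mem_normalizedFactors_of_dvd hx
      hπ.irreducible hπx
    refine ⟨q, ?_, hassoc.dvd⟩
    rw [Finset.mem_filter, Multiset.mem_toFinset]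
    exact ⟨hq, fun h => hg (hassoc.dvd.trans h)⟩

variable {A : Type*} [CommRing A] [IsDomain A]

local notation "K" => FractionRing A

theorem exists_C_mul_eq_map (l : K[X]) :
    ∃ c : A, c ≠ 0 ∧ ∃ l' : A[X], l'.map (algebraMap A K) = C (algebraMap A K c) * l := by
  obtain ⟨c, hc, h⟩ := IsLocalization.integerNormalization_spec (nonZeroDivisors A) l
  refine ⟨c, nonZeroDivisors.ne_zero hc, _, h.trans ?_⟩
  ext n
  rw [coeff_C_mul]
  change (c • l).coeff n = _
  rw [coeff_smul, Algebra.smul_def]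

theorem exists_prime_dvd_map_iff {x g : A[X]} (hx : x ≠ 0) :
    ∃ l : A[X], ∀ π : K[X], Prime π → π ∣ x.map (algebraMap A K) →
      (π ∣ l.map (algebraMap A K) ↔ ¬ π ∣ g.map (algebraMap A K)) := by
  obtain ⟨l, hl⟩ := exists_prime_dvd_iff (x := x.map (algebraMap A K))
    (g := g.map (algebraMap A K))
    ((Polynomial.map_ne_zero_iff (IsFractionRing.injective A K)).2 hx)
  obtain ⟨c, hc, l', hl'⟩ := exists_C_mul_eq_map l
  refine ⟨l', fun π hπ hπx => ?_⟩
  rw [← hl π hπ hπx, hl']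
  have hu : IsUnit (C (algebraMap A K c)) := by
    rw [Polynomial.isUnit_C, isUnit_iff_ne_zero]
    exact (map_ne_zero_iff _ (IsFractionRing.injective A K)).2 hc
  exact hu.dvd_mul_left

theorem exists_C_mem_of_isCoprime_map {x g : A[X]}
    (h : IsCoprime (x.map (algebraMap A K)) (g.map (algebraMap A K))) :
    ∃ c : A, c ≠ 0 ∧ ∃ a b : A[X], a * x + b * g = C c := by
  obtain ⟨a, b, hab⟩ := h
  obtain ⟨c, hc, a', ha⟩ := exists_C_mul_eq_map a
  obtain ⟨d, hd, b', hb⟩ := exists_C_mul_eq_map b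
  refine ⟨c * d, mul_ne_zero hc hd, C d * a', C c * b', ?_⟩
  apply map_injective _ (IsFractionRing.injective A K)
  simp only [Polynomial.map_add, Polynomial.map_mul, Polynomial.map_C, ha, hb, map_mul]
  linear_combination C ((algebraMap A K) c) * C ((algebraMap A K) d) * hab

variable [IsDiscreteValuationRing A] {ι : Type*} [Fintype ι] [DecidableEq ι]

/-- Polynomials over the residue field form a Euclidean domain, so the reduced row can be cleared
there, and elementary matrices lift. -/
theorem exists_unitConstMod_row {s : Finset ι} {i : ι} (hi : i ∈ s) {X : Matrix ι ι A[X]}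
    (hX : SupportedOn s X) (hdet : X.det = 1) :
    ∃ B ∈ elemMonoid A[X] s, UnitConstMod ((X * B) i i) := by
  have hsurj : Function.Surjective (mapRingHom (residue A)) :=
    map_surjective _ residue_surjective
  obtain ⟨B', hB', h⟩ := exists_vecMul_eq_zero hi (X.map (mapRingHom (residue A)) i)
  obtain ⟨B, hB, rfl⟩ := elemMonoid_exists_map_eq _ hsurj hB'
  refine ⟨B, hB, ?_⟩
  have hd : ((X * B).map (mapRingHom (residue A))).det = 1 := by
    rw [← RingHom.mapMatrix_apply, ← RingHom.map_det, det_mul, hdet, elemMonoid_det hB, one_mul,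
      map_one]
  have hu := isUnit_of_row_eq_zero (i := i) hd (by
    intro j hj
    by_cases hjs : j ∈ s
    · rw [Matrix.map_mul]; exact h j hjs hj
    · rw [map_apply, (hX.mul (supportedOn_of_mem hB)) i j (Or.inr hjs), one_apply_ne hj.symm,
        map_zero])
  obtain ⟨v, hv, hv'⟩ := Polynomial.isUnit_iff.1 hu
  exact ⟨v, hv.ne_zero, hv'.symm⟩

/-- Over the fraction field, multiples of the other columns added to column `j` make entries `i` and
`j` coprime, since no prime divides the whole row. Bézout then holds over `A[X]` up to a nonzero
constant, which is comaximal with `X i i` because the latter is a unit constant modulo the maximal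
ideal. -/
theorem exists_coprime_row {s : Finset ι} {i j : ι} (hj : j ∈ s) (hij : i ≠ j)
    {X : Matrix ι ι A[X]} (hX : SupportedOn s X) (hdet : X.det = 1) (hx : UnitConstMod (X i i)) :
    ∃ B ∈ elemMonoid A[X] s, IsCoprime ((X * B) i i) ((X * B) i j) := by
  set φ := algebraMap A K
  have hx0 : X i i ≠ 0 := by
    obtain ⟨v, hv, hv'⟩ := hx
    intro h; rw [h, Polynomial.map_zero] at hv'; exact hv (C_eq_zero.1 hv'.symm)
  have key : ∀ t ⊆ (s.erase i).erase j, ∃ B ∈ elemMonoid A[X] s,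
      (∀ l, l ≠ j → (X * B) i l = X i l) ∧
      ∀ π : K[X], Prime π → π ∣ (X i i).map φ → π ∣ ((X * B) i j).map φ →
        π ∣ (X i j).map φ ∧ ∀ l ∈ t, π ∣ (X i l).map φ := by
    intro t
    induction t using Finset.induction_on with
    | empty => exact fun _ => ⟨1, one_mem _, by simp, by simp +contextual⟩
    | insert k t hk ih =>
      intro ht
      obtain ⟨B, hB, h1, h2⟩ := ih ((Finset.subset_insert _ _).trans ht)
      have hk' := ht (Finset.mem_insert_self k t)
      have hkj : k ≠ j := Finset.ne_of_mem_erase hk'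
      have hks : k ∈ s := Finset.mem_of_mem_erase (Finset.mem_of_mem_erase hk')
      obtain ⟨l, hl⟩ := exists_prime_dvd_map_iff (g := (X * B) i j) hx0
      refine ⟨B * transvection k j l, mul_mem hB (transvection_mem_elemMonoid hks hj hkj _),
        ?_, ?_⟩
      · intro m hm
        rw [← mul_assoc, mul_transvection_apply_of_ne _ _ _ _ hm, h1 m hm]
      · intro π hπ hπx hπd
        rw [← mul_assoc, mul_transvection_apply_same, h1 k hkj, Polynomial.map_add,
          Polynomial.map_mul] at hπd
        have hl' := hl π hπ hπx
        by_cases hg : π ∣ ((X * B) i j).map φ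
        · have h3 := (hπ.dvd_mul.1 ((dvd_add_right hg).1 hπd)).resolve_left
            (fun h => hl'.1 h hg)
          obtain ⟨h4, h5⟩ := h2 π hπ hπx hg
          refine ⟨h4, fun m hm => ?_⟩
          rcases Finset.mem_insert.1 hm with rfl | hm
          exacts [h3, h5 m hm]
        · exact absurd ((dvd_add_left ((hl'.2 hg).mul_right _)).1 hπd) hg
  obtain ⟨B, hB, h1, h2⟩ := key _ subset_rfl
  refine ⟨B, hB, ?_⟩
  rw [h1 i hij]
  have hc : IsCoprime ((X i i).map φ) (((X * B) i j).map φ) := by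
    refine isCoprime_of_prime_dvd ?_ ?_
    · rintro ⟨h, -⟩
      exact hx0 ((Polynomial.map_eq_zero_iff (IsFractionRing.injective A K)).1 h)
    · intro π hπ hπx hπg
      obtain ⟨h3, h4⟩ := h2 π hπ hπx hπg
      have h5 : ∀ l, π ∣ (X i l).map φ := by
        intro l
        by_cases hli : l = i
        · rwa [hli]
        by_cases hlj : l = j
        · rwa [hlj]
        by_cases hls : l ∈ s
        · exact h4 l (by simp [hli, hlj, hls])
        · rw [hX i l (Or.inr hls), one_apply_ne (Ne.symm hli), Polynomial.map_zero]
          exact dvd_zero _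
      have h6 : (X * X.adjugate) i i = 1 := by rw [mul_adjugate, hdet]; simp
      apply hπ.not_dvd_one
      rw [← Polynomial.map_one φ, ← h6, mul_apply, Polynomial.map_sum]
      refine Finset.dvd_sum fun l _ => ?_
      rw [Polynomial.map_mul]
      exact (h5 l).mul_right _
  obtain ⟨c, hc0, a, b, hab⟩ := exists_C_mem_of_isCoprime_map hc
  obtain ⟨u, v, huv⟩ := hx.isCoprime_C hc0
  exact ⟨u + v * a, v * b, by linear_combination huv + v * hab⟩

/-- Suslin: `SL_n(A[t]) = E_n(A[t])` for a discrete valuation ring `A` and `n ≥ 3`. -/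
theorem mem_elemMonoid_of_dvr (hι : 3 ≤ Fintype.card ι) {s : Finset ι} {X : Matrix ι ι A[X]}
    (hX : SupportedOn s X) (hdet : X.det = 1) : X ∈ elemMonoid A[X] .univ := by
  induction s using Finset.strongInduction generalizing X with
  | H s ih =>
    rcases Nat.lt_or_ge 2 s.card with hs | hs
    · obtain ⟨i, j, k, hi, hj, hk, hij, hik, hjk⟩ := Finset.two_lt_card_iff.1 hs
      obtain ⟨B, hB, h1⟩ := exists_unitConstMod_row hi hX hdet
      have hXB := hX.mul (supportedOn_of_mem hB)
      have hd : (X * B).det = 1 := by rw [det_mul, hdet, elemMonoid_det hB, one_mul]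
      obtain ⟨B', hB', a, b, hab⟩ := exists_coprime_row hj hij hXB hd h1
      set Y := X * B * B' with hY
      have hYs := hXB.mul (supportedOn_of_mem hB')
      rw [← hY] at hYs
      have hYd : Y.det = 1 := by rw [hY, det_mul, hd, elemMonoid_det hB', one_mul]
      -- Since `a * Y i i + b * Y i j = 1`, these multiples of columns `i` and `j` turn the entry
      -- `(i, k)` into `1`.
      have hT₁ := transvection_mem_elemMonoid hi hk hik ((1 - Y i k) * a)
      have hT₂ := transvection_mem_elemMonoid hj hk hjk ((1 - Y i k) * b)
      have h2 : (Y * transvection i k ((1 - Y i k) * a) *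
          transvection j k ((1 - Y i k) * b)) i k = 1 := by
        rw [mul_transvection_apply_same, mul_transvection_apply_same,
          mul_transvection_apply_of_ne _ _ _ _ hjk]
        linear_combination (1 - Y i k) * hab
      obtain ⟨C, hC, D, hD, hsup⟩ := exists_supportedOn_erase hi hk hik
        ((hYs.mul (supportedOn_of_mem hT₁)).mul (supportedOn_of_mem hT₂)) h2
      have := ih _ (Finset.erase_ssubset hi) hsup (by
        simp only [det_mul, hYd, elemMonoid_det hC, elemMonoid_det hD, elemMonoid_det hT₁,
          elemMonoid_det hT₂, mul_one])
      have hu := elemMonoid_mono (R := A[X]) (Finset.subset_univ s)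
      rwa [elemMonoid_mul_mem_cancel_right (hu hD), elemMonoid_mul_mem_cancel_left (hu hC),
        elemMonoid_mul_mem_cancel_right (hu hT₂), elemMonoid_mul_mem_cancel_right (hu hT₁),
        elemMonoid_mul_mem_cancel_right (hu hB'), elemMonoid_mul_mem_cancel_right (hu hB)] at this
    · rcases Nat.lt_or_ge 1 s.card with h1 | h1
      -- Triviality of the symbol uses a third index outside the support `{i, j}`, which is why
      -- membership is claimed over `.univ` only.
      · obtain ⟨i, j, hij, rfl⟩ := Finset.card_eq_two.1 (le_antisymm hs h1)
        have e := hX.eq_planar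
        rw [e, det_planar hij] at hdet
        rw [e]
        exact TrivialSymbol.of_isCoprime hι ⟨X j j, -X j i, by linear_combination hdet⟩ i j hij _ _
          hdet
      · rw [eq_one_of_supportedOn h1 hX hdet]; exact one_mem _

end DVR

/-! ### Patching: `SL_n(ℤ[t]) = E_n(ℤ[t])` -/

section Patching

open Polynomial Matrix

variable {ι : Type*} [Fintype ι] [DecidableEq ι]

/-- The ring endomorphism `t ↦ b t`. -/
noncomputable def scaleHom {S : Type*} [CommRing S] (b : S) : S[X] →+* S[X] :=
  compRingHom (C b * X)

theorem dvd_scaleHom_sub {S : Type*} [CommRing S] (b s : S) (g : S[X]) :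
    C s ∣ scaleHom (b + s) g - scaleHom b g := by
  have h := sub_dvd_eval_sub (C (b + s) * X) (C b * X) (g.map C)
  rw [eval_map, eval_map] at h
  refine Dvd.dvd.trans ⟨X, ?_⟩ h
  simp only [map_add]; ring

theorem scaleHom_map {S T : Type*} [CommRing S] [CommRing T] (f : S →+* T) (b : S) (g : S[X]) :
    (scaleHom b g).map f = scaleHom (f b) (g.map f) := by
  simp [scaleHom, Polynomial.map_comp]

variable {S A : Type*} [CommRing S] [CommRing A] (f : S →+* A)

/-- Products of elementary matrices with entries in `s S[t]`. -/
noncomputable def levelMonoid (ι : Type*) [Fintype ι] [DecidableEq ι] (s : S) : Submonoid (Matrix ι ι A[X]) :=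
  Submonoid.closure {M | ∃ i j, i ≠ j ∧ ∃ h : S[X], M = transvection i j ((C s * h).map f)}

theorem transvection_mem_levelMonoid {i j : ι} (hij : i ≠ j) {s : S} {h : S[X]} (hs : C s ∣ h) :
    transvection i j (h.map f) ∈ levelMonoid f ι s := by
  obtain ⟨h, rfl⟩ := hs
  exact Submonoid.subset_closure ⟨i, j, hij, h, rfl⟩

theorem levelMonoid_le {s s' : S} (h : s' ∣ s) : levelMonoid f ι s ≤ levelMonoid f ι s' := by
  refine (Submonoid.closure_le).2 ?_
  rintro _ ⟨i, j, hij, g, rfl⟩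
  exact transvection_mem_levelMonoid f hij ((map_dvd C h).mul_right g)

theorem transvection_commutator {R : Type*} [CommRing R] {i j k : ι} (hjk : j ≠ k)
    (hik : i ≠ k) (x y : R) : transvection i j x * transvection j k y =
      transvection i k (x * y) * transvection j k y * transvection i j x := by
  simp only [transvection, Matrix.mul_add, Matrix.add_mul, Matrix.one_mul, Matrix.mul_one,
    single_mul_single_same, single_mul_single_of_ne _ _ _ _ hjk.symm, single_mul_single_of_ne _ _ _ _ hik.symm, Matrix.zero_mul]
  abel

theorem transvection_comm {R : Type*} [CommRing R] {i j k l : ι} (hjk : j ≠ k) (hil : i ≠ l)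
    (x y : R) : transvection i j x * transvection k l y =
      transvection k l y * transvection i j x := by
  simp only [transvection, Matrix.mul_add, Matrix.add_mul, Matrix.one_mul, Matrix.mul_one,
    single_mul_single_of_ne _ _ _ _ hjk, single_mul_single_of_ne _ _ _ _ hil.symm]
  abel

theorem transvection_mul_neg_same {R : Type*} [CommRing R] {i j : ι} (hij : i ≠ j) (x : R) :
    transvection i j x * transvection i j (-x) = 1 := by
  rw [transvection_mul_transvection_same _ _ hij]; simp

theorem transvection_eq_commutator {R : Type*} [CommRing R] {i j k : ι} (hij : i ≠ j)
    (hjk : j ≠ k) (hik : i ≠ k) (x y : R) : transvection i k (x * y) =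
      transvection i j x * transvection j k y * (transvection i j (-x) * transvection j k (-y)) := by
  rw [transvection_commutator hjk hik, mul_assoc, ← mul_assoc (transvection i j x),
    transvection_mul_neg_same hij, one_mul, mul_assoc, transvection_mul_neg_same hjk, mul_one]

/-- The commutator formula multiplies the two coefficients, and the factor `d` of `x` cancels the
denominator of `a`. Only the opposite root `(q, p)` has no such formula. -/
theorem exists_conj_transvection_of_ne {p q : ι} (hpq : p ≠ q) {a : A[X]} {d : S} {g : S[X]}
    (hd : C (f d) * a = g.map f) (s : S) {i j : ι} (hij : i ≠ j) (h : ¬(i = q ∧ j = p))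
    {x : S[X]} (hx : C (d * s) ∣ x) :
    ∃ D ∈ levelMonoid f ι s,
      transvection p q a * transvection i j (x.map f) = D * transvection p q a := by
  obtain ⟨x, rfl⟩ := hx
  have hmem : ∀ k l : ι, k ≠ l → transvection k l ((C (d * s) * x).map f) ∈ levelMonoid f ι s :=
    fun k l hkl => transvection_mem_levelMonoid f hkl
      ((map_dvd C (Dvd.intro_left d rfl)).mul_right x)
  have hax : a * (C (d * s) * x).map f = (C s * (g * x)).map f := by
    simp only [Polynomial.map_mul, map_C, map_mul, ← hd]; ring
  have hmem' : ∀ k l : ι, k ≠ l → ∀ c : S[X],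
      transvection k l ((C s * c).map f) ∈ levelMonoid f ι s :=
    fun k l hkl c => transvection_mem_levelMonoid f hkl (Dvd.intro _ rfl)
  by_cases hiq : i = q
  · have hjp : j ≠ p := fun hjp => h ⟨hiq, hjp⟩
    subst hiq
    refine ⟨_, mul_mem (hmem' p j hjp.symm (g * x)) (hmem i j hij), ?_⟩
    rw [transvection_commutator hij hjp.symm, hax]
  · by_cases hjp : j = p
    · subst hjp
      refine ⟨_, mul_mem (hmem' i q hiq (-(g * x))) (hmem i j hij), ?_⟩
      have h1 := transvection_commutator hpq hiq ((C (d * s) * x).map f) a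
      rw [mul_comm _ a, hax] at h1
      have h2 : (C s * -(g * x)).map f = -(C s * (g * x)).map f := by
        rw [mul_neg, Polynomial.map_neg]
      rw [h2, mul_assoc _ (transvection i j _), h1, ← mul_assoc, ← mul_assoc]
      have h3 := transvection_mul_neg_same hiq (-(C s * (g * x)).map f)
      rw [neg_neg] at h3
      rw [h3, one_mul]
    · exact ⟨_, hmem i j hij, transvection_comm (Ne.symm hiq) (Ne.symm hjp) _ _⟩

/-- The opposite root is reached through a third index: a transvection with coefficient divisible by
`(d s)²` is a commutator of two with coefficients divisible by `d s`, neither of them opposite. -/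
theorem exists_conj_transvection (hι : 3 ≤ Fintype.card ι) {p q : ι} (hpq : p ≠ q) {a : A[X]}
    {d : S} {g : S[X]} (hd : C (f d) * a = g.map f) (s : S) {D : Matrix ι ι A[X]}
    (hD : D ∈ levelMonoid f ι ((d * s) * (d * s))) :
    ∃ D' ∈ levelMonoid f ι s, transvection p q a * D = D' * transvection p q a := by
  induction hD using Submonoid.closure_induction with
  | mem M hM =>
    obtain ⟨i, j, hij, x, rfl⟩ := hM
    by_cases h : i = q ∧ j = p
    · obtain ⟨l, hli, hlj⟩ := TrivialSymbol.exists_third hι i j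
      have hy : C (d * s) ∣ (C (d * s) : S[X]) := dvd_rfl
      have hy' : C (d * s) ∣ (-C (d * s) : S[X]) := (dvd_neg).2 dvd_rfl
      have hz : C (d * s) ∣ C (d * s) * x := Dvd.intro _ rfl
      have hz' : C (d * s) ∣ -(C (d * s) * x) := (dvd_neg).2 hz
      have e : transvection i j ((C (d * s * (d * s)) * x).map f) =
          transvection i l ((C (d * s)).map f) * transvection l j ((C (d * s) * x).map f) *
          (transvection i l ((-C (d * s)).map f) * transvection l j ((-(C (d * s) * x)).map f)) := by
        rw [Polynomial.map_neg, Polynomial.map_neg, ← transvection_eq_commutator hli.symm hlj hij,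
          ← Polynomial.map_mul]
        congr 2
        rw [C_mul]; ring
      have n1 : ¬ (i = q ∧ l = p) := fun h' => hlj (h'.2.trans h.2.symm)
      have n2 : ¬ (l = q ∧ j = p) := fun h' => hli (h'.1.trans h.1.symm)
      obtain ⟨D₁, hD₁, e₁⟩ := exists_conj_transvection_of_ne f hpq hd s hli.symm n1 hy
      obtain ⟨D₂, hD₂, e₂⟩ := exists_conj_transvection_of_ne f hpq hd s hlj n2 hz
      obtain ⟨D₃, hD₃, e₃⟩ := exists_conj_transvection_of_ne f hpq hd s hli.symm n1 hy'
      obtain ⟨D₄, hD₄, e₄⟩ := exists_conj_transvection_of_ne f hpq hd s hlj n2 hz'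
      refine ⟨D₁ * D₂ * (D₃ * D₄), mul_mem (mul_mem hD₁ hD₂) (mul_mem hD₃ hD₄), ?_⟩
      rw [e]
      exact ((show SemiconjBy _ _ _ from e₁).mul_right e₂).mul_right
        ((show SemiconjBy _ _ _ from e₃).mul_right e₄)
    · exact exists_conj_transvection_of_ne f hpq hd s hij h
        ((_root_.map_dvd C (Dvd.intro _ rfl)).mul_right x)
  | one => exact ⟨1, one_mem _, by simp⟩
  | mul D₁ D₂ _ _ h₁ h₂ =>
    obtain ⟨D₁', h₁', e₁⟩ := h₁
    obtain ⟨D₂', h₂', e₂⟩ := h₂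
    exact ⟨D₁' * D₂', mul_mem h₁' h₂', by
      rw [← mul_assoc, e₁, mul_assoc, e₂, mul_assoc]⟩

/-- Quillen's patching estimate: moving the scaling parameter of `M` by multiples of a suitable `s`
changes `M` only by a factor coming from `S`. In a product, the correction of one factor must be
carried past the other, so the conjugation statement is part of the induction. -/
theorem exists_level (hι : 3 ≤ Fintype.card ι) (U : Submonoid S)
    (hden : ∀ a : A[X], ∃ d ∈ U, ∃ g : S[X], C (f d) * a = g.map f)
    (hreg : ∀ d ∈ U, IsUnit (f d))
    {M : Matrix ι ι A[X]} (hM : M ∈ elemMonoid A[X] .univ) :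
    ∀ s' ∈ U, ∃ s ∈ U,
      (∀ b c : S, ∃ D ∈ levelMonoid f ι s',
        M.map (scaleHom (f (b + s * c))) = D * M.map (scaleHom (f b))) ∧
      (∀ b : S, ∀ D ∈ levelMonoid f ι s, ∃ D' ∈ levelMonoid f ι s',
        M.map (scaleHom (f b)) * D = D' * M.map (scaleHom (f b))) := by
  induction hM using Submonoid.closure_induction with
  | mem M hM =>
    obtain ⟨i, -, j, -, hij, a, rfl⟩ := hM
    intro s' hs'
    obtain ⟨d, hd, g, hg⟩ := hden a
    have hgb : ∀ b : S, C (f d) * scaleHom (f b) a = (scaleHom b g).map f := by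
      intro b
      rw [scaleHom_map, ← hg, map_mul]
      congr 1
      simp [scaleHom]
    refine ⟨(d * s') * (d * s'), mul_mem (mul_mem hd hs') (mul_mem hd hs'), ?_, ?_⟩
    · intro b c
      obtain ⟨h, hh⟩ := dvd_scaleHom_sub b (d * s' * (d * s') * c) g
      refine ⟨_, transvection_mem_levelMonoid f hij (h := C s' * (C (d * s' * c) * h))
        (Dvd.intro _ rfl), ?_⟩
      rw [transvection_map_ringHom, transvection_map_ringHom,
        transvection_mul_transvection_same _ _ hij]
      congr 1
      have hu : IsUnit (C (f d)) := (hreg d hd).map C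
      apply hu.mul_left_cancel
      rw [mul_add, hgb, hgb, sub_eq_iff_eq_add.1 hh]
      simp only [Polynomial.map_mul, Polynomial.map_add, map_mul, map_C]
      ring
    · intro b D hD
      rw [transvection_map_ringHom]
      exact exists_conj_transvection f hι hij (hgb b) s' hD
  | one =>
    intro s' hs'
    have h1 : ∀ b : A, (1 : Matrix ι ι A[X]).map (scaleHom b) = 1 := fun b =>
      Matrix.map_one _ (map_zero _) (map_one _)
    refine ⟨s', hs', fun b c => ⟨1, one_mem _, by rw [h1, h1, one_mul]⟩,
      fun b D hD => ⟨D, hD, by rw [h1, one_mul, mul_one]⟩⟩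
  | mul M₁ M₂ _ _ h₁ h₂ =>
    intro s' hs'
    obtain ⟨s₁, hs₁, p₁, q₁⟩ := h₁ s' hs'
    obtain ⟨s₂, hs₂, p₂, q₂⟩ := h₂ s₁ hs₁
    refine ⟨s₁ * s₂, mul_mem hs₁ hs₂, ?_, ?_⟩
    · intro b c
      obtain ⟨D₁, hD₁, e₁⟩ := p₁ b (s₂ * c)
      obtain ⟨D₂, hD₂, e₂⟩ := p₂ b (s₁ * c)
      obtain ⟨D₃, hD₃, e₃⟩ := q₁ b D₂ hD₂
      refine ⟨D₁ * D₃, mul_mem hD₁ hD₃, ?_⟩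
      rw [Matrix.map_mul, Matrix.map_mul, show s₁ * s₂ * c = s₁ * (s₂ * c) by ring, e₁,
        show s₁ * (s₂ * c) = s₂ * (s₁ * c) by ring, e₂, mul_assoc D₁, ← mul_assoc _ D₂, e₃]
      simp only [mul_assoc]
    · intro b D hD
      obtain ⟨D₂, hD₂, e₂⟩ := q₂ b D (levelMonoid_le f (Dvd.intro_left _ rfl) hD)
      obtain ⟨D₁, hD₁, e₁⟩ := q₁ b D₂ hD₂
      exact ⟨D₁, hD₁, by rw [Matrix.map_mul, mul_assoc, e₂, ← mul_assoc, e₁, mul_assoc]⟩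

theorem exists_map_eq_of_mem_levelMonoid {s : S} {D : Matrix ι ι A[X]}
    (hD : D ∈ levelMonoid f ι s) :
    ∃ D' ∈ elemMonoid S[X] (.univ : Finset ι), D'.map (mapRingHom f) = D := by
  induction hD using Submonoid.closure_induction with
  | mem M hM =>
    obtain ⟨i, j, hij, x, rfl⟩ := hM
    exact ⟨_, transvection_mem_elem hij (C s * x), transvection_map_ringHom _ _ _ _⟩
  | one => exact ⟨1, one_mem _, Matrix.map_one _ (map_zero _) (map_one _)⟩
  | mul D₁ D₂ _ _ h₁ h₂ =>
    obtain ⟨D₁', h₁', e₁⟩ := h₁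
    obtain ⟨D₂', h₂', e₂⟩ := h₂
    exact ⟨D₁' * D₂', mul_mem h₁' h₂', by rw [Matrix.map_mul, e₁, e₂]⟩

/-- Suslin: `SL_n(ℤ[t]) = E_n(ℤ[t])` for `n ≥ 3`. -/
theorem mem_elemMonoid_polynomial_int (hι : 3 ≤ Fintype.card ι) {Y : Matrix ι ι ℤ[X]}
    (hdet : Y.det = 1) : Y ∈ elemMonoid ℤ[X] .univ := by
  -- Quillen's ideal: changing `b` by multiples of `s` changes `Y(bt)` by an elementary factor. Once
  -- it contains `1`, comparing the parameters `1` and `0` relates `Y` to the integral matrix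
  -- `Y(0)`.
  let J : Ideal ℤ :=
    { carrier := {s | ∀ b c : ℤ, ∃ D ∈ elemMonoid ℤ[X] .univ,
        Y.map (scaleHom (b + s * c)) = D * Y.map (scaleHom b)}
      zero_mem' := fun b c => ⟨1, one_mem _, by simp⟩
      add_mem' := by
        intro s s' h h' b c
        obtain ⟨D, hD, e⟩ := h (b + s' * c) c
        obtain ⟨D', hD', e'⟩ := h' b c
        exact ⟨D * D', mul_mem hD hD', by
          rw [show b + (s + s') * c = b + s' * c + s * c by ring, e, e', mul_assoc]⟩
      smul_mem' := by
        intro r s h b c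
        obtain ⟨D, hD, e⟩ := h b (r * c)
        exact ⟨D, hD, by
          rw [← e]; congr 3; rw [smul_eq_mul]; ring⟩ }
  -- Otherwise localize at a maximal ideal containing `J`. Over this discrete valuation ring `Y`
  -- becomes elementary, and `exists_level` yields an element of `J` outside that maximal ideal.
  have hJ : J = ⊤ := by
    by_contra hne
    obtain ⟨P, hP, hJP⟩ := J.exists_le_maximal hne
    have hP0 : P ≠ ⊥ := Ring.ne_bot_of_isMaximal_of_not_isField hP Int.not_isField
    have hprime := hP.isPrime
    let A := Localization.AtPrime P
    have : IsDiscreteValuationRing A :=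
      IsLocalization.AtPrime.isDiscreteValuationRing_of_dedekind_domain ℤ hP0 A
    let f : ℤ →+* A := algebraMap ℤ A
    have hinj : Function.Injective f :=
      IsLocalization.injective A P.primeCompl_le_nonZeroDivisors
    have hY := mem_elemMonoid_of_dvr hι (supportedOn_univ (Y.map (mapRingHom f))) (by
      rw [← RingHom.mapMatrix_apply, ← RingHom.map_det, hdet, map_one])
    obtain ⟨s, hs, h, -⟩ := exists_level f hι P.primeCompl (fun a => by
        obtain ⟨d, hd, h⟩ := IsLocalization.integerNormalization_spec P.primeCompl a
        refine ⟨d, hd, _, (h.trans ?_).symm⟩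
        ext n
        rw [coeff_C_mul, coeff_smul, Algebra.smul_def])
      (fun d hd => IsLocalization.map_units A (⟨d, hd⟩ : P.primeCompl)) hY 1 (one_mem _)
    refine hs (hJP ?_)
    intro b c
    obtain ⟨D, hD, e⟩ := h b c
    obtain ⟨D', hD', rfl⟩ := exists_map_eq_of_mem_levelMonoid f hD
    refine ⟨D', hD', ?_⟩
    have hcomm : ∀ b : ℤ, (Y.map (mapRingHom f)).map (scaleHom (f b)) =
        (Y.map (scaleHom b)).map (mapRingHom f) := by
      intro b
      ext1 i j
      simp only [Matrix.map_apply, coe_mapRingHom, scaleHom_map]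
    rw [hcomm, hcomm, ← Matrix.map_mul] at e
    exact Matrix.map_injective (map_injective f hinj) e
  have h1 : (1 : ℤ) ∈ J := by rw [hJ]; trivial
  obtain ⟨D, hD, e⟩ := h1 0 1
  have e1 : Y.map (scaleHom (0 + 1 * 1 : ℤ)) = Y := by
    ext1 i j
    simp [scaleHom]
  have e2 : Y.map (scaleHom (0 : ℤ)) = (Y.map (evalRingHom 0)).map C := by
    ext1 i j
    simp [scaleHom]
  rw [e1, e2] at e
  rw [e]
  refine mul_mem hD (elemMonoid_map C (mem_elemMonoid_of_euclidean (supportedOn_univ _) ?_))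
  rw [← RingHom.mapMatrix_apply, ← RingHom.map_det, hdet, map_one]

end Patching

/-! ### `SL_n(ℤ[t, t⁻¹]) = E_n(ℤ[t, t⁻¹])` -/

section Laurent

open Polynomial Matrix

set_option linter.unusedSectionVars false

variable {ι : Type*} [Fintype ι] [DecidableEq ι]

/-- The diagonal matrix with entry `u` at `i` and `1` elsewhere. -/
def diagAt {R : Type*} [CommRing R] (i : ι) (u : R) : Matrix ι ι R :=
  diagonal (Function.update 1 i u)

theorem diagAt_mul_diagAt {R : Type*} [CommRing R] (i : ι) (u v : R) :
    diagAt i u * diagAt i v = diagAt i (u * v) := by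
  rw [diagAt, diagAt, diagonal_mul_diagonal, diagAt]
  congr 1
  ext k
  by_cases hk : k = i
  · subst hk; simp
  · simp [hk]

theorem diagAt_det {R : Type*} [CommRing R] (i : ι) (u : R) : (diagAt i u).det = u := by
  rw [diagAt, det_diagonal, Finset.prod_update_of_mem (Finset.mem_univ i)]
  simp

theorem diagAt_map {R S : Type*} [CommRing R] [CommRing S] (f : R →+* S) (i : ι) (u : R) :
    (diagAt i u).map f = diagAt i (f u) := by
  rw [diagAt, diagonal_map (map_zero f), diagAt]
  congr 1
  ext k
  by_cases hk : k = i
  · subst hk; simp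
  · simp [hk]

theorem exists_diagAt_mul_eq {R : Type*} [CommRing R] (i : ι) (u : Rˣ) {M : Matrix ι ι R}
    (hM : M ∈ elemMonoid R .univ) :
    ∃ M' ∈ elemMonoid R .univ, diagAt i (u : R) * M = M' * diagAt i (u : R) := by
  induction hM using Submonoid.closure_induction with
  | mem M hM =>
    obtain ⟨p, -, q, -, hpq, c, rfl⟩ := hM
    refine ⟨_, transvection_mem_elem hpq
      (Function.update (1 : ι → R) i (u : R) p * c *
        Function.update (1 : ι → R) i ((u⁻¹ : Rˣ) : R) q), ?_⟩
    ext a b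
    rw [diagAt, diagonal_mul, mul_diagonal]
    simp only [transvection, Matrix.add_apply, one_apply, single_apply]
    have hu : ∀ k, Function.update (1 : ι → R) i ((u⁻¹ : Rˣ) : R) k *
        Function.update (1 : ι → R) i (u : R) k = 1 := by
      intro k
      by_cases hk : k = i
      · subst hk; simp
      · simp [hk]
    by_cases hab : a = b
    · subst hab
      have : ¬ (p = a ∧ q = a) := by rintro ⟨rfl, rfl⟩; exact hpq rfl
      simp [this]
    · by_cases h : p = a ∧ q = b
      · obtain ⟨rfl, rfl⟩ := h
        simp only [hab, if_false, and_self, if_true, zero_add]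
        rw [mul_assoc, hu, mul_one]
      · simp [hab, h]
  | one => exact ⟨1, one_mem _, by simp⟩
  | mul M₁ M₂ _ _ h₁ h₂ =>
    obtain ⟨M₁', h₁', e₁⟩ := h₁
    obtain ⟨M₂', h₂', e₂⟩ := h₂
    exact ⟨M₁' * M₂', mul_mem h₁' h₂', (show SemiconjBy _ _ _ from e₁).mul_right e₂⟩

/-- This is the product of the planar matrices `diag(u, u⁻¹)` in the planes `(i, k)`, `k ∈ t`. -/
theorem diagonal_mem_elemMonoid {R : Type*} [CommRing R] (i : ι) (u : Rˣ) (t : Finset ι)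
    (ht : i ∉ t) : diagonal (fun k => if k = i then (u : R) ^ t.card else
      if k ∈ t then ((u⁻¹ : Rˣ) : R) else 1) ∈ elemMonoid R .univ := by
  induction t using Finset.induction_on with
  | empty =>
    convert one_mem (elemMonoid R (Finset.univ : Finset ι)) using 1
    rw [← diagonal_one]
    simp
  | insert j t hj ih =>
    have hij : i ≠ j := by rintro rfl; simp at ht
    have hit : i ∉ t := fun h => ht (Finset.mem_insert_of_mem h)
    convert mul_mem (TrivialSymbol.unit_left u.isUnit 0 i j hij 0 ((u⁻¹ : Rˣ) : R) (by simp))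
      (ih hit) using 1
    ext a b
    rw [planar_mul_apply hij, Finset.card_insert_of_notMem hj, pow_succ]
    simp only [diagonal_apply, Finset.mem_insert]
    by_cases ha : a = i
    · subst ha
      by_cases hab : a = b
      · subst hab; simp [mul_comm]
      · simp [hab]
    · by_cases haj : a = j
      · subst haj
        by_cases hab : a = b
        · subst hab; simp [ha, hj]
        · simp [ha, hab]
      · by_cases hab : a = b
        · subst hab; simp [ha, haj]
        · simp [ha, haj, hab]

/-- Euclid reduces a left kernel vector to a nonzero multiple of the `i`-th basis vector; in the new
coordinates row `i` vanishes. -/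
theorem exists_row_eq_zero {M : Matrix ι ι ℤ} (h : M.det = 0) (i : ι) :
    ∃ A ∈ elemMonoid ℤ (.univ : Finset ι), ∃ B ∈ elemMonoid ℤ (.univ : Finset ι),
      A * B = 1 ∧ ∀ k, (B * M) i k = 0 := by
  obtain ⟨v, hv0, hv⟩ := Matrix.exists_vecMul_eq_zero_iff.2 h
  obtain ⟨A, hA, hA'⟩ := exists_vecMul_eq_zero (Finset.mem_univ i) v
  obtain ⟨B, hB, hAB, hBA⟩ := elemMonoid_exists_inv hA
  refine ⟨A, hA, B, hB, hAB, fun k => ?_⟩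
  have h1 : (v ᵥ* A) ᵥ* (B * M) = 0 := by
    rw [vecMul_vecMul, ← mul_assoc, hAB, one_mul, hv]
  have h2 : (v ᵥ* A) i ≠ 0 := by
    intro h0
    apply hv0
    have : v ᵥ* A = 0 := by
      ext j
      by_cases hj : j = i
      · rw [hj, h0]; rfl
      · exact hA' j (Finset.mem_univ j) hj
    rw [← vecMul_one v, ← hAB, ← vecMul_vecMul, this, zero_vecMul]
  have h3 := congrFun h1 k
  rw [vecMul, dotProduct, Finset.sum_eq_single i (fun j _ hj => by
    rw [hA' j (Finset.mem_univ j) hj, zero_mul]) (by simp)] at h3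
  exact (mul_eq_zero.1 h3).resolve_left h2

/-- For positive exponent `Y(0)` is singular, so an integral elementary change makes row `i`
divisible by `X`. Splitting off `diagAt i X` lowers the exponent, and over Laurent polynomials this
diagonal unit can be moved past elementary factors. -/
theorem exists_eq_mul_diagAt (hι : 3 ≤ Fintype.card ι) (i : ι) (m : ℕ) {Y : Matrix ι ι ℤ[X]}
    (hY : Y.det = X ^ m) : ∃ A ∈ elemMonoid ℤ[T;T⁻¹] .univ,
      Y.map toLaurent = A * diagAt i (LaurentPolynomial.T m : ℤ[T;T⁻¹]) := by
  induction m generalizing Y with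
  | zero =>
    refine ⟨_, elemMonoid_map toLaurent (mem_elemMonoid_polynomial_int hι (by simpa using hY)), ?_⟩
    have : diagAt i (LaurentPolynomial.T (0 : ℕ) : ℤ[T;T⁻¹]) = (1 : Matrix ι ι ℤ[T;T⁻¹]) := by
      rw [diagAt, Nat.cast_zero, LaurentPolynomial.T_zero, ← diagonal_one]
      congr 1
      exact Function.update_eq_self i _
    rw [this, mul_one]
  | succ m ih =>
    have h0 : (Y.map (evalRingHom 0)).det = 0 := by
      rw [← RingHom.mapMatrix_apply, ← RingHom.map_det, hY]; simp
    obtain ⟨A, hA, B, hB, hAB, hrow⟩ := exists_row_eq_zero h0 i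
    have hAC := elemMonoid_map (C : ℤ →+* ℤ[X]) hA
    have hBC := elemMonoid_map (C : ℤ →+* ℤ[X]) hB
    have hABC : A.map C * B.map C = (1 : Matrix ι ι ℤ[X]) := by
      rw [← Matrix.map_mul, hAB, Matrix.map_one (C : ℤ →+* ℤ[X]) (map_zero _) (map_one _)]
    have hdiv : ∀ k, ∃ y, (B.map C * Y) i k = X * y := by
      intro k
      refine X_dvd_iff.2 ?_
      have hB0 : (B.map C).map (evalRingHom (0 : ℤ)) = B := by
        ext1 a b; simp
      have := hrow k
      rw [← hB0, ← Matrix.map_mul, map_apply, coe_evalRingHom, ← coeff_zero_eq_eval_zero] at this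
      exact this
    choose y hy using hdiv
    have hYe : B.map C * Y = diagAt i X * (B.map C * Y).updateRow i y := by
      ext1 a b
      rw [diagAt, diagonal_mul]
      by_cases ha : a = i
      · subst ha; simp [hy]
      · simp [ha]
    set Z := (B.map C * Y).updateRow i y with hZ
    have hZd : Z.det = X ^ m := by
      have := congrArg det hYe
      rw [det_mul, det_mul, elemMonoid_det hBC, one_mul, hY, diagAt_det, pow_succ'] at this
      exact (mul_left_cancel₀ X_ne_zero this).symm
    obtain ⟨D, hD, hDe⟩ := ih hZd
    let u : (ℤ[T;T⁻¹])ˣ := ⟨LaurentPolynomial.T 1, LaurentPolynomial.T (-1),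
      by rw [← LaurentPolynomial.T_add]; simp, by rw [← LaurentPolynomial.T_add]; simp⟩
    obtain ⟨D', hD', hDe'⟩ := exists_diagAt_mul_eq i u hD
    refine ⟨(A.map C).map toLaurent * D', mul_mem (elemMonoid_map toLaurent hAC) hD', ?_⟩
    have hY' : Y = A.map C * (diagAt i X * Z) := by
      rw [← hYe, ← mul_assoc, hABC, one_mul]
    conv_lhs => rw [hY']
    rw [Matrix.map_mul, Matrix.map_mul, diagAt_map, hDe, toLaurent_X, ← mul_assoc (diagAt i _),
      show (LaurentPolynomial.T 1 : ℤ[T;T⁻¹]) = u from rfl, hDe', mul_assoc D', diagAt_mul_diagAt,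
      show (u : ℤ[T;T⁻¹]) = LaurentPolynomial.T 1 from rfl, ← LaurentPolynomial.T_add, ← mul_assoc]
    congr 3
    push_cast
    ring

theorem exists_map_toLaurent_eq (Z : Matrix ι ι ℤ[T;T⁻¹]) :
    ∃ (k : ℕ) (Y : Matrix ι ι ℤ[X]), Y.map toLaurent = (LaurentPolynomial.T k : ℤ[T;T⁻¹]) • Z := by
  choose N f hf using fun p : ι × ι => LaurentPolynomial.exists_T_pow (Z p.1 p.2)
  refine ⟨∑ p, N p, Matrix.of fun a b => X ^ (∑ p, N p - N (a, b)) * f (a, b), ?_⟩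
  ext1 a b
  have hle : N (a, b) ≤ ∑ p, N p := Finset.single_le_sum (fun _ _ => Nat.zero_le _)
    (Finset.mem_univ (a, b))
  rw [map_apply, of_apply, map_mul, hf, map_pow, toLaurent_X, LaurentPolynomial.T_pow,
    Matrix.smul_apply, smul_eq_mul, mul_left_comm, mul_comm, ← LaurentPolynomial.T_add, mul_one, ← Nat.cast_add,
    Nat.sub_add_cancel hle, mul_comm]

theorem mem_elemMonoid_laurent_int (hι : 3 ≤ Fintype.card ι) {Z : Matrix ι ι ℤ[T;T⁻¹]}
    (hdet : Z.det = 1) : Z ∈ elemMonoid ℤ[T;T⁻¹] .univ := by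
  obtain ⟨i⟩ : Nonempty ι := Fintype.card_pos_iff.1 (by omega)
  obtain ⟨k, Y, hY⟩ := exists_map_toLaurent_eq Z
  have hYd : Y.det = X ^ (k * Fintype.card ι) := by
    apply Polynomial.toLaurent_injective
    have := congrArg det hY
    rw [det_smul, hdet, mul_one, LaurentPolynomial.T_pow, ← RingHom.mapMatrix_apply,
      ← RingHom.map_det] at this
    rw [this, map_pow, toLaurent_X, LaurentPolynomial.T_pow]
    congr 1; push_cast; ring
  obtain ⟨A, hA, hAe⟩ := exists_eq_mul_diagAt hι i _ hYd
  let u : (ℤ[T;T⁻¹])ˣ := ⟨LaurentPolynomial.T k, LaurentPolynomial.T (-k),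
    by rw [← LaurentPolynomial.T_add]; simp, by rw [← LaurentPolynomial.T_add]; simp⟩
  -- The scalar `T^(-k)` and `diagAt i (T^(k n))`, with `n` the size, combine to the determinant-one
  -- matrix of `diagonal_mem_elemMonoid`.
  have hZ : Z = A * diagonal (fun j => if j = i then (u : ℤ[T;T⁻¹]) ^ (Finset.univ.erase i).card else
      if j ∈ Finset.univ.erase i then ((u⁻¹ : (ℤ[T;T⁻¹])ˣ) : ℤ[T;T⁻¹]) else 1) := by
    have h1 : Z = ((u⁻¹ : (ℤ[T;T⁻¹])ˣ) : ℤ[T;T⁻¹]) • Y.map toLaurent := by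
      rw [hY, smul_smul]
      change _ = (((u⁻¹ : (ℤ[T;T⁻¹])ˣ) : ℤ[T;T⁻¹]) * u) • Z
      simp
    rw [h1, hAe, ← mul_smul_comm]
    congr 1
    ext1 a b
    rw [Matrix.smul_apply, diagAt, diagonal_apply, diagonal_apply]
    by_cases hab : a = b
    · subst hab
      by_cases ha : a = i
      · subst ha
        simp only [if_true, Function.update_self, smul_eq_mul]
        rw [Finset.card_erase_of_mem (Finset.mem_univ a), Finset.card_univ]
        change LaurentPolynomial.T (-k) * _ = (LaurentPolynomial.T k) ^ _
        rw [LaurentPolynomial.T_pow, ← LaurentPolynomial.T_add]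
        congr 1
        rw [Nat.cast_sub (by omega)]
        push_cast
        ring
      · simp [ha]
    · simp [hab]
  rw [hZ]
  exact mul_mem hA (diagonal_mem_elemMonoid i u _ (by simp))

end Laurent

/-! ### Biadditive functions of orthogonal pairs -/

section Biadditive

set_option linter.unusedSectionVars false

open Matrix

variable {ι : Type*} [Fintype ι] [DecidableEq ι]

/-- A function of pairs of orthogonal integral vectors that is additive in each variable. -/
structure IsOrthoBiadditive (φ : (ι → ℤ) → (ι → ℤ) → ℚ) : Prop where
  add_left : ∀ v v' u, v ⬝ᵥ u = 0 → v' ⬝ᵥ u = 0 → φ (v + v') u = φ v u + φ v' u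
  add_right : ∀ v u u', v ⬝ᵥ u = 0 → v ⬝ᵥ u' = 0 → φ v (u + u') = φ v u + φ v u'

namespace IsOrthoBiadditive

variable {φ : (ι → ℤ) → (ι → ℤ) → ℚ} (h : IsOrthoBiadditive φ)

include h

theorem swap : IsOrthoBiadditive (fun v u => φ u v) :=
  ⟨fun v v' u h1 h2 => h.add_right u v v' (by rwa [dotProduct_comm]) (by rwa [dotProduct_comm]),
    fun v u u' h1 h2 => h.add_left u u' v (by rwa [dotProduct_comm]) (by rwa [dotProduct_comm])⟩

theorem zero_left (u : ι → ℤ) : φ 0 u = 0 := by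
  have := h.add_left 0 0 u (by simp) (by simp)
  rw [add_zero] at this; linarith

theorem smul_left (c : ℤ) {v u : ι → ℤ} (hvu : v ⬝ᵥ u = 0) : φ (c • v) u = c * φ v u := by
  induction c using Int.induction_on with
  | zero => simp [h.zero_left]
  | succ c ih =>
    rw [add_smul, one_smul, h.add_left _ _ _ (by rw [smul_dotProduct, hvu, smul_zero]) hvu, ih]; push_cast; ring
  | pred c ih =>
    have := h.add_left ((-(c : ℤ) - 1) • v) v u (by rw [smul_dotProduct, hvu, smul_zero]) hvu
    rw [sub_smul, one_smul, sub_add_cancel, ih] at this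
    rw [sub_smul, one_smul]
    push_cast at this ⊢
    linarith

theorem smul_right (c : ℤ) {v u : ι → ℤ} (hvu : v ⬝ᵥ u = 0) : φ v (c • u) = c * φ v u :=
  h.swap.smul_left c (by rwa [dotProduct_comm])

theorem sum_left {κ : Type*} (s : Finset κ) (f : κ → ι → ℤ) {u : ι → ℤ}
    (hf : ∀ k ∈ s, f k ⬝ᵥ u = 0) : φ (∑ k ∈ s, f k) u = ∑ k ∈ s, φ (f k) u := by
  classical
  induction s using Finset.induction_on with
  | empty => simp [h.zero_left]
  | insert a s ha ih =>
    rw [Finset.sum_insert ha, Finset.sum_insert ha, h.add_left _ _ _ (hf a (by simp)), ih]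
    · exact fun k hk => hf k (by simp [-zsmul_eq_mul, hk])
    · rw [sum_dotProduct]; exact Finset.sum_eq_zero fun k hk => hf k (by simp [-zsmul_eq_mul, hk])

theorem sum_right {κ : Type*} (s : Finset κ) (f : κ → ι → ℤ) {v : ι → ℤ}
    (hf : ∀ k ∈ s, v ⬝ᵥ f k = 0) : φ v (∑ k ∈ s, f k) = ∑ k ∈ s, φ v (f k) :=
  h.swap.sum_left s f (fun k hk => by rw [dotProduct_comm]; exact hf k hk)

local notation:max "𝐞" i:max => (Pi.single i (1 : ℤ) : _ → ℤ)

variable (h0 : ∀ i j : ι, i ≠ j → φ (Pi.single i 1) (Pi.single j 1) = 0)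

include h0

/-- Adding `𝐞 k` to the second vector changes nothing, as `φ` vanishes on distinct basis vectors,
and `a c + b d = 0` rewrites the first as `a (𝐞 i - c 𝐞 k) + b (𝐞 j - d 𝐞 k)`, both summands
orthogonal to the new second vector. -/
theorem planar_eq {i j k : ι} (hij : i ≠ j) (hik : i ≠ k) (hjk : j ≠ k) {a b c d : ℤ}
    (habcd : a * c + b * d = 0) :
    φ (a • 𝐞 i + b • 𝐞 j) (c • 𝐞 i + d • 𝐞 j) =
      a * φ (𝐞 i - c • 𝐞 k) (c • 𝐞 i + 𝐞 k) + b * φ (𝐞 j - d • 𝐞 k) (d • 𝐞 j + 𝐞 k) := by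
  have d1 : ∀ {i k : ι}, i ≠ k → ∀ c : ℤ, (𝐞 i - c • 𝐞 k) ⬝ᵥ (c • 𝐞 i + 𝐞 k) = 0 := by
    intro i k hik c; simp [-zsmul_eq_mul, dotProduct_add, dotProduct_smul, hik, hik.symm]
  have d2 : ∀ {i j k : ι}, i ≠ j → k ≠ j → ∀ c : ℤ, (𝐞 i - c • 𝐞 k) ⬝ᵥ 𝐞 j = 0 := by
    intro i j k hij hkj c; simp [-zsmul_eq_mul, hij.symm, hkj.symm]
  have z : ∀ {i j k : ι}, i ≠ j → k ≠ j → ∀ c : ℤ, φ (𝐞 i - c • 𝐞 k) (𝐞 j) = 0 := by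
    intro i j k hij hkj c
    rw [sub_eq_add_neg, ← neg_smul, h.add_left _ _ _ (by simp [-zsmul_eq_mul, hij.symm]) (by simp [-zsmul_eq_mul, hkj.symm]),
      h.smul_left _ (by simp [-zsmul_eq_mul, hkj.symm]), h0 _ _ hij, h0 _ _ hkj]
    simp
  have v1 : (a • 𝐞 i + b • 𝐞 j) ⬝ᵥ (c • 𝐞 i + d • 𝐞 j) = 0 := by
    simp [-zsmul_eq_mul, dotProduct_add, dotProduct_smul, hij, hij.symm]; linarith
  have v2 : (a • 𝐞 i + b • 𝐞 j) ⬝ᵥ 𝐞 k = 0 := by simp [-zsmul_eq_mul, hik.symm, hjk.symm]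
  have e1 : φ (a • 𝐞 i + b • 𝐞 j) (c • 𝐞 i + d • 𝐞 j + 𝐞 k) =
      φ (a • 𝐞 i + b • 𝐞 j) (c • 𝐞 i + d • 𝐞 j) := by
    have : φ (a • 𝐞 i + b • 𝐞 j) (𝐞 k) = 0 := by
      rw [h.add_left _ _ _ (by simp [-zsmul_eq_mul, hik.symm]) (by simp [-zsmul_eq_mul, hjk.symm]),
      h.smul_left _ (by simp [-zsmul_eq_mul, hik.symm]), h.smul_left _ (by simp [-zsmul_eq_mul, hjk.symm]), h0 _ _ hik,
        h0 _ _ hjk]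
      simp
    rw [h.add_right _ _ _ v1 v2, this, add_zero]
  have e2 : a • 𝐞 i + b • 𝐞 j = a • (𝐞 i - c • 𝐞 k) + b • (𝐞 j - d • 𝐞 k) := by
    have : a • (𝐞 i - c • 𝐞 k) + b • (𝐞 j - d • 𝐞 k) =
        a • 𝐞 i + b • 𝐞 j - (a * c + b * d) • 𝐞 k := by module
    rw [this, habcd, zero_smul, sub_zero]
  have w1 : (𝐞 i - c • 𝐞 k) ⬝ᵥ (c • 𝐞 i + d • 𝐞 j + 𝐞 k) = 0 := by
    rw [show c • 𝐞 i + d • 𝐞 j + 𝐞 k = (c • 𝐞 i + 𝐞 k) + d • 𝐞 j by module, dotProduct_add,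
      d1 hik, dotProduct_smul, d2 hij hjk.symm]; simp
  have w2 : (𝐞 j - d • 𝐞 k) ⬝ᵥ (c • 𝐞 i + d • 𝐞 j + 𝐞 k) = 0 := by
    rw [show c • 𝐞 i + d • 𝐞 j + 𝐞 k = (d • 𝐞 j + 𝐞 k) + c • 𝐞 i by module, dotProduct_add,
      d1 hjk, dotProduct_smul, d2 hij.symm hik.symm]; simp
  rw [← e1, e2, h.add_left _ _ _ (by rw [smul_dotProduct, w1]; simp)
    (by rw [smul_dotProduct, w2]; simp), h.smul_left _ w1, h.smul_left _ w2]
  congr 2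
  · rw [show c • 𝐞 i + d • 𝐞 j + 𝐞 k = (c • 𝐞 i + 𝐞 k) + d • 𝐞 j by module,
      h.add_right _ _ _ (d1 hik c) (by rw [dotProduct_smul, d2 hij hjk.symm]; simp),
      h.smul_right _ (d2 hij hjk.symm c), z hij hjk.symm]
    simp
  · rw [show c • 𝐞 i + d • 𝐞 j + 𝐞 k = (d • 𝐞 j + 𝐞 k) + c • 𝐞 i by module,
      h.add_right _ _ _ (d1 hjk d) (by rw [dotProduct_smul, d2 hij.symm hik.symm]; simp),
      h.smul_right _ (d2 hij.symm hik.symm d), z hij.symm hik.symm]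
    simp

/-- By `planar_eq` the value `ψ i k c` is independent of `i` and satisfies `ψ(m c) = c ψ(m) + m
ψ(c)`. Such functions may be prescribed at the primes, so another relation is needed: pairs with
first vector `𝐞 i + 𝐞 j + 𝐞 k` make `ψ(d) + ψ(-(1 + d))` affine in `d`, and with oddness this forces
`ψ(1 + d) = ψ(d)`. -/
theorem psi_eq_zero (hι : 3 ≤ Fintype.card ι) (o : ι)
    (ho : ∀ i, i ≠ o → φ (𝐞 o - 𝐞 i) (𝐞 o + 𝐞 i) = 0) {i k : ι} (hik : i ≠ k) (c : ℤ) :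
    φ (𝐞 i - c • 𝐞 k) (c • 𝐞 i + 𝐞 k) = 0 := by
  set ψ : ι → ι → ℤ → ℚ := fun i k c => φ (𝐞 i - c • 𝐞 k) (c • 𝐞 i + 𝐞 k) with hψ
  have rel : ∀ {i j k : ι}, i ≠ j → i ≠ k → j ≠ k → ∀ a b c d m : ℤ, a * c + b * d = 0 →
      a * ψ i k (m * c) + b * ψ j k (m * d) = m * (a * ψ i k c + b * ψ j k d) := by
    intro i j k hij hik hjk a b c d m habcd
    rw [← h.planar_eq h0 hij hik hjk habcd,
      ← h.planar_eq h0 hij hik hjk (by linear_combination m * habcd), ← h.smul_right m]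
    · congr 1; module
    · simp [-zsmul_eq_mul, dotProduct_add, dotProduct_smul, hij, hij.symm]; linarith
  -- The values at `1` form a cocycle in the indices, which the normalization at `o` makes zero.
  have one_eq : ∀ {i j k : ι}, i ≠ j → i ≠ k → j ≠ k → ψ i j 1 = ψ i k 1 - ψ j k 1 := by
    intro i j k hij hik hjk
    have := h.planar_eq h0 hij hik hjk (a := 1) (b := -1) (c := 1) (d := 1) (by norm_num)
    simp only [hψ]
    simp only [one_smul, neg_smul, ← sub_eq_add_neg] at this ⊢
    rw [this]; push_cast; ring
  have hψo : ∀ i, i ≠ o → ψ o i 1 = 0 := by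
    intro i hi
    simp only [hψ, one_smul]
    exact ho i hi
  have one_zero : ∀ {i k : ι}, i ≠ k → ψ i k 1 = 0 := by
    have main : ∀ {j k : ι}, j ≠ k → j ≠ o → k ≠ o → ψ j k 1 = 0 := by
      intro j k hjk hj hk
      have := one_eq hj.symm hk.symm hjk
      rw [hψo j hj, hψo k hk] at this
      linarith
    intro i k hik
    by_cases hi : i = o
    · subst hi; exact hψo k hik.symm
    · by_cases hk : k = o
      · subst hk
        obtain ⟨l, hl, hl'⟩ := TrivialSymbol.exists_third hι i k
        rw [one_eq hik hl.symm hl'.symm, main hl.symm hi hl', hψo l hl', sub_zero]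
      · exact main hik hi hk
  have indep : ∀ {i j k : ι}, i ≠ j → i ≠ k → j ≠ k → ∀ m, ψ i k m = ψ j k m := by
    intro i j k hij hik hjk m
    have := rel hij hik hjk 1 (-1) 1 1 m (by norm_num)
    rw [one_zero hik, one_zero hjk, mul_one] at this
    push_cast at this; linarith
  obtain ⟨j, hji, hjk⟩ := TrivialSymbol.exists_third hι i k
  have der : ∀ m c, ψ i k (m * c) = c * ψ i k m + m * ψ i k c := by
    intro m c
    have := rel hji.symm hik hjk 1 (-c) c 1 m (by ring)
    rw [one_zero hjk, mul_one, ← indep hji.symm hik hjk] at this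
    push_cast at this; linarith
  have hzero : ψ i k 0 = 0 := by
    simp only [hψ, zero_smul, sub_zero, zero_add]
    exact h0 i k hik
  have hneg1 : ψ i k (-1) = 0 := by
    have := der (-1) (-1)
    rw [show (-1 : ℤ) * -1 = 1 by norm_num, one_zero hik] at this
    push_cast at this; linarith
  have hneg : ∀ x, ψ i k (-x) = -ψ i k x := by
    intro x
    have := der (-1) x
    rw [hneg1, show (-1 : ℤ) * x = -x by ring] at this
    push_cast at this; linarith
  -- additivity along `(1, 1, 1)`
  have aff : ∃ α β : ℚ, ∀ d : ℤ, ψ i k d + ψ i k (-(1 + d)) = α + d * β := by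
    refine ⟨φ (𝐞 i + 𝐞 j + 𝐞 k) (𝐞 k - 𝐞 j), φ (𝐞 i + 𝐞 j + 𝐞 k) (𝐞 i - 𝐞 j), fun d => ?_⟩
    have t1 : (𝐞 i + 𝐞 j + 𝐞 k) ⬝ᵥ (𝐞 k - 𝐞 j) = 0 := by
      simp [-zsmul_eq_mul, dotProduct_sub, hik.symm, hji, hjk, hjk.symm]
    have t2 : (𝐞 i + 𝐞 j + 𝐞 k) ⬝ᵥ (𝐞 i - 𝐞 j) = 0 := by
      simp [-zsmul_eq_mul, dotProduct_sub, hik, hji, hji.symm, hjk]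
    rw [← h.smul_right d t2, ← h.add_right _ _ _ t1 (by rw [dotProduct_smul, t2]; simp),
      indep hji.symm hik hjk (-(1 + d))]
    have s1 : 𝐞 i + 𝐞 j + 𝐞 k = (𝐞 i - d • 𝐞 k) + (𝐞 j - (-(1 + d)) • 𝐞 k) := by module
    have s2 : 𝐞 k - 𝐞 j + d • (𝐞 i - 𝐞 j) = (d • 𝐞 i + 𝐞 k) + (-(1 + d)) • 𝐞 j := by module
    have s3 : 𝐞 k - 𝐞 j + d • (𝐞 i - 𝐞 j) = (-(1 + d)) • 𝐞 j + 𝐞 k + d • 𝐞 i := by module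
    have w1 : (𝐞 i - d • 𝐞 k) ⬝ᵥ (d • 𝐞 i + 𝐞 k) = 0 := by
      simp [-zsmul_eq_mul, dotProduct_add, dotProduct_smul, hik, hik.symm]
    have w2 : (𝐞 i - d • 𝐞 k) ⬝ᵥ 𝐞 j = 0 := by simp [-zsmul_eq_mul, hji, hjk]
    have w3 : (𝐞 j - (-(1 + d)) • 𝐞 k) ⬝ᵥ ((-(1 + d)) • 𝐞 j + 𝐞 k) = 0 := by
      simp only [sub_dotProduct, dotProduct_add, dotProduct_smul, smul_dotProduct,
        single_dotProduct, Pi.single_eq_same, Pi.single_eq_of_ne hjk, Pi.single_eq_of_ne hjk.symm]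
      simp
    have w4 : (𝐞 j - (-(1 + d)) • 𝐞 k) ⬝ᵥ 𝐞 i = 0 := by
      simp only [sub_dotProduct, smul_dotProduct, single_dotProduct, Pi.single_eq_of_ne hji,
        Pi.single_eq_of_ne hik.symm]
      simp
    have z1 : φ (𝐞 i - d • 𝐞 k) (𝐞 j) = 0 := by
      rw [sub_eq_add_neg, ← neg_smul, h.add_left _ _ _ (by simp [-zsmul_eq_mul, hji]) (by simp [-zsmul_eq_mul, hjk]),
        h.smul_left _ (by simp [-zsmul_eq_mul, hjk]), h0 _ _ hji.symm, h0 _ _ hjk.symm]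
      simp
    have z2 : φ (𝐞 j - (-(1 + d)) • 𝐞 k) (𝐞 i) = 0 := by
      rw [sub_eq_add_neg, ← neg_smul, h.add_left _ _ _ (by simp [-zsmul_eq_mul, hji.symm]) (by simp [-zsmul_eq_mul, hik]),
        h.smul_left _ (by simp [-zsmul_eq_mul, hik]), h0 _ _ hji, h0 _ _ hik.symm]
      simp
    rw [s1, h.add_left]
    · congr 1
      · rw [s2, h.add_right _ _ _ w1 (by rw [dotProduct_smul, w2]; simp), h.smul_right _ w2, z1]
        simp [hψ]
      · rw [s3, h.add_right _ _ _ w3 (by rw [dotProduct_smul, w4]; simp), h.smul_right _ w4, z2]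
        simp [hψ]
    · rw [s2, dotProduct_add, w1, dotProduct_smul, w2]; simp
    · rw [s3, dotProduct_add, w3, dotProduct_smul, w4]; simp
  obtain ⟨α, β, haff⟩ := aff
  have a0 := haff 0
  have a1 := haff (-1)
  rw [hzero, add_zero, hneg1] at a0
  rw [hneg1, show -(1 + (-1 : ℤ)) = 0 by norm_num, hzero] at a1
  push_cast at a0 a1
  have step : ∀ d, ψ i k (1 + d) = ψ i k d := by
    intro d
    have := haff d
    rw [hneg] at this
    have hα : α = 0 := by linarith
    have hβ : β = 0 := by linarith
    rw [hα, hβ] at this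
    linarith
  change ψ i k c = 0
  induction c using Int.induction_on with
  | zero => exact hzero
  | succ c ih => rw [add_comm, step, ih]
  | pred c ih => rw [← step, ← ih]; congr 1; ring

/-- Values are rational, so `u` may be multiplied by a nonzero coordinate `v k`. Then `v k • u` is a
combination of the vectors `v k 𝐞 i - v i 𝐞 k` orthogonal to `v`, against which only the `(i, k)`
part of `v` counts. -/
theorem eq_zero (hι : 3 ≤ Fintype.card ι) (o : ι)
    (ho : ∀ i, i ≠ o → φ (𝐞 o - 𝐞 i) (𝐞 o + 𝐞 i) = 0) {v u : ι → ℤ} (hvu : v ⬝ᵥ u = 0) :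
    φ v u = 0 := by
  by_cases hv : v = 0
  · rw [hv, h.zero_left]
  obtain ⟨k, hk⟩ : ∃ k, v k ≠ 0 := by
    by_contra! hall
    exact hv (funext hall)
  have horth : ∀ i, v ⬝ᵥ (v k • 𝐞 i - v i • 𝐞 k) = 0 := by
    intro i; simp [-zsmul_eq_mul, dotProduct_sub, dotProduct_smul]; ring
  have key : ∀ i, φ v (v k • 𝐞 i - v i • 𝐞 k) = 0 := by
    intro i
    by_cases hik : i = k
    · subst hik; rw [sub_self]; exact h.swap.zero_left v
    obtain ⟨l, hli, hlk⟩ := TrivialSymbol.exists_third hι i k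
    have hv : v = (v i • 𝐞 i + v k • 𝐞 k) +
        ∑ l ∈ (Finset.univ.erase i).erase k, v l • 𝐞 l := by
      have h1 : v = ∑ l, v l • 𝐞 l := by
        ext x; simp [Finset.sum_apply, Pi.single_apply]
      conv_lhs => rw [h1]
      rw [← Finset.add_sum_erase _ _ (Finset.mem_univ i), ← Finset.add_sum_erase _ _
        (Finset.mem_erase.2 ⟨Ne.symm hik, Finset.mem_univ k⟩), add_assoc]
    have o1 : (v i • 𝐞 i + v k • 𝐞 k) ⬝ᵥ (v k • 𝐞 i - v i • 𝐞 k) = 0 := by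
      simp [-zsmul_eq_mul, dotProduct_sub, dotProduct_smul, hik, Ne.symm hik]; ring
    have o2 : ∀ l ∈ (Finset.univ.erase i).erase k, 𝐞 l ⬝ᵥ (v k • 𝐞 i - v i • 𝐞 k) = 0 := by
      intro l hl
      simp only [Finset.mem_erase, Finset.mem_univ, and_true] at hl
      simp [hl.1, hl.2]
    have z1 : φ (v i • 𝐞 i + v k • 𝐞 k) (v k • 𝐞 i - v i • 𝐞 k) = 0 := by
      rw [sub_eq_add_neg, ← neg_smul, h.planar_eq h0 hik hli.symm hlk.symm (by ring),
        h.psi_eq_zero h0 hι o ho hli.symm, h.psi_eq_zero h0 hι o ho hlk.symm]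
      simp
    set w := v k • 𝐞 i - v i • 𝐞 k with hw
    rw [hv, h.add_left _ _ _ o1, z1, zero_add, h.sum_left]
    · refine Finset.sum_eq_zero fun l hl => ?_
      rw [h.smul_left _ (o2 l hl)]
      simp only [Finset.mem_erase, Finset.mem_univ, and_true] at hl
      rw [hw, sub_eq_add_neg, ← neg_smul, h.add_right _ _ _ (by simp [-zsmul_eq_mul, dotProduct_smul, hl.2]) (by simp [-zsmul_eq_mul, dotProduct_smul, hl.1]),
        h.smul_right _ (by simp [-zsmul_eq_mul, hl.2]), h.smul_right _ (by simp [-zsmul_eq_mul, hl.1]),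
        h0 _ _ hl.2, h0 _ _ hl.1]
      simp
    · intro l hl; rw [smul_dotProduct, o2 l hl]; simp
    · rw [sum_dotProduct]
      refine Finset.sum_eq_zero fun l hl => ?_
      rw [smul_dotProduct, o2 l hl]; simp
  have hsum : v k • u = ∑ i, u i • (v k • 𝐞 i - v i • 𝐞 k) := by
    ext x
    have h2 : ∑ i, u i * (v i * (if x = k then 1 else 0)) = 0 := by
      have : ∑ i, u i * (v i * (if x = k then (1 : ℤ) else 0)) =
          (v ⬝ᵥ u) * (if x = k then 1 else 0) := by
        rw [dotProduct, Finset.sum_mul]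
        exact Finset.sum_congr rfl fun i _ => by ring
      rw [this, hvu, zero_mul]
    simp only [Pi.smul_apply, Finset.sum_apply, Pi.sub_apply, smul_eq_mul, Pi.single_apply,
      mul_sub, Finset.sum_sub_distrib, h2, sub_zero]
    simp [mul_comm]
  have h3 := h.smul_right (v k) hvu
  rw [hsum, h.sum_right _ _ (fun i _ => by rw [dotProduct_smul, horth]; simp)] at h3
  have h4 : ∑ i, φ v (u i • (v k • 𝐞 i - v i • 𝐞 k)) = 0 :=
    Finset.sum_eq_zero fun i _ => by rw [h.smul_right _ (horth i), key, mul_zero]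
  rw [h4] at h3
  exact (mul_eq_zero.1 h3.symm).resolve_left (by exact_mod_cast hk)

omit h0 in
/-- In rank at least three, such a function is induced by a linear form on matrices. -/
theorem exists_eq_sum (hι : 3 ≤ Fintype.card ι) :
    ∃ t : ι → ι → ℚ, ∀ v u, v ⬝ᵥ u = 0 → φ v u = ∑ i, ∑ j, v i * u j * t i j := by
  obtain ⟨o⟩ : Nonempty ι := Fintype.card_pos_iff.1 (by omega)
  -- Scalar matrices are invisible on orthogonal pairs, so `t o o = 0` is a normalization; the pairs
  -- `(𝐞 o - 𝐞 i, 𝐞 o + 𝐞 i)` then determine the other diagonal entries.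
  let t : ι → ι → ℚ := fun i j => if i ≠ j then φ (𝐞 i) (𝐞 j) else
    if i = o then 0 else φ (𝐞 o) (𝐞 i) - φ (𝐞 i) (𝐞 o) - φ (𝐞 o - 𝐞 i) (𝐞 o + 𝐞 i)
  let B : (ι → ℤ) → (ι → ℤ) → ℚ := fun v u => ∑ i, ∑ j, v i * u j * t i j
  have hBl : ∀ v v' u, B (v + v') u = B v u + B v' u := by
    intro v v' u
    simp only [B, ← Finset.sum_add_distrib]
    refine Finset.sum_congr rfl fun i _ => Finset.sum_congr rfl fun j _ => ?_
    push_cast [Pi.add_apply]; ring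
  have hBr : ∀ v u u', B v (u + u') = B v u + B v u' := by
    intro v v' u
    simp only [B, ← Finset.sum_add_distrib]
    refine Finset.sum_congr rfl fun i _ => Finset.sum_congr rfl fun j _ => ?_
    push_cast [Pi.add_apply]; ring
  have hBn : ∀ v u, B (-v) u = -B v u := by
    intro v u
    simp only [B, ← Finset.sum_neg_distrib]
    refine Finset.sum_congr rfl fun i _ => Finset.sum_congr rfl fun j _ => ?_
    push_cast [Pi.neg_apply]; ring
  have hBe : ∀ i j, B (𝐞 i) (𝐞 j) = t i j := by
    intro i j
    simp only [B]
    rw [Finset.sum_eq_single i, Finset.sum_eq_single j]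
    · simp
    · intro x _ hx; simp [hx]
    · simp
    · intro x _ hx; simp [hx]
    · simp
  have h' : IsOrthoBiadditive (fun v u => φ v u - B v u) :=
    ⟨fun v v' u h1 h2 => by rw [h.add_left _ _ _ h1 h2, hBl]; ring,
      fun v u u' h1 h2 => by rw [h.add_right _ _ _ h1 h2, hBr]; ring⟩
  refine ⟨t, fun v u hvu => ?_⟩
  have := h'.eq_zero (fun i j hij => ?_) hι o (fun i hi => ?_) hvu
  · change φ v u = B v u
    linarith
  · rw [hBe]; simp [t, hij]
  · rw [sub_eq_add_neg (𝐞 o), hBl, hBr, hBr, hBn, hBn, hBe, hBe, hBe, hBe, ← sub_eq_add_neg]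
    simp only [t]
    simp [hi, Ne.symm hi]
    ring

end IsOrthoBiadditive

end Biadditive

/-! ### Characters of the graded pieces of the lower central series -/

section LowerCentral

open scoped commutatorElement

variable {G : Type*} [Group G]

theorem Subgroup.commutator_commutator_le_of_rotate {H₁ H₂ H₃ N : Subgroup G} [N.Normal]
    (h1 : ⁅⁅H₂, H₃⁆, H₁⁆ ≤ N) (h2 : ⁅⁅H₃, H₁⁆, H₂⁆ ≤ N) : ⁅⁅H₁, H₂⁆, H₃⁆ ≤ N := by
  have key : ∀ A : Subgroup G, A ≤ N ↔ A.map (QuotientGroup.mk' N) = ⊥ := fun A => by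
    rw [Subgroup.map_eq_bot_iff, QuotientGroup.ker_mk']
  rw [key, Subgroup.map_commutator, Subgroup.map_commutator] at h1 h2 ⊢
  exact Subgroup.commutator_commutator_eq_bot_of_rotate h1 h2

/-- The three subgroups lemma; index `p` stands for `Γ^(p+1)`, hence the extra `1`. -/
theorem Subgroup.commutator_lowerCentralSeries_le (K : Subgroup G) [K.Normal] (p q : ℕ) :
    ⁅K.lowerCentralSeries p, K.lowerCentralSeries q⁆ ≤ K.lowerCentralSeries (p + q + 1) := by
  induction q generalizing p with
  | zero => rfl
  | succ q ih =>
    rw [Subgroup.commutator_comm, Subgroup.lowerCentralSeries_succ]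
    refine Subgroup.commutator_commutator_le_of_rotate ?_ ?_
    · rw [Subgroup.commutator_comm K, ← Subgroup.lowerCentralSeries_succ]
      exact (ih (p + 1)).trans (le_of_eq (by congr 1; ring))
    · exact Subgroup.commutator_mono (ih p) le_rfl

theorem Subgroup.commutator_mem_lowerCentralSeries {K : Subgroup G} [K.Normal] {p q r : ℕ}
    {x y : G} (hx : x ∈ K.lowerCentralSeries p) (hy : y ∈ K.lowerCentralSeries q)
    (hr : r ≤ p + q + 1) : ⁅x, y⁆ ∈ K.lowerCentralSeries r :=
  K.lowerCentralSeries_antitone hr (K.commutator_lowerCentralSeries_le p q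
    (Subgroup.commutator_mem_commutator hx hy))

/-- A function on `G` that restricts to a homomorphism from the `r`-th term of the lower central
series of `K` to `ℚ` that is trivial on the next term. -/
structure IsGradedChar (K : Subgroup G) (r : ℕ) (f : G → ℚ) : Prop where
  map_mul : ∀ x ∈ K.lowerCentralSeries r, ∀ y ∈ K.lowerCentralSeries r, f (x * y) = f x + f y
  map_eq_zero : ∀ x ∈ K.lowerCentralSeries (r + 1), f x = 0

namespace IsGradedChar

variable {K : Subgroup G} {r : ℕ} {f g : G → ℚ} (hf : IsGradedChar K r f)

theorem sub (hf : IsGradedChar K r f) (hg : IsGradedChar K r g) :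
    IsGradedChar K r (fun x => f x - g x) :=
  ⟨fun x hx y hy => by rw [hf.map_mul x hx y hy, hg.map_mul x hx y hy]; ring,
    fun x hx => by rw [hf.map_eq_zero x hx, hg.map_eq_zero x hx, sub_zero]⟩

include hf

theorem map_one : f 1 = 0 := by
  have := hf.map_mul 1 (one_mem _) 1 (one_mem _)
  rw [mul_one] at this; linarith

theorem map_inv {x : G} (hx : x ∈ K.lowerCentralSeries r) : f x⁻¹ = -f x := by
  have := hf.map_mul x hx x⁻¹ (inv_mem hx)
  rw [mul_inv_cancel, hf.map_one] at this; linarith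

theorem map_pow {x : G} (hx : x ∈ K.lowerCentralSeries r) (m : ℕ) : f (x ^ m) = m * f x := by
  induction m with
  | zero => simp [hf.map_one]
  | succ m ih => rw [pow_succ, hf.map_mul _ (pow_mem hx m) _ hx, ih]; push_cast; ring

theorem map_zpow {x : G} (hx : x ∈ K.lowerCentralSeries r) (m : ℤ) : f (x ^ m) = m * f x := by
  obtain ⟨k, rfl | rfl⟩ := m.eq_nat_or_neg
  · rw [zpow_natCast, hf.map_pow hx]; simp
  · rw [zpow_neg, zpow_natCast, hf.map_inv (pow_mem hx k), hf.map_pow hx]; simp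

theorem map_commutator (x y : G) (h : ⁅x, y⁆ ∈ K.lowerCentralSeries r) : f ⁅y, x⁆ = -f ⁅x, y⁆ := by
  rw [← hf.map_inv h, commutatorElement_inv]

variable [K.Normal]

theorem comp_conj (c : G) : IsGradedChar K r (fun x => f (c * x * c⁻¹)) := by
  refine ⟨fun x hx y hy => ?_, fun x hx => hf.map_eq_zero _
    ((Subgroup.lowerCentralSeries_normal K _).conj_mem x hx c)⟩
  rw [← hf.map_mul _ ((Subgroup.lowerCentralSeries_normal K _).conj_mem x hx c) _
    ((Subgroup.lowerCentralSeries_normal K _).conj_mem y hy c)]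
  congr 1; group

theorem map_conj {x c : G} (hx : x ∈ K.lowerCentralSeries r) (hc : c ∈ K) :
    f (c * x * c⁻¹) = f x := by
  have h : ⁅c, x⁆ ∈ K.lowerCentralSeries (r + 1) :=
    Subgroup.commutator_mem_lowerCentralSeries (p := 0) hc hx (by omega)
  rw [show c * x * c⁻¹ = ⁅c, x⁆ * x by simp [commutatorElement_def],
    hf.map_mul _ (K.lowerCentralSeries_antitone r.le_succ h) _ hx, hf.map_eq_zero _ h, zero_add]

/-- The conjugations in the commutator identities are invisible to `f`, so commutation is biadditive
on graded pieces. -/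
theorem map_commutator_mul_left {p q : ℕ} (hr : r = p + q + 1) {x y z : G}
    (hx : x ∈ K.lowerCentralSeries p) (hy : y ∈ K.lowerCentralSeries p)
    (hz : z ∈ K.lowerCentralSeries q) : f ⁅x * y, z⁆ = f ⁅x, z⁆ + f ⁅y, z⁆ := by
  have h1 := Subgroup.commutator_mem_lowerCentralSeries hx hz hr.le
  have h2 := Subgroup.commutator_mem_lowerCentralSeries hy hz hr.le
  have hxK : x ∈ K := K.lowerCentralSeries_antitone (Nat.zero_le p) hx
  rw [commutatorElement_mul_left_eq_conj_mul, hf.map_mul _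
    ((Subgroup.lowerCentralSeries_normal K _).conj_mem _ h2 x) _ h1, hf.map_conj h2 hxK, add_comm]

theorem map_commutator_mul_right {p q : ℕ} (hr : r = p + q + 1) {x y z : G}
    (hx : x ∈ K.lowerCentralSeries p) (hy : y ∈ K.lowerCentralSeries q)
    (hz : z ∈ K.lowerCentralSeries q) : f ⁅x, y * z⁆ = f ⁅x, y⁆ + f ⁅x, z⁆ := by
  have h1 := Subgroup.commutator_mem_lowerCentralSeries hx hy hr.le
  have h2 := Subgroup.commutator_mem_lowerCentralSeries hx hz hr.le
  have hyK : y ∈ K := K.lowerCentralSeries_antitone (Nat.zero_le q) hy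
  rw [commutatorElement_mul_right_eq_mul_conj, mul_assoc, mul_assoc, ← mul_assoc y,
    hf.map_mul _ h1 _ ((Subgroup.lowerCentralSeries_normal K _).conj_mem _ h2 y), hf.map_conj h2 hyK]

theorem map_commutator_inv_left {p q : ℕ} (hr : r = p + q + 1) {x z : G}
    (hx : x ∈ K.lowerCentralSeries p) (hz : z ∈ K.lowerCentralSeries q) :
    f ⁅x⁻¹, z⁆ = -f ⁅x, z⁆ := by
  have := hf.map_commutator_mul_left hr hx (inv_mem hx) hz
  rw [mul_inv_cancel, commutatorElement_one_left, hf.map_one] at this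
  linarith

theorem map_commutator_inv_right {p q : ℕ} (hr : r = p + q + 1) {x z : G}
    (hx : x ∈ K.lowerCentralSeries p) (hz : z ∈ K.lowerCentralSeries q) :
    f ⁅x, z⁻¹⁆ = -f ⁅x, z⁆ := by
  have := hf.map_commutator_mul_right hr hx hz (inv_mem hz)
  rw [mul_inv_cancel, commutatorElement_one_right, hf.map_one] at this
  linarith

/-- Characters ignore conjugation by `K`, so the Hall–Witt identity becomes a Jacobi identity. -/
theorem hallWitt {p q s : ℕ} (hr : r = p + q + s + 2) {x y z : G}
    (hx : x ∈ K.lowerCentralSeries p) (hy : y ∈ K.lowerCentralSeries q)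
    (hz : z ∈ K.lowerCentralSeries s) :
    f ⁅⁅x⁻¹, y⁆, z⁆ + f ⁅⁅z⁻¹, x⁆, y⁆ + f ⁅⁅y⁻¹, z⁆, x⁆ = 0 := by
  have m1 : ⁅⁅x⁻¹, y⁆, z⁆ ∈ K.lowerCentralSeries r :=
    Subgroup.commutator_mem_lowerCentralSeries
      (Subgroup.commutator_mem_lowerCentralSeries (inv_mem hx) hy le_rfl) hz (by omega)
  have m2 : ⁅⁅z⁻¹, x⁆, y⁆ ∈ K.lowerCentralSeries r :=
    Subgroup.commutator_mem_lowerCentralSeries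
      (Subgroup.commutator_mem_lowerCentralSeries (inv_mem hz) hx le_rfl) hy (by omega)
  have m3 : ⁅⁅y⁻¹, z⁆, x⁆ ∈ K.lowerCentralSeries r :=
    Subgroup.commutator_mem_lowerCentralSeries
      (Subgroup.commutator_mem_lowerCentralSeries (inv_mem hy) hz le_rfl) hx (by omega)
  have N : (K.lowerCentralSeries r).Normal := inferInstance
  have := congrArg f (conj_commutatorElement_left_commutatorElement_mul x y z)
  rw [show x * ⁅⁅x⁻¹, y⁆, z⁆ * x⁻¹ * z * ⁅⁅z⁻¹, x⁆, y⁆ * z⁻¹ * y * ⁅⁅y⁻¹, z⁆, x⁆ * y⁻¹ =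
      (x * ⁅⁅x⁻¹, y⁆, z⁆ * x⁻¹) * (z * ⁅⁅z⁻¹, x⁆, y⁆ * z⁻¹) * (y * ⁅⁅y⁻¹, z⁆, x⁆ * y⁻¹) by
        simp only [mul_assoc],
    hf.map_mul _ (mul_mem (N.conj_mem _ m1 x) (N.conj_mem _ m2 z)) _ (N.conj_mem _ m3 y),
    hf.map_mul _ (N.conj_mem _ m1 x) _ (N.conj_mem _ m2 z),
    hf.map_conj m1 (K.lowerCentralSeries_antitone (Nat.zero_le _) hx),
    hf.map_conj m2 (K.lowerCentralSeries_antitone (Nat.zero_le _) hz),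
    hf.map_conj m3 (K.lowerCentralSeries_antitone (Nat.zero_le _) hy), hf.map_one] at this
  exact this

/-- Commutation with a fixed element lowers the degree of a character. -/
theorem commutator_right {p q : ℕ} (hr : r = p + q + 1) {z : G}
    (hz : z ∈ K.lowerCentralSeries q) : IsGradedChar K p (fun x => f ⁅x, z⁆) :=
  ⟨fun _ hx _ hy => hf.map_commutator_mul_left hr hx hy hz, fun _ hx => hf.map_eq_zero _
    (Subgroup.commutator_mem_lowerCentralSeries hx hz (by omega))⟩

omit [K.Normal] in
theorem eq_zero_of_closure {S : Set G} (hS : K.lowerCentralSeries r = Subgroup.closure S)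
    (h : ∀ x ∈ S, f x = 0) {x : G} (hx : x ∈ K.lowerCentralSeries r) : f x = 0 := by
  have := hx
  rw [hS] at this
  induction this using Subgroup.closure_induction with
  | mem x hx' => exact h x hx'
  | one => exact hf.map_one
  | mul x y hx' hy' ihx ihy =>
    rw [← hS] at hx' hy'
    rw [hf.map_mul x hx' y hy', ihx hx', ihy hy', add_zero]
  | inv x hx' ih =>
    rw [← hS] at hx'
    rw [hf.map_inv hx', ih hx', neg_zero]

theorem eq_zero_of_commutator {p : ℕ} (hr : r = p + 1) {S : Set G}
    (hS : K = Subgroup.closure S)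
    (h : ∀ y ∈ K.lowerCentralSeries p, ∀ x ∈ S, f ⁅y, x⁆ = 0) {x : G}
    (hx : x ∈ K.lowerCentralSeries r) : f x = 0 := by
  have key : ∀ y ∈ K.lowerCentralSeries p, ∀ x ∈ K, f ⁅y, x⁆ = 0 := by
    intro y hy x hx
    have := hx
    rw [hS] at this
    induction this using Subgroup.closure_induction with
    | mem x hx' => exact h y hy x hx'
    | one => rw [commutatorElement_one_right, hf.map_one]
    | mul x z hx' hz' ihx ihz =>
      rw [← hS] at hx' hz'
      rw [hf.map_commutator_mul_right (q := 0) (by omega) hy hx' hz', ihx hx', ihz hz', add_zero]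
    | inv x hx' ih =>
      rw [← hS] at hx'
      rw [hf.map_commutator_inv_right (q := 0) (by omega) hy hx', ih hx', neg_zero]
  subst hr
  refine hf.eq_zero_of_closure (Subgroup.commutator_def _ _) ?_ hx
  rintro _ ⟨y, hy, x, hx, rfl⟩
  exact key y hy x hx

omit hf in
/-- Elements of infinite order modulo the next term are detected by characters. -/
theorem exists_pow_mem {x : G} (hx : x ∈ K.lowerCentralSeries r)
    (h : ∀ f, IsGradedChar K r f → f x = 0) :
    ∃ m : ℕ, 0 < m ∧ x ^ m ∈ K.lowerCentralSeries (r + 1) := by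
  set L := K.lowerCentralSeries r with hL
  set N := (K.lowerCentralSeries (r + 1)).subgroupOf L with hN
  have hcomm : ∀ u v : L ⧸ N, u * v = v * u := by
    intro u v
    induction u using QuotientGroup.induction_on with | H u => ?_
    induction v using QuotientGroup.induction_on with | H v => ?_
    rw [← QuotientGroup.mk_mul, ← QuotientGroup.mk_mul, QuotientGroup.eq, hN,
      Subgroup.mem_subgroupOf]
    have : ((u * v)⁻¹ * (v * u) : L) = ⁅v⁻¹, u⁻¹⁆ := by simp [commutatorElement_def, mul_assoc]
    rw [this]
    exact Subgroup.commutator_mem_lowerCentralSeries (inv_mem v.2) (inv_mem u.2) (by omega)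
  let : CommGroup (L ⧸ N) := { (inferInstance : Group (L ⧸ N)) with mul_comm := hcomm }
  let α : Additive (L ⧸ N) := Additive.ofMul (QuotientGroup.mk (⟨x, hx⟩ : L))
  by_contra! hpow
  have hα : Function.Injective (zmultiplesHom _ α) := by
    rw [injective_iff_map_eq_zero]
    intro c hc
    rw [zmultiplesHom_apply] at hc
    have hmem : ∀ m : ℕ, m • α = 0 → m = 0 := by
      intro m hm
      by_contra hm0
      refine hpow m (Nat.pos_of_ne_zero hm0) ?_
      have h1 : (QuotientGroup.mk ((⟨x, hx⟩ : L) ^ m) : L ⧸ N) = 1 := hm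
      rw [QuotientGroup.eq_one_iff, hN, Subgroup.mem_subgroupOf] at h1
      exact h1
    obtain ⟨k, rfl | rfl⟩ := c.eq_nat_or_neg
    · rw [natCast_zsmul] at hc
      rw [hmem k hc]; rfl
    · rw [neg_zsmul, natCast_zsmul, neg_eq_zero] at hc
      rw [hmem k hc]; rfl
  -- `x` is assumed of infinite order modulo the next term; as `ℚ` is divisible, hence injective,
  -- the map sending its class to `1` extends to the whole quotient.
  obtain ⟨F, hF⟩ := (Module.Baer.of_divisible ℚ).extension_property_addMonoidHom
    (zmultiplesHom _ α) hα (zmultiplesHom ℚ 1)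
  classical
  let f : G → ℚ := fun y => if hy : y ∈ L then
    F (Additive.ofMul (QuotientGroup.mk (⟨y, hy⟩ : L))) else 0
  have hfL : ∀ y (hy : y ∈ L), f y = F (Additive.ofMul (QuotientGroup.mk (⟨y, hy⟩ : L))) :=
    fun y hy => dif_pos hy
  have hfx : f x = 1 := by
    rw [hfL x hx]
    have := DFunLike.congr_fun hF 1
    simpa [α] using this
  have hf : IsGradedChar K r f := by
    refine ⟨fun y hy z hz => ?_, fun y hy => ?_⟩
    · rw [hfL y hy, hfL z hz, hfL _ (mul_mem hy hz), ← map_add]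
      rfl
    · have hyL := K.lowerCentralSeries_antitone r.le_succ hy
      rw [hfL y hyL, (QuotientGroup.eq_one_iff (⟨y, hyL⟩ : L)).2 (Subgroup.mem_subgroupOf.2 hy)]
      exact map_zero F
  rw [h f hf] at hfx
  exact zero_ne_one hfx

end IsGradedChar

end LowerCentral

/-! ### The congruence filtration on matrices of power series -/

section SeriesCongr

open Matrix PowerSeries
open scoped commutatorElement

variable {n : ℕ}

/-- The matrices in `SL_n(ℚ⟦T⟧)` that are congruent to the identity modulo `T ^ r`. -/
noncomputable def seriesCongr (n r : ℕ) : Subgroup (Matrix.SpecialLinearGroup (Fin n) ℚ⟦X⟧) :=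
  slKer n (Ideal.Quotient.mk (Ideal.span {(X : ℚ⟦X⟧) ^ r}))

instance (n r : ℕ) : (seriesCongr n r).Normal := by unfold seriesCongr slKer; infer_instance

theorem mem_slKer_iff {R S : Type} [CommRing R] [CommRing S] {f : R →+* S}
    {x : Matrix.SpecialLinearGroup (Fin n) R} :
    x ∈ slKer n f ↔ ∀ i j, f (x i j - (1 : Matrix (Fin n) (Fin n) R) i j) = 0 := by
  rw [slKer, MonoidHom.mem_ker, Matrix.SpecialLinearGroup.ext_iff]
  refine forall_congr' fun i => forall_congr' fun j => ?_
  have : f ((1 : Matrix (Fin n) (Fin n) R) i j) = (1 : Matrix (Fin n) (Fin n) S) i j := by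
    by_cases h : i = j
    · rw [h, one_apply_eq, one_apply_eq, map_one]
    · rw [one_apply_ne h, one_apply_ne h, map_zero]
  rw [map_sub, sub_eq_zero, this]
  rfl

theorem mem_seriesCongr {r : ℕ} {x : Matrix.SpecialLinearGroup (Fin n) ℚ⟦X⟧} :
    x ∈ seriesCongr n r ↔ ∀ i j, X ^ r ∣ (x.1 - 1) i j := by
  rw [seriesCongr, mem_slKer_iff]
  simp only [Ideal.Quotient.eq_zero_iff_mem, Ideal.mem_span_singleton]
  rfl

theorem mem_seriesCongr_iff_coeff {r : ℕ} {x : Matrix.SpecialLinearGroup (Fin n) ℚ⟦X⟧} :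
    x ∈ seriesCongr n r ↔ ∀ i j, ∀ m < r, coeff m ((x.1 - 1) i j) = 0 := by
  simp only [mem_seriesCongr, X_pow_dvd_iff]

theorem mem_seriesCongr_iff_exists {r : ℕ} {x : Matrix.SpecialLinearGroup (Fin n) ℚ⟦X⟧} :
    x ∈ seriesCongr n r ↔ ∃ A : Matrix (Fin n) (Fin n) ℚ⟦X⟧, x.1 = 1 + (X : ℚ⟦X⟧) ^ r • A := by
  rw [mem_seriesCongr]
  constructor
  · intro h
    choose A hA using h
    exact ⟨Matrix.of A, by ext1 i j; rw [Matrix.add_apply, Matrix.smul_apply, of_apply, smul_eq_mul, ← hA]; simp⟩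
  · rintro ⟨A, hA⟩ i j
    rw [hA, add_sub_cancel_left]
    exact ⟨A i j, rfl⟩

theorem seriesCongr_antitone {r s : ℕ} (h : r ≤ s) : seriesCongr n s ≤ seriesCongr n r := by
  intro x hx
  rw [mem_seriesCongr] at hx ⊢
  exact fun i j => (pow_dvd_pow X h).trans (hx i j)

theorem seriesCongr_zero : seriesCongr n 0 = ⊤ := by
  rw [eq_top_iff]
  exact fun x _ => mem_seriesCongr.2 fun i j => by simp

theorem seriesKer_eq : seriesKer n = seriesCongr n 1 := by
  ext x
  rw [mem_slKer_iff, mem_seriesCongr]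
  simp only [pow_one, X_dvd_iff]
  rfl

theorem coeff_one_apply {m : ℕ} (hm : m ≠ 0) (i j : Fin n) :
    coeff m ((1 : Matrix (Fin n) (Fin n) ℚ⟦X⟧) i j) = 0 := by
  by_cases h : i = j
  · subst h; rw [one_apply_eq, coeff_one, if_neg hm]
  · rw [one_apply_ne h, map_zero]

/-- The matrix of coefficients of `T ^ m`. -/
noncomputable def coeffMatrix (m : ℕ) (x : Matrix.SpecialLinearGroup (Fin n) ℚ⟦X⟧) :
    Matrix (Fin n) (Fin n) ℚ := Matrix.of fun i j => coeff m (x i j)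

theorem mem_seriesCongr_succ {r : ℕ} {x : Matrix.SpecialLinearGroup (Fin n) ℚ⟦X⟧} (hr : r ≠ 0) :
    x ∈ seriesCongr n (r + 1) ↔ x ∈ seriesCongr n r ∧ coeffMatrix r x = 0 := by
  simp only [mem_seriesCongr_iff_coeff, Nat.lt_succ_iff_lt_or_eq]
  constructor
  · refine fun h => ⟨fun i j m hm => h i j m (Or.inl hm), ?_⟩
    ext i j
    have := h i j r (Or.inr rfl)
    rwa [Matrix.sub_apply, map_sub, coeff_one_apply hr, sub_zero] at this
  · rintro ⟨h1, h2⟩ i j m (hm | rfl)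
    · exact h1 i j m hm
    · rw [Matrix.sub_apply, map_sub, coeff_one_apply hr, sub_zero]
      exact congrFun (congrFun h2 i) j

theorem coeffMatrix_of_eq {r : ℕ} (hr : r ≠ 0) {x : Matrix.SpecialLinearGroup (Fin n) ℚ⟦X⟧}
    {A : Matrix (Fin n) (Fin n) ℚ⟦X⟧} (hA : x.1 = 1 + (X : ℚ⟦X⟧) ^ r • A) (i j : Fin n) :
    coeffMatrix r x i j = constantCoeff (A i j) := by
  change coeff r (x.1 i j) = _
  rw [hA, Matrix.add_apply, map_add, coeff_one_apply hr, zero_add, Matrix.smul_apply, smul_eq_mul,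
    coeff_X_pow_mul', if_pos le_rfl, Nat.sub_self, coeff_zero_eq_constantCoeff_apply]

/-- Multiplication by an element of level `s` does not affect coefficients below `s`, and is
additive on the coefficients at `s`. -/
theorem coeffMatrix_mul_of_le {r s : ℕ} (hr : r ≠ 0) (hsr : s ≤ r)
    {x y : Matrix.SpecialLinearGroup (Fin n) ℚ⟦X⟧} (hx : x ∈ seriesCongr n 1)
    (hy : y ∈ seriesCongr n r) : coeffMatrix s (x * y) = coeffMatrix s x +
      (if s = r then coeffMatrix r y else 0) := by
  obtain ⟨A, hA⟩ := mem_seriesCongr_iff_exists.1 hx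
  obtain ⟨B, hB⟩ := mem_seriesCongr_iff_exists.1 hy
  have h : (x * y).1 = x.1 + (X : ℚ⟦X⟧) ^ r • B + (X : ℚ⟦X⟧) ^ (r + 1) • (A * B) := by
    rw [Matrix.SpecialLinearGroup.coe_mul, hB, hA, mul_add, mul_one, add_mul (1 : Matrix _ _ _), one_mul,
      smul_mul_smul_comm, ← pow_add, ← add_assoc, add_comm 1 r]
  ext i j
  rw [Matrix.add_apply]
  change coeff s ((x * y).1 i j) = coeff s (x.1 i j) + _
  rw [h, Matrix.add_apply, Matrix.add_apply, map_add, map_add, Matrix.smul_apply, Matrix.smul_apply, smul_eq_mul,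
    smul_eq_mul, coeff_X_pow_mul', coeff_X_pow_mul', if_neg (by omega : ¬ r + 1 ≤ s), add_zero]
  congr 1
  rcases hsr.eq_or_lt with rfl | hlt
  · rw [if_pos le_rfl, if_pos rfl, coeffMatrix_of_eq hr hB, Nat.sub_self,
      coeff_zero_eq_constantCoeff_apply]
  · rw [if_neg (by omega), if_neg hlt.ne]; rfl

theorem coeffMatrix_mul {r : ℕ} (hr : r ≠ 0) {x y : Matrix.SpecialLinearGroup (Fin n) ℚ⟦X⟧}
    (hx : x ∈ seriesCongr n 1) (hy : y ∈ seriesCongr n r) :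
    coeffMatrix r (x * y) = coeffMatrix r x + coeffMatrix r y := by
  rw [coeffMatrix_mul_of_le hr le_rfl hx hy, if_pos rfl]

theorem coeffMatrix_one {r : ℕ} (hr : r ≠ 0) :
    coeffMatrix r (1 : Matrix.SpecialLinearGroup (Fin n) ℚ⟦X⟧) = 0 := by
  ext i j
  exact coeff_one_apply hr i j

theorem coeffMatrix_pow {r : ℕ} (hr : r ≠ 0) {x : Matrix.SpecialLinearGroup (Fin n) ℚ⟦X⟧}
    (hx : x ∈ seriesCongr n r) (m : ℕ) : coeffMatrix r (x ^ m) = (m : ℚ) • coeffMatrix r x := by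
  induction m with
  | zero => rw [pow_zero, coeffMatrix_one hr, Nat.cast_zero, zero_smul]
  | succ m ih =>
    rw [pow_succ, coeffMatrix_mul hr (pow_mem (seriesCongr_antitone (by omega) hx) m) hx, ih,
      Nat.cast_succ, add_smul, one_smul]

theorem coeffMatrix_inv {r : ℕ} (hr : r ≠ 0) {x : Matrix.SpecialLinearGroup (Fin n) ℚ⟦X⟧}
    (hx : x ∈ seriesCongr n r) : coeffMatrix r x⁻¹ = -coeffMatrix r x := by
  have h := coeffMatrix_mul hr (inv_mem (seriesCongr_antitone (by omega) hx)) hx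
  rw [inv_mul_cancel, coeffMatrix_one hr] at h
  exact eq_neg_of_add_eq_zero_left h.symm

/-- `det (1 + T^r A)` is `1 + T^r tr A` up to a multiple of `T^(2r)`. -/
theorem trace_coeffMatrix {r : ℕ} (hr : r ≠ 0) {x : Matrix.SpecialLinearGroup (Fin n) ℚ⟦X⟧}
    (hx : x ∈ seriesCongr n r) : (coeffMatrix r x).trace = 0 := by
  obtain ⟨A, hA⟩ := mem_seriesCongr_iff_exists.1 hx
  have hdet := x.2
  rw [hA, det_one_add_smul, add_assoc, add_eq_left] at hdet
  have h := congrArg (coeff r) hdet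
  rw [map_add, map_zero, mul_comm, coeff_X_pow_mul', if_pos le_rfl, ← pow_mul, mul_comm _ (X ^ _),
    coeff_X_pow_mul', if_neg (by omega), add_zero, Nat.sub_self,
    coeff_zero_eq_constantCoeff_apply] at h
  rw [← h, trace, trace, map_sum]
  exact Finset.sum_congr rfl fun i _ => coeffMatrix_of_eq hr hA i i

/-- `⁅x, y⁆ - 1 = (x y - y x)(y x)⁻¹`, and only the parts `T^r A` and `T^s B` contribute to `x y - y
x`. -/
theorem seriesCongr_commutator_mem {r s : ℕ} {x y : Matrix.SpecialLinearGroup (Fin n) ℚ⟦X⟧}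
    (hx : x ∈ seriesCongr n r) (hy : y ∈ seriesCongr n s) : ⁅x, y⁆ ∈ seriesCongr n (r + s) := by
  obtain ⟨A, hA⟩ := mem_seriesCongr_iff_exists.1 hx
  obtain ⟨B, hB⟩ := mem_seriesCongr_iff_exists.1 hy
  refine mem_seriesCongr_iff_exists.2 ⟨(A * B - B * A) * (y * x)⁻¹.1, ?_⟩
  have h1 : ⁅x, y⁆.1 = (x * y).1 * (y * x)⁻¹.1 := by
    rw [← Matrix.SpecialLinearGroup.coe_mul, commutatorElement_def, _root_.mul_inv_rev, ← mul_assoc]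
  have h2 : (x * y).1 = (y * x).1 + (X : ℚ⟦X⟧) ^ (r + s) • (A * B - B * A) := by
    rw [Matrix.SpecialLinearGroup.coe_mul, Matrix.SpecialLinearGroup.coe_mul, hA, hB]
    simp only [mul_add, add_mul, one_mul, mul_one, smul_mul_smul_comm, ← pow_add, smul_sub,
      add_comm s r]
    abel
  rw [h1, h2, add_mul, ← Matrix.SpecialLinearGroup.coe_mul, mul_inv_cancel, smul_mul]
  rfl

theorem eq_of_forall_seriesCongr {x y : Matrix.SpecialLinearGroup (Fin n) ℚ⟦X⟧}
    (h : ∀ r, x⁻¹ * y ∈ seriesCongr n r) : x = y := by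
  rw [← inv_mul_eq_one]
  ext i j m
  have := mem_seriesCongr_iff_coeff.1 (h (m + 1)) i j m (by omega)
  rwa [Matrix.sub_apply, map_sub, sub_eq_zero] at this

/-- Elements are congruent modulo level `r` exactly if their coefficients below `r` agree. -/
theorem inv_mul_mem_seriesCongr_iff {r : ℕ} {x y : Matrix.SpecialLinearGroup (Fin n) ℚ⟦X⟧} :
    x⁻¹ * y ∈ seriesCongr n r ↔ ∀ m < r, coeffMatrix m x = coeffMatrix m y := by
  rw [← QuotientGroup.eq]
  have : (QuotientGroup.mk x : _ ⧸ seriesCongr n r) = QuotientGroup.mk y ↔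
      Matrix.SpecialLinearGroup.map (Ideal.Quotient.mk (Ideal.span {(X : ℚ⟦X⟧) ^ r})) x =
      Matrix.SpecialLinearGroup.map (Ideal.Quotient.mk (Ideal.span {(X : ℚ⟦X⟧) ^ r})) y := by
    rw [QuotientGroup.eq, seriesCongr, slKer, MonoidHom.mem_ker, map_mul, map_inv,
      inv_mul_eq_one]
  rw [this, Matrix.SpecialLinearGroup.ext_iff]
  have h2 : ∀ i j, ((Matrix.SpecialLinearGroup.map (Ideal.Quotient.mk (Ideal.span {(X : ℚ⟦X⟧) ^ r})) x) i j
      = (Matrix.SpecialLinearGroup.map (Ideal.Quotient.mk (Ideal.span {(X : ℚ⟦X⟧) ^ r})) y) i j) ↔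
      ∀ m < r, coeff m (x i j) = coeff m (y i j) := by
    intro i j
    change Ideal.Quotient.mk _ (x i j) = Ideal.Quotient.mk _ (y i j) ↔ _
    rw [Ideal.Quotient.eq, Ideal.mem_span_singleton, X_pow_dvd_iff]
    simp only [map_sub, sub_eq_zero]
  simp only [h2]
  exact ⟨fun h m hm => by ext i j; exact h i j m hm,
    fun h i j m hm => congrFun (congrFun (h m hm) i) j⟩

end SeriesCongr

/-! ### Transvections along orthogonal pairs of integral vectors -/

section OrthoTrans

open Matrix
open scoped commutatorElement

variable {ι : Type*} [Fintype ι] [DecidableEq ι] {R : Type*} [CommRing R]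

/-- The matrix of rank at most one of a pair of integral vectors. -/
def rankOne (R : Type*) [CommRing R] (v u : ι → ℤ) : Matrix ι ι R :=
  vecMulVec (fun i => (v i : R)) (fun i => (u i : R))

theorem rankOne_apply (v u : ι → ℤ) (i j : ι) : rankOne R v u i j = (v i : R) * u j := rfl

theorem rankOne_mul_rankOne (v u v' u' : ι → ℤ) :
    rankOne R v u * rankOne R v' u' = ((u ⬝ᵥ v' : ℤ) : R) • rankOne R v u' := by
  ext i j
  simp only [mul_apply, rankOne_apply, Matrix.smul_apply, smul_eq_mul, dotProduct, Int.cast_sum,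
    Int.cast_mul, Finset.sum_mul]
  exact Finset.sum_congr rfl fun k _ => by ring

theorem rankOne_add_left (v v' u : ι → ℤ) :
    rankOne R (v + v') u = rankOne R v u + rankOne R v' u := by
  ext i j
  simp only [rankOne_apply, Matrix.add_apply, Pi.add_apply, Int.cast_add, add_mul]

theorem rankOne_add_right (v u u' : ι → ℤ) :
    rankOne R v (u + u') = rankOne R v u + rankOne R v u' := by
  ext i j
  simp only [rankOne_apply, Matrix.add_apply, Pi.add_apply, Int.cast_add, mul_add]

theorem rankOne_smul_left (c : ℤ) (v u : ι → ℤ) :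
    rankOne R (c • v) u = (c : R) • rankOne R v u := by
  ext i j
  simp only [rankOne_apply, Matrix.smul_apply, Pi.smul_apply, smul_eq_mul, Int.cast_mul, mul_assoc]

theorem rankOne_smul_right (c : ℤ) (v u : ι → ℤ) :
    rankOne R v (c • u) = (c : R) • rankOne R v u := by
  ext i j
  simp only [rankOne_apply, Matrix.smul_apply, Pi.smul_apply, smul_eq_mul, Int.cast_mul]
  ring

theorem det_one_add_smul_rankOne (f : R) {v u : ι → ℤ} (h : v ⬝ᵥ u = 0) :
    (1 + f • rankOne R v u).det = 1 := by
  have h2 : f • rankOne R v u = replicateCol Unit (fun i => f * (v i : R)) *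
      replicateRow Unit (fun i => (u i : R)) := by
    ext i j
    simp [rankOne_apply, mul_apply, mul_assoc]
  have h3 : (fun i => (u i : R)) ⬝ᵥ (fun i => f * (v i : R)) = f * ((v ⬝ᵥ u : ℤ) : R) := by
    simp only [dotProduct, Int.cast_sum, Int.cast_mul, Finset.mul_sum]
    exact Finset.sum_congr rfl fun k _ => by ring
  rw [h2, det_one_add_replicateCol_mul_replicateRow, h3, h, Int.cast_zero, mul_zero, add_zero]

/-- The transvection `1 + f v uᵀ` for orthogonal vectors `v` and `u`; the identity for other pairs. -/
def orthoTrans (f : R) (v u : ι → ℤ) : Matrix.SpecialLinearGroup ι R :=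
  if h : v ⬝ᵥ u = 0 then ⟨1 + f • rankOne R v u, det_one_add_smul_rankOne f h⟩ else 1

theorem coe_orthoTrans (f : R) {v u : ι → ℤ} (h : v ⬝ᵥ u = 0) :
    (orthoTrans f v u : Matrix ι ι R) = 1 + f • rankOne R v u := by
  have : orthoTrans f v u = ⟨1 + f • rankOne R v u, det_one_add_smul_rankOne f h⟩ := dif_pos h
  rw [this]

theorem orthoTrans_of_ne (f : R) {v u : ι → ℤ} (h : v ⬝ᵥ u ≠ 0) : orthoTrans f v u = 1 :=
  dif_neg h

theorem sl_ext {x y : Matrix.SpecialLinearGroup ι R} (h : (x : Matrix ι ι R) = y) : x = y :=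
  Subtype.ext h

theorem orthoTrans_add_coeff (f g : R) {v u : ι → ℤ} (h : v ⬝ᵥ u = 0) :
    orthoTrans (f + g) v u = orthoTrans f v u * orthoTrans g v u := by
  apply sl_ext
  rw [Matrix.SpecialLinearGroup.coe_mul, coe_orthoTrans _ h, coe_orthoTrans _ h,
    coe_orthoTrans _ h, Matrix.mul_add, Matrix.add_mul, Matrix.add_mul, smul_mul_smul_comm,
    rankOne_mul_rankOne, dotProduct_comm u v, h, add_smul]
  simp [add_assoc]

theorem orthoTrans_zero_coeff (v u : ι → ℤ) : orthoTrans (0 : R) v u = 1 := by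
  by_cases h : v ⬝ᵥ u = 0
  · apply sl_ext
    rw [coe_orthoTrans _ h, zero_smul, add_zero, Matrix.SpecialLinearGroup.coe_one]
  · exact orthoTrans_of_ne _ h

theorem orthoTrans_zero_right (f : R) (v : ι → ℤ) : orthoTrans f v 0 = 1 := by
  apply sl_ext
  rw [coe_orthoTrans _ (dotProduct_zero v), Matrix.SpecialLinearGroup.coe_one,
    show rankOne R v 0 = 0 by ext i j; simp [rankOne_apply], smul_zero, add_zero]

theorem orthoTrans_zero_left (f : R) (u : ι → ℤ) : orthoTrans f 0 u = 1 := by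
  apply sl_ext
  rw [coe_orthoTrans _ (zero_dotProduct u), Matrix.SpecialLinearGroup.coe_one,
    show rankOne R 0 u = 0 by ext i j; simp [rankOne_apply], smul_zero, add_zero]

theorem orthoTrans_neg_coeff (f : R) {v u : ι → ℤ} (h : v ⬝ᵥ u = 0) :
    orthoTrans (-f) v u = (orthoTrans f v u)⁻¹ := by
  rw [eq_inv_iff_mul_eq_one, ← orthoTrans_add_coeff _ _ h, neg_add_cancel, orthoTrans_zero_coeff]

theorem orthoTrans_add_left (f : R) {v v' u : ι → ℤ} (h : v ⬝ᵥ u = 0) (h' : v' ⬝ᵥ u = 0) :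
    orthoTrans f (v + v') u = orthoTrans f v u * orthoTrans f v' u := by
  apply sl_ext
  rw [Matrix.SpecialLinearGroup.coe_mul, coe_orthoTrans _ h, coe_orthoTrans _ h',
    coe_orthoTrans _ (by rw [add_dotProduct, h, h', add_zero]), Matrix.mul_add, Matrix.add_mul,
    Matrix.add_mul, smul_mul_smul_comm,
    rankOne_mul_rankOne, dotProduct_comm u v', h', rankOne_add_left, smul_add]
  simp [add_assoc]

theorem orthoTrans_add_right (f : R) {v u u' : ι → ℤ} (h : v ⬝ᵥ u = 0) (h' : v ⬝ᵥ u' = 0) :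
    orthoTrans f v (u + u') = orthoTrans f v u * orthoTrans f v u' := by
  apply sl_ext
  rw [Matrix.SpecialLinearGroup.coe_mul, coe_orthoTrans _ h, coe_orthoTrans _ h',
    coe_orthoTrans _ (by rw [dotProduct_add, h, h', add_zero]), Matrix.mul_add, Matrix.add_mul,
    Matrix.add_mul, smul_mul_smul_comm,
    rankOne_mul_rankOne, dotProduct_comm u v, h, rankOne_add_right, smul_add]
  simp [add_assoc]

theorem orthoTrans_smul_left (c : ℤ) (f : R) {v u : ι → ℤ} (h : v ⬝ᵥ u = 0) :
    orthoTrans f (c • v) u = orthoTrans (f * c) v u := by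
  apply sl_ext
  rw [coe_orthoTrans _ h, coe_orthoTrans _ (by rw [smul_dotProduct, h, smul_zero]),
    rankOne_smul_left, smul_smul]

theorem orthoTrans_smul_right (c : ℤ) (f : R) {v u : ι → ℤ} (h : v ⬝ᵥ u = 0) :
    orthoTrans f v (c • u) = orthoTrans (f * c) v u := by
  apply sl_ext
  rw [coe_orthoTrans _ h, coe_orthoTrans _ (by rw [dotProduct_smul, h, smul_zero]),
    rankOne_smul_right, smul_smul]

/-- As `v` is orthogonal to `u'`, the only product of the two rank-one matrices that can be nonzero
is `v uᵀ v' u'ᵀ`. -/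
theorem orthoTrans_commutator_left (f g : R) {v u v' u' : ι → ℤ} (h : v ⬝ᵥ u = 0)
    (h' : v' ⬝ᵥ u' = 0) (h₂ : v ⬝ᵥ u' = 0) :
    ⁅orthoTrans f v u, orthoTrans g v' u'⁆ = orthoTrans (f * g * (u ⬝ᵥ v' : ℤ)) v u' := by
  rw [commutatorElement_def, mul_inv_eq_iff_eq_mul, mul_inv_eq_iff_eq_mul]
  apply sl_ext
  simp only [Matrix.SpecialLinearGroup.coe_mul, coe_orthoTrans _ h, coe_orthoTrans _ h',
    coe_orthoTrans _ h₂, Matrix.mul_add, Matrix.add_mul, smul_mul_smul_comm, rankOne_mul_rankOne,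
    dotProduct_comm u' v', h']
  simp only [Matrix.mul_one, Matrix.one_mul, Int.cast_zero, zero_smul, smul_zero, add_zero,
    smul_smul, Matrix.smul_mul, Matrix.mul_smul, rankOne_mul_rankOne,
    dotProduct_comm u' v, h₂, zero_mul]
  abel

theorem orthoTrans_commutator_right (f g : R) {v u v' u' : ι → ℤ} (h : v ⬝ᵥ u = 0)
    (h' : v' ⬝ᵥ u' = 0) (h₂ : v' ⬝ᵥ u = 0) :
    ⁅orthoTrans f v u, orthoTrans g v' u'⁆ = orthoTrans (-(f * g * (u' ⬝ᵥ v : ℤ))) v' u := by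
  rw [orthoTrans_neg_coeff _ h₂, mul_comm f, ← orthoTrans_commutator_left _ _ h' h h₂,
    commutatorElement_inv]

theorem orthoTrans_map {S : Type*} [CommRing S] (φ : R →+* S) (f : R) (v u : ι → ℤ) :
    Matrix.SpecialLinearGroup.map φ (orthoTrans f v u) = orthoTrans (φ f) v u := by
  by_cases h : v ⬝ᵥ u = 0
  · apply sl_ext
    rw [coe_orthoTrans _ h]
    change φ.mapMatrix (orthoTrans f v u : Matrix ι ι R) = _
    rw [coe_orthoTrans _ h, map_add, map_one]
    congr 1
    ext i j
    simp [rankOne_apply]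
  · rw [orthoTrans_of_ne _ h, orthoTrans_of_ne _ h, map_one]

/-- The matrix with integral entries, as a matrix over `R`. -/
abbrev slCast (R : Type*) [CommRing R] :
    Matrix.SpecialLinearGroup ι ℤ →* Matrix.SpecialLinearGroup ι R :=
  Matrix.SpecialLinearGroup.map (Int.castRingHom R)

theorem orthoTrans_conj (γ : Matrix.SpecialLinearGroup ι ℤ) (f : R) {v u : ι → ℤ}
    (h : v ⬝ᵥ u = 0) :
    ((γ : Matrix ι ι ℤ) *ᵥ v) ⬝ᵥ (u ᵥ* (γ⁻¹ : Matrix.SpecialLinearGroup ι ℤ)) = 0 ∧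
    slCast R γ * orthoTrans f v u * (slCast R γ)⁻¹ =
      orthoTrans f ((γ : Matrix ι ι ℤ) *ᵥ v) (u ᵥ* (γ⁻¹ : Matrix.SpecialLinearGroup ι ℤ)) := by
  have h1 : ((γ : Matrix ι ι ℤ) *ᵥ v) ⬝ᵥ (u ᵥ* (γ⁻¹ : Matrix.SpecialLinearGroup ι ℤ)) = 0 := by
    rw [dotProduct_comm, ← dotProduct_mulVec, mulVec_mulVec, ← Matrix.SpecialLinearGroup.coe_mul,
      inv_mul_cancel, Matrix.SpecialLinearGroup.coe_one, one_mulVec, dotProduct_comm, h]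
  refine ⟨h1, ?_⟩
  rw [mul_inv_eq_iff_eq_mul]
  apply sl_ext
  have h2 : ((slCast R γ : Matrix.SpecialLinearGroup ι R) : Matrix ι ι R) * rankOne R v u =
      rankOne R ((γ : Matrix ι ι ℤ) *ᵥ v) u := by
    ext i j
    rw [mul_apply, rankOne_apply, mulVec, dotProduct, Int.cast_sum, Finset.sum_mul]
    refine Finset.sum_congr rfl fun k _ => ?_
    rw [rankOne_apply, Int.cast_mul, mul_assoc]
    rfl
  have h3 : rankOne R ((γ : Matrix ι ι ℤ) *ᵥ v) (u ᵥ* (γ⁻¹ : Matrix.SpecialLinearGroup ι ℤ)) *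
      ((slCast R γ : Matrix.SpecialLinearGroup ι R) : Matrix ι ι R) =
      rankOne R ((γ : Matrix ι ι ℤ) *ᵥ v) u := by
    have h4 : u = (u ᵥ* (γ⁻¹ : Matrix.SpecialLinearGroup ι ℤ)) ᵥ* (γ : Matrix ι ι ℤ) := by
      rw [vecMul_vecMul, ← Matrix.SpecialLinearGroup.coe_mul, inv_mul_cancel,
        Matrix.SpecialLinearGroup.coe_one, vecMul_one]
    conv_rhs => rw [h4]
    ext i j
    rw [mul_apply, rankOne_apply, vecMul, dotProduct, Int.cast_sum, Finset.mul_sum]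
    refine Finset.sum_congr rfl fun k _ => ?_
    rw [rankOne_apply, Int.cast_mul, mul_assoc]
    rfl
  rw [Matrix.SpecialLinearGroup.coe_mul, Matrix.SpecialLinearGroup.coe_mul, coe_orthoTrans _ h,
    coe_orthoTrans _ h1, Matrix.mul_add, Matrix.add_mul, Matrix.mul_smul, Matrix.smul_mul, h2, h3,
    Matrix.mul_one, Matrix.one_mul]

theorem single_dotProduct_single {i j : ι} (h : i ≠ j) :
    (Pi.single i (1 : ℤ) : ι → ℤ) ⬝ᵥ (Pi.single j (1 : ℤ)) = 0 := by
  rw [single_dotProduct, Pi.single_eq_of_ne h, mul_zero]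

theorem coe_orthoTrans_single (f : R) {i j : ι} (h : i ≠ j) :
    (orthoTrans f (Pi.single i 1) (Pi.single j 1) : Matrix ι ι R) = transvection i j f := by
  rw [coe_orthoTrans _ (single_dotProduct_single h), transvection]
  congr 1
  ext k l
  rw [Matrix.smul_apply, rankOne_apply, Matrix.single_apply, Pi.single_apply, Pi.single_apply]
  simp only [eq_comm (a := k), eq_comm (a := l)]
  by_cases hk : i = k <;> by_cases hl : j = l <;> simp [hk, hl]

/-- A subgroup that is normalised by `SL(ℤ)` and contains the elementary transvections with
coefficients in `f ℤ` contains all transvections along orthogonal pairs with these coefficients. -/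
theorem orthoTrans_mem (hι : 2 ≤ Fintype.card ι)
    {H : Subgroup (Matrix.SpecialLinearGroup ι R)}
    (hH : ∀ γ, ∀ x ∈ H, slCast R γ * x * (slCast R γ)⁻¹ ∈ H) {f : R}
    (hf : ∀ i j, i ≠ j → ∀ c : ℤ, orthoTrans (f * c) (Pi.single i 1) (Pi.single j 1) ∈ H)
    {v u : ι → ℤ} (h : v ⬝ᵥ u = 0) : orthoTrans f v u ∈ H := by
  obtain ⟨o⟩ : Nonempty ι := Fintype.card_pos_iff.1 (by omega)
  -- If the second vector is a multiple of the basis vector at `o` and `w` has no `o`-coordinate,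
  -- the transvection is a product of elementary ones in column `o`.
  have col : ∀ (c : ℤ) (w : ι → ℤ), w o = 0 → orthoTrans f w (c • Pi.single o 1) ∈ H := by
    intro c w hw
    have key : ∀ s : Finset ι, (∑ i ∈ s, w i • (Pi.single i 1 : ι → ℤ)) ⬝ᵥ
        (c • Pi.single o 1) = 0 ∧
        orthoTrans f (∑ i ∈ s, w i • (Pi.single i 1 : ι → ℤ)) (c • Pi.single o 1) ∈ H := by
      intro s
      induction s using Finset.induction_on with
      | empty => simp [orthoTrans_zero_left]
      | insert i s hi ih =>
        have h1 : (w i • (Pi.single i 1 : ι → ℤ)) ⬝ᵥ (c • Pi.single o 1) = 0 := by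
          rw [smul_dotProduct, dotProduct_smul]
          by_cases hio : i = o
          · rw [hio, hw, zero_smul]
          · rw [single_dotProduct_single hio, smul_zero, smul_zero]
        rw [Finset.sum_insert hi]
        refine ⟨by rw [add_dotProduct, h1, ih.1, add_zero], ?_⟩
        rw [orthoTrans_add_left _ h1 ih.1]
        refine mul_mem ?_ ih.2
        by_cases hio : i = o
        · rw [hio, hw, zero_smul, orthoTrans_zero_left]; exact one_mem _
        · have h2 := single_dotProduct_single hio
          rw [orthoTrans_smul_left _ _ (by rw [dotProduct_smul, h2, smul_zero]),
            orthoTrans_smul_right _ _ h2, mul_assoc, ← Int.cast_mul]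
          exact hf i o hio _
    have hsum : w = ∑ i, w i • (Pi.single i 1 : ι → ℤ) := by
      ext k; simp [Finset.sum_apply, Pi.single_apply]
    rw [hsum]
    exact (key _).2
  -- An integral elementary matrix moves `u` to a multiple of the basis vector at `o`. Unless that
  -- multiple is zero, orthogonality kills the `o`-coordinate of the transformed `v`.
  obtain ⟨A, hA, hAu⟩ := exists_vecMul_eq_zero (Finset.mem_univ o) u
  let γ : Matrix.SpecialLinearGroup ι ℤ := ⟨A, elemMonoid_det hA⟩
  have hu : u ᵥ* (γ : Matrix ι ι ℤ) = (u ᵥ* A) o • Pi.single o 1 := by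
    ext k
    by_cases hk : k = o
    · subst hk; simp [γ]
    · rw [Pi.smul_apply, Pi.single_eq_of_ne hk, smul_zero]
      exact hAu k (Finset.mem_univ k) hk
  obtain ⟨h1, h2⟩ := orthoTrans_conj γ⁻¹ f h
  rw [inv_inv, hu] at h1 h2
  have h3 : orthoTrans f ((γ⁻¹ : Matrix.SpecialLinearGroup ι ℤ) *ᵥ v)
      ((u ᵥ* A) o • Pi.single o 1) ∈ H := by
    by_cases h0 : (u ᵥ* A) o = 0
    · rw [h0, zero_smul, orthoTrans_zero_right]; exact one_mem _
    · refine col _ _ ?_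
      rw [dotProduct_smul, dotProduct_single, mul_one, smul_eq_mul] at h1
      exact (mul_eq_zero.1 h1).resolve_left h0
  rw [← h2] at h3
  have h4 := hH γ _ h3
  rwa [map_inv, inv_inv, show slCast R γ * ((slCast R γ)⁻¹ * orthoTrans f v u * slCast R γ) *
    (slCast R γ)⁻¹ = orthoTrans f v u by group] at h4

end OrthoTrans

/-! ### Characters of the graded pieces of the lower central series of a congruence kernel -/

section Expansion

open Matrix
open scoped commutatorElement

/-- A ring `R` with an augmentation `a` whose kernel is generated by `τ`, embedded in `ℚ⟦T⟧`
compatibly with the augmentation and with `τ ↦ T`. -/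
structure IsExpansion {R : Type} [CommRing R] (a : R →+* ℤ) (e : R →+* ℚ⟦X⟧) (τ : R) : Prop where
  constantCoeff_eq : ∀ x, PowerSeries.constantCoeff (e x) = (a x : ℚ)
  map_uniformizer : e τ = PowerSeries.X
  dvd_of_map_eq_zero : ∀ x, a x = 0 → τ ∣ x
  injective : Function.Injective e

namespace IsExpansion

variable {n : ℕ} {R : Type} [CommRing R] {a : R →+* ℤ} {e : R →+* ℚ⟦X⟧} {τ : R}
  (h : IsExpansion a e τ)

instance (n : ℕ) {R S : Type} [CommRing R] [CommRing S] (f : R →+* S) : (slKer n f).Normal := by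
  unfold slKer; infer_instance

include h

theorem map_uniformizer_eq_zero : a τ = 0 := by
  have := h.constantCoeff_eq τ
  rw [h.map_uniformizer, PowerSeries.constantCoeff_X] at this
  exact_mod_cast this.symm

theorem exists_eq (x : R) : ∃ y, x = (a x : R) + τ * y := by
  obtain ⟨y, hy⟩ := h.dvd_of_map_eq_zero (x - (a x : R)) (by simp)
  exact ⟨y, by rw [← hy]; ring⟩

theorem dvd_iff (r : ℕ) (x : R) : τ ^ r ∣ x ↔ (PowerSeries.X : ℚ⟦X⟧) ^ r ∣ e x := by
  constructor
  · rintro ⟨y, rfl⟩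
    exact ⟨e y, by rw [map_mul, map_pow, h.map_uniformizer]⟩
  · induction r generalizing x with
    | zero => intro _; simp
    | succ r ih =>
      intro hx
      have h0 : a x = 0 := by
        have := PowerSeries.X_dvd_iff.1 ((dvd_pow_self _ r.succ_ne_zero).trans hx)
        rw [h.constantCoeff_eq] at this
        exact_mod_cast this
      obtain ⟨y, rfl⟩ := h.dvd_of_map_eq_zero x h0
      rw [map_mul, h.map_uniformizer, pow_succ'] at hx
      rw [pow_succ']
      exact mul_dvd_mul_left _ (ih y ((mul_dvd_mul_iff_left PowerSeries.X_ne_zero).1 hx))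

theorem orthoTrans_mem_slKer (g : R) (v u : Fin n → ℤ) : orthoTrans (τ * g) v u ∈ slKer n a := by
  rw [slKer, MonoidHom.mem_ker, orthoTrans_map, map_mul, h.map_uniformizer_eq_zero, zero_mul,
    orthoTrans_zero_coeff]

theorem map_mem_seriesCongr_one {x : Matrix.SpecialLinearGroup (Fin n) R} (hx : x ∈ slKer n a) :
    Matrix.SpecialLinearGroup.map e x ∈ seriesCongr n 1 := by
  rw [← seriesKer_eq]
  rw [mem_slKer_iff] at hx ⊢
  intro i j
  have h1 : e ((1 : Matrix (Fin n) (Fin n) R) i j) = (1 : Matrix (Fin n) (Fin n) ℚ⟦X⟧) i j := by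
    by_cases h : i = j
    · rw [h, one_apply_eq, one_apply_eq, map_one]
    · rw [one_apply_ne h, one_apply_ne h, map_zero]
  change PowerSeries.constantCoeff (e (x i j) - _) = 0
  rw [← h1, ← map_sub, h.constantCoeff_eq, hx i j, Int.cast_zero]

theorem map_mem_seriesCongr {r : ℕ} {x : Matrix.SpecialLinearGroup (Fin n) R}
    (hx : x ∈ (slKer n a).lowerCentralSeries r) :
    Matrix.SpecialLinearGroup.map e x ∈ seriesCongr n (r + 1) := by
  have : (slKer n a).lowerCentralSeries r ≤
      (seriesCongr n (r + 1)).comap (Matrix.SpecialLinearGroup.map e) := by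
    clear hx
    induction r with
    | zero => exact fun x hx => h.map_mem_seriesCongr_one hx
    | succ r ih =>
      rw [Subgroup.lowerCentralSeries_succ, Subgroup.commutator_le]
      intro y hy z hz
      rw [Subgroup.mem_comap, map_commutatorElement]
      exact seriesCongr_commutator_mem (ih hy) (h.map_mem_seriesCongr_one hz)
  exact this hx

/-- The coefficients of the leading term. -/
theorem coeffMatrix_orthoTrans {r : ℕ} (hr : r ≠ 0) {v u : Fin n → ℤ} (hvu : v ⬝ᵥ u = 0)
    (i j : Fin n) : coeffMatrix r (Matrix.SpecialLinearGroup.map e (orthoTrans (τ ^ r) v u)) i j =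
      v i * u j := by
  rw [orthoTrans_map, map_pow, h.map_uniformizer, coeffMatrix_of_eq hr (coe_orthoTrans _ hvu),
    rankOne_apply, map_mul, map_intCast, map_intCast]

/-- Through a third index, an elementary matrix with coefficient divisible by `τ^(r+2)` is a
commutator of two with coefficients divisible by `τ^(r+1)` and `τ`; `orthoTrans_mem` passes to all
orthogonal pairs. -/
theorem orthoTrans_mem_lowerCentralSeries (hn : 3 ≤ n) (r : ℕ) (g : R) {v u : Fin n → ℤ}
    (hvu : v ⬝ᵥ u = 0) : orthoTrans (τ ^ (r + 1) * g) v u ∈ (slKer n a).lowerCentralSeries r := by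
  refine orthoTrans_mem (by rw [Fintype.card_fin]; omega)
    (fun γ x hx => ((slKer n a).lowerCentralSeries_normal r).conj_mem x hx _)
    (fun i j hij c => ?_) hvu
  rw [mul_assoc]
  generalize g * (c : R) = g
  induction r generalizing i j with
  | zero => rw [zero_add, pow_one]; exact h.orthoTrans_mem_slKer _ _ _
  | succ r ih =>
    obtain ⟨k, hki, hkj⟩ := TrivialSymbol.exists_third (by rwa [Fintype.card_fin]) i j
    have := orthoTrans_commutator_left (τ ^ (r + 1) * g) τ
      (single_dotProduct_single hki.symm) (single_dotProduct_single hkj)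
      (single_dotProduct_single hij)
    rw [single_dotProduct, Pi.single_eq_same, mul_one, Int.cast_one, mul_one,
      show τ ^ (r + 1) * g * τ = τ ^ (r + 1 + 1) * g by ring] at this
    rw [← this]
    have hk := h.orthoTrans_mem_slKer 1 (Pi.single k 1 : Fin n → ℤ) (Pi.single j 1)
    rw [mul_one] at hk
    exact Subgroup.commutator_mem_commutator (ih i k hki.symm) hk

/-- The congruence kernel is generated by the conjugates of elementary transvections. -/
theorem slKer_eq_closure
    (hE : ∀ Y : Matrix (Fin n) (Fin n) R, Y.det = 1 → Y ∈ elemMonoid R .univ) :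
    slKer n a = Subgroup.closure {x | ∃ (γ : Matrix.SpecialLinearGroup (Fin n) ℤ) (i j : Fin n)
      (g : R), i ≠ j ∧ x = slCast R γ * orthoTrans (τ * g) (Pi.single i 1) (Pi.single j 1) *
        (slCast R γ)⁻¹} := by
  set S := {x | ∃ (γ : Matrix.SpecialLinearGroup (Fin n) ℤ) (i j : Fin n)
      (g : R), i ≠ j ∧ x = slCast R γ * orthoTrans (τ * g) (Pi.single i 1) (Pi.single j 1) *
        (slCast R γ)⁻¹} with hS
  have hle : Subgroup.closure S ≤ slKer n a := by
    rw [Subgroup.closure_le]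
    rintro _ ⟨γ, i, j, g, -, rfl⟩
    exact (inferInstance : (slKer n a).Normal).conj_mem _ (h.orthoTrans_mem_slKer _ _ _) _
  refine le_antisymm (fun Y hY => ?_) hle
  have hconj : ∀ (γ : Matrix.SpecialLinearGroup (Fin n) ℤ), ∀ x ∈ Subgroup.closure S,
      slCast R γ * x * (slCast R γ)⁻¹ ∈ Subgroup.closure S := by
    intro γ x hx
    induction hx using Subgroup.closure_induction with
    | mem x hx =>
      obtain ⟨γ', i, j, g, hij, rfl⟩ := hx
      refine Subgroup.subset_closure ⟨γ * γ', i, j, g, hij, ?_⟩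
      rw [map_mul]; group
    | one => simp
    | mul x y _ _ hx hy =>
      have := mul_mem hx hy
      rwa [show slCast R γ * x * (slCast R γ)⁻¹ * (slCast R γ * y * (slCast R γ)⁻¹) =
        slCast R γ * (x * y) * (slCast R γ)⁻¹ by group] at this
    | inv x _ hx =>
      have := inv_mem hx
      rwa [show (slCast R γ * x * (slCast R γ)⁻¹)⁻¹ = slCast R γ * x⁻¹ * (slCast R γ)⁻¹ by
        group] at this
  -- As `R = ℤ + τ R`, an elementary matrix is a member of `S` times an integral one. The closure of
  -- `S` is normalized by integral matrices, so products keep this shape; for an element of the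
  -- kernel, the augmentation shows that the integral factor is `1`.
  have key : ∀ M ∈ elemMonoid R (Finset.univ : Finset (Fin n)), ∃ ν ∈ Subgroup.closure S,
      ∃ γ : Matrix.SpecialLinearGroup (Fin n) ℤ,
        M = (ν * slCast R γ : Matrix.SpecialLinearGroup (Fin n) R) := by
    intro M hM
    induction hM using Submonoid.closure_induction with
    | mem M hM =>
      obtain ⟨i, -, j, -, hij, c, rfl⟩ := hM
      obtain ⟨y, hy⟩ := h.exists_eq c
      refine ⟨orthoTrans (τ * y) (Pi.single i 1) (Pi.single j 1),
        Subgroup.subset_closure ⟨1, i, j, y, hij, by simp⟩,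
        orthoTrans (a c) (Pi.single i 1) (Pi.single j 1), ?_⟩
      rw [slCast, orthoTrans_map, eq_intCast,
        ← orthoTrans_add_coeff _ _ (single_dotProduct_single hij), coe_orthoTrans_single _ hij,
        add_comm, ← hy]
    | one => exact ⟨1, one_mem _, 1, by simp⟩
    | mul M N _ _ hM hN =>
      obtain ⟨ν, hν, γ, rfl⟩ := hM
      obtain ⟨ν', hν', γ', rfl⟩ := hN
      refine ⟨ν * (slCast R γ * ν' * (slCast R γ)⁻¹), mul_mem hν (hconj γ _ hν'), γ * γ', ?_⟩
      rw [← Matrix.SpecialLinearGroup.coe_mul, map_mul]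
      refine congrArg _ ?_
      simp only [mul_assoc, inv_mul_cancel_left]
  obtain ⟨ν, hν, γ, hY'⟩ := key _ (hE _ Y.2)
  have hY2 : Y = ν * slCast R γ := sl_ext hY'
  have hνK := hle hν
  rw [slKer, MonoidHom.mem_ker] at hY hνK
  have hγ : Matrix.SpecialLinearGroup.map a (slCast R γ) = γ := by
    ext i j
    change a (((γ i j : ℤ)) : R) = _
    rw [map_intCast, Int.cast_id]
  rw [hY2, map_mul, hνK, one_mul, hγ] at hY
  rw [hY2, hY, map_one, mul_one]
  exact hν

end IsExpansion

end Expansion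

/-! ### Characters on commutators of opposite root elements. -/

section GradedChar

open Matrix
open scoped commutatorElement

/-- An antisymmetric function satisfying the cyclic cocycle relation vanishes. -/
theorem eq_zero_of_cyclic {r : ℕ} {Y : ℕ → ℕ → ℚ}
    (hanti : ∀ p q, p + q + 1 = r → Y p q = -Y q p)
    (hcyc : ∀ p q s, p + q + s + 2 = r → Y (p + q + 1) s + Y (s + p + 1) q + Y (q + s + 1) p = 0)
    {p q : ℕ} (hpq : p + q + 1 = r) : Y p q = 0 := by
  -- The cyclic relation at `(p, 0, q)` adds `Y 0 (r - 1)` at each step in `p`; antisymmetry at the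
  -- end of the range gives `(r + 1) * Y 0 (r - 1) = 0`.
  have key : ∀ p q, p + q + 1 = r → Y p q = (p + 1) * Y 0 (r - 1) := by
    intro p
    induction p with
    | zero => intro q hq; rw [show r - 1 = q by omega]; simp
    | succ p ih =>
      intro q hq
      have h1 := hcyc p 0 q (by omega)
      rw [hanti (q + p + 1) 0 (by omega), hanti (0 + q + 1) p (by omega),
        show q + p + 1 = r - 1 by omega, ih _ (by omega), add_zero] at h1
      push_cast
      linarith
  have h0 : Y 0 (r - 1) = 0 := by
    have h1 := hanti 0 (r - 1) (by omega)
    rw [key (r - 1) 0 (by omega)] at h1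
    have h2 : ((r - 1 : ℕ) : ℚ) + 1 + 1 ≠ 0 := by positivity
    have h3 : (((r - 1 : ℕ) : ℚ) + 1 + 1) * Y 0 (r - 1) = 0 := by linarith
    exact (mul_eq_zero.1 h3).resolve_left h2
  rw [key p q hpq, h0, mul_zero]

namespace IsExpansion

variable {n : ℕ} {R : Type} [CommRing R] {a : R →+* ℤ} {e : R →+* ℚ⟦X⟧} {τ : R}
  (h : IsExpansion a e τ)

include h

theorem orthoTrans_pow_mem (hn : 3 ≤ n) (r : ℕ) {v u : Fin n → ℤ} (hvu : v ⬝ᵥ u = 0) :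
    orthoTrans (τ ^ (r + 1)) v u ∈ (slKer n a).lowerCentralSeries r := by
  have := h.orthoTrans_mem_lowerCentralSeries hn r 1 hvu
  rwa [mul_one] at this

section

variable {r : ℕ} {f : Matrix.SpecialLinearGroup (Fin n) R → ℚ} (hn : 3 ≤ n)
  (hf : IsGradedChar (slKer n a) r f)
  (hkill : ∀ v u : Fin n → ℤ, v ⬝ᵥ u = 0 → f (orthoTrans (τ ^ (r + 1)) v u) = 0)

include hn hf hkill

theorem char_orthoTrans_int {v u : Fin n → ℤ} (hvu : v ⬝ᵥ u = 0) (c : ℤ) :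
    f (orthoTrans (τ ^ (r + 1) * c) v u) = 0 := by
  rw [← orthoTrans_smul_left _ _ hvu]
  exact hkill _ _ (by rw [smul_dotProduct, hvu, smul_zero])

/-- Only the augmentation of `g` counts: the remainder `τ y` gives a transvection in the next term.
-/
theorem char_orthoTrans {v u : Fin n → ℤ} (hvu : v ⬝ᵥ u = 0) (g : R) :
    f (orthoTrans (τ ^ (r + 1) * g) v u) = 0 := by
  obtain ⟨y, hy⟩ := h.exists_eq g
  have h1 := h.orthoTrans_mem_lowerCentralSeries hn (r + 1) y hvu
  have h2 := h.orthoTrans_mem_lowerCentralSeries hn r (a g) hvu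
  rw [hy, mul_add, ← mul_assoc (τ ^ (r + 1)) τ, ← pow_succ, orthoTrans_add_coeff _ _ hvu,
    hf.map_mul _ h2 _ ((slKer n a).lowerCentralSeries_antitone r.le_succ h1),
    hf.map_eq_zero _ h1, h.char_orthoTrans_int hn hf hkill hvu, add_zero]

theorem char_comp_conj (γ : Matrix.SpecialLinearGroup (Fin n) ℤ) {v u : Fin n → ℤ}
    (hvu : v ⬝ᵥ u = 0) :
    f (slCast R γ * orthoTrans (τ ^ (r + 1)) v u * (slCast R γ)⁻¹) = 0 := by
  obtain ⟨h1, h2⟩ := orthoTrans_conj γ (τ ^ (r + 1)) hvu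
  rw [h2]
  exact hkill _ _ h1

theorem char_commutator_left {p q : ℕ} (hr : p + q + 1 = r) {v u v' u' : Fin n → ℤ}
    (h1 : v ⬝ᵥ u = 0) (h2 : v' ⬝ᵥ u' = 0) (h3 : v ⬝ᵥ u' = 0) :
    f ⁅orthoTrans (τ ^ (p + 1)) v u, orthoTrans (τ ^ (q + 1)) v' u'⁆ = 0 := by
  rw [orthoTrans_commutator_left _ _ h1 h2 h3, ← pow_add,
    show p + 1 + (q + 1) = r + 1 by omega]
  exact h.char_orthoTrans_int hn hf hkill h3 _

theorem char_commutator_right {p q : ℕ} (hr : p + q + 1 = r) {v u v' u' : Fin n → ℤ}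
    (h1 : v ⬝ᵥ u = 0) (h2 : v' ⬝ᵥ u' = 0) (h3 : v' ⬝ᵥ u = 0) :
    f ⁅orthoTrans (τ ^ (p + 1)) v u, orthoTrans (τ ^ (q + 1)) v' u'⁆ = 0 := by
  rw [orthoTrans_commutator_right _ _ h1 h2 h3, ← pow_add,
    show p + 1 + (q + 1) = r + 1 by omega, ← mul_neg, ← Int.cast_neg]
  exact h.char_orthoTrans_int hn hf hkill h3 _

local notation:max "𝐞" i:max => (Pi.single i (1 : ℤ) : Fin n → ℤ)

/-- Since `𝐞 j + 𝐞 k` is orthogonal to `𝐞 j - 𝐞 k`, `f` kills the commutator of the transvections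
along `(𝐞 i, 𝐞 j - 𝐞 k)` and `(𝐞 j + 𝐞 k, 𝐞 i)`. In its biadditive expansion the mixed terms are
killed too, and the two opposite pairs remain with opposite signs. -/
theorem char_opposite_eq_right {p q : ℕ} (hr : p + q + 1 = r) {i j k : Fin n} (hij : i ≠ j)
    (hik : i ≠ k) (hjk : j ≠ k) :
    f ⁅orthoTrans (τ ^ (p + 1)) (𝐞 i) (𝐞 j), orthoTrans (τ ^ (q + 1)) (𝐞 j) (𝐞 i)⁆ =
      f ⁅orthoTrans (τ ^ (p + 1)) (𝐞 i) (𝐞 k), orthoTrans (τ ^ (q + 1)) (𝐞 k) (𝐞 i)⁆ := by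
  have dij := single_dotProduct_single hij
  have dik := single_dotProduct_single hik
  have dji := single_dotProduct_single hij.symm
  have dki := single_dotProduct_single hik.symm
  have djk := single_dotProduct_single hjk
  have dkj := single_dotProduct_single hjk.symm
  have djj : (𝐞 j) ⬝ᵥ (𝐞 j) = 1 := by simp
  have dkk : (𝐞 k) ⬝ᵥ (𝐞 k) = 1 := by simp
  have n1 : (𝐞 i) ⬝ᵥ (-𝐞 k) = 0 := by rw [dotProduct_neg, dik, neg_zero]
  have n2 : (𝐞 i) ⬝ᵥ (𝐞 j + -𝐞 k) = 0 := by rw [dotProduct_add, dij, n1, add_zero]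
  have n3 : (𝐞 j + 𝐞 k) ⬝ᵥ (𝐞 i) = 0 := by rw [add_dotProduct, dji, dki, add_zero]
  have n4 : (𝐞 j + 𝐞 k) ⬝ᵥ (𝐞 j + -𝐞 k) = 0 := by
    rw [add_dotProduct, dotProduct_add, dotProduct_add, dotProduct_neg, dotProduct_neg, djk, dkj,
      djj, dkk]; norm_num
  have hneg : orthoTrans (τ ^ (p + 1)) (𝐞 i) (-𝐞 k) =
      (orthoTrans (τ ^ (p + 1)) (𝐞 i) (𝐞 k))⁻¹ := by
    rw [← neg_one_smul ℤ, orthoTrans_smul_right _ _ dik, ← orthoTrans_neg_coeff _ dik]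
    congr 1; push_cast; ring
  have main := h.char_commutator_right hn hf hkill hr n2 n3 n4
  have mk := h.orthoTrans_pow_mem hn p dik
  have m1 := h.orthoTrans_pow_mem hn q dji
  have m2 := h.orthoTrans_pow_mem hn q dki
  rw [orthoTrans_add_right _ dij n1, hneg, hf.map_commutator_mul_left hr.symm
      (h.orthoTrans_pow_mem hn p dij) (inv_mem mk) (h.orthoTrans_pow_mem hn q n3),
    hf.map_commutator_inv_left hr.symm mk (h.orthoTrans_pow_mem hn q n3),
    orthoTrans_add_left _ dji dki, hf.map_commutator_mul_right hr.symm
      (h.orthoTrans_pow_mem hn p dij) m1 m2,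
    hf.map_commutator_mul_right hr.symm mk m1 m2,
    h.char_commutator_right hn hf hkill hr dij dki dkj,
    h.char_commutator_right hn hf hkill hr dik dji djk] at main
  linarith

theorem char_opposite_antisymm {p q : ℕ} (hr : p + q + 1 = r) {i j : Fin n} (hij : i ≠ j) :
    f ⁅orthoTrans (τ ^ (p + 1)) (𝐞 i) (𝐞 j), orthoTrans (τ ^ (q + 1)) (𝐞 j) (𝐞 i)⁆ =
      -f ⁅orthoTrans (τ ^ (q + 1)) (𝐞 j) (𝐞 i), orthoTrans (τ ^ (p + 1)) (𝐞 i) (𝐞 j)⁆ :=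
  hf.map_commutator _ _ (Subgroup.commutator_mem_lowerCentralSeries
    (h.orthoTrans_pow_mem hn q (single_dotProduct_single hij.symm))
    (h.orthoTrans_pow_mem hn p (single_dotProduct_single hij)) (by omega))

theorem char_opposite_eq_left {p q : ℕ} (hr : p + q + 1 = r) {i j k : Fin n} (hij : i ≠ j)
    (hik : i ≠ k) (hjk : j ≠ k) :
    f ⁅orthoTrans (τ ^ (p + 1)) (𝐞 i) (𝐞 j), orthoTrans (τ ^ (q + 1)) (𝐞 j) (𝐞 i)⁆ =
      f ⁅orthoTrans (τ ^ (p + 1)) (𝐞 k) (𝐞 j), orthoTrans (τ ^ (q + 1)) (𝐞 j) (𝐞 k)⁆ := by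
  rw [h.char_opposite_antisymm hn hf hkill hr hij,
    h.char_opposite_antisymm hn hf hkill hr hjk.symm,
    h.char_opposite_eq_right hn hf hkill (by omega) hij.symm hjk hik]

/-- Independence of the indices leaves a function of `(p, q)`, antisymmetric because commutators
are. Hall–Witt around the triangle `i → j → k → i` is the cyclic relation. -/
theorem char_opposite_eq_zero {p q : ℕ} (hr : p + q + 1 = r) {i j : Fin n} (hij : i ≠ j) :
    f ⁅orthoTrans (τ ^ (p + 1)) (𝐞 i) (𝐞 j), orthoTrans (τ ^ (q + 1)) (𝐞 j) (𝐞 i)⁆ = 0 := by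
  obtain ⟨k, hki, hkj⟩ := TrivialSymbol.exists_third (by rwa [Fintype.card_fin]) i j
  refine eq_zero_of_cyclic (r := r) (Y := fun p q =>
    f ⁅orthoTrans (τ ^ (p + 1)) (𝐞 i) (𝐞 j), orthoTrans (τ ^ (q + 1)) (𝐞 j) (𝐞 i)⁆) ?_ ?_ hr
  · intro p q hpq
    rw [h.char_opposite_antisymm hn hf hkill hpq hij,
      h.char_opposite_eq_right hn hf hkill (by omega) hij.symm hkj.symm hki.symm,
      h.char_opposite_eq_left hn hf hkill (by omega) hkj.symm hij.symm hki,
      h.char_opposite_eq_right hn hf hkill (by omega) hki.symm hij hkj]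
  · intro p q s hpqs
    have key : ∀ {i j k : Fin n} (_ : i ≠ j) (_ : i ≠ k) (_ : j ≠ k) (p q s : ℕ),
        p + q + s + 2 = r →
        f ⁅⁅(orthoTrans (τ ^ (p + 1)) (𝐞 i) (𝐞 j))⁻¹, orthoTrans (τ ^ (q + 1)) (𝐞 j) (𝐞 k)⁆,
          orthoTrans (τ ^ (s + 1)) (𝐞 k) (𝐞 i)⁆ =
        -f ⁅orthoTrans (τ ^ (p + q + 1 + 1)) (𝐞 i) (𝐞 k),
          orthoTrans (τ ^ (s + 1)) (𝐞 k) (𝐞 i)⁆ := by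
      intro i j k hij hik hjk p q s hpqs
      have dij := single_dotProduct_single hij
      have dik := single_dotProduct_single hik
      have djk := single_dotProduct_single hjk
      rw [← hf.map_commutator_inv_left (p := p + q + 1) (q := s) (by omega)
        (h.orthoTrans_pow_mem hn _ dik)
        (h.orthoTrans_pow_mem hn _ (single_dotProduct_single hik.symm)),
        ← orthoTrans_neg_coeff _ dij, orthoTrans_commutator_left _ _ dij djk dik,
        ← orthoTrans_neg_coeff _ dik]
      congr 3
      rw [single_dotProduct, Pi.single_eq_same]
      push_cast; ring
    have hw := hf.hallWitt (p := p) (q := q) (s := s) (by omega)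
      (h.orthoTrans_pow_mem hn p (single_dotProduct_single hij))
      (h.orthoTrans_pow_mem hn q (single_dotProduct_single hkj.symm))
      (h.orthoTrans_pow_mem hn s (single_dotProduct_single hki))
    rw [key hij hki.symm hkj.symm p q s hpqs, key hki hkj hij s p q (by omega),
      key hkj.symm hij.symm hki q s p (by omega),
      h.char_opposite_eq_right hn hf hkill (by omega) hki.symm hij hkj,
      h.char_opposite_eq_left hn hf hkill (by omega) hkj hki hij.symm,
      h.char_opposite_eq_right hn hf hkill (by omega) hij.symm hkj.symm hki.symm,
      h.char_opposite_eq_left hn hf hkill (by omega) hkj.symm hij.symm hki,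
      h.char_opposite_eq_right hn hf hkill (by omega) hki.symm hij hkj] at hw
    linarith

end

end IsExpansion

end GradedChar

/-! ### Characters as linear forms, and congruence subgroups as isolators. -/

section Isolator

open Matrix
open scoped commutatorElement

theorem IsGradedChar.commutator_left {G : Type*} [Group G] {K : Subgroup G} [K.Normal] {r : ℕ}
    {f : G → ℚ} (hf : IsGradedChar K r f) {p q : ℕ} (hr : r = p + q + 1) {z : G}
    (hz : z ∈ K.lowerCentralSeries p) : IsGradedChar K q (fun x => f ⁅z, x⁆) :=
  ⟨fun _ hx _ hy => hf.map_commutator_mul_right hr hz hx hy, fun _ hx => hf.map_eq_zero _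
    (Subgroup.commutator_mem_lowerCentralSeries hz hx (by omega))⟩

namespace IsExpansion

variable {n : ℕ} {R : Type} [CommRing R] {a : R →+* ℤ} {e : R →+* ℚ⟦X⟧} {τ : R}
  (h : IsExpansion a e τ)

include h

/-- A linear form on the leading coefficient matrix is a character. -/
theorem isGradedChar_sum (r : ℕ) (t : Fin n → Fin n → ℚ) :
    IsGradedChar (slKer n a) r (fun x => ∑ i, ∑ j,
      t i j * coeffMatrix (r + 1) (Matrix.SpecialLinearGroup.map e x) i j) := by
  refine ⟨fun x hx y hy => ?_, fun x hx => ?_⟩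
  · rw [map_mul, coeffMatrix_mul r.succ_ne_zero
      (seriesCongr_antitone (by omega) (h.map_mem_seriesCongr hx)) (h.map_mem_seriesCongr hy),
      ← Finset.sum_add_distrib]
    refine Finset.sum_congr rfl fun i _ => ?_
    rw [← Finset.sum_add_distrib]
    refine Finset.sum_congr rfl fun j _ => ?_
    rw [Matrix.add_apply, mul_add]
  · rw [((mem_seriesCongr_succ r.succ_ne_zero).1 (h.map_mem_seriesCongr hx)).2]
    simp

/-- Subtracting a linear form, a character vanishes on all transvections. -/
theorem exists_char_sub (hn : 3 ≤ n) {r : ℕ} {f : Matrix.SpecialLinearGroup (Fin n) R → ℚ}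
    (hf : IsGradedChar (slKer n a) r f) : ∃ t : Fin n → Fin n → ℚ,
      ∀ v u : Fin n → ℤ, v ⬝ᵥ u = 0 → f (orthoTrans (τ ^ (r + 1)) v u) =
        ∑ i, ∑ j, t i j * coeffMatrix (r + 1)
          (Matrix.SpecialLinearGroup.map e (orthoTrans (τ ^ (r + 1)) v u)) i j := by
  have hφ : IsOrthoBiadditive (fun v u : Fin n → ℤ => f (orthoTrans (τ ^ (r + 1)) v u)) := by
    constructor
    · intro v v' u h1 h2
      rw [orthoTrans_add_left _ h1 h2, hf.map_mul _ (h.orthoTrans_pow_mem hn r h1) _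
        (h.orthoTrans_pow_mem hn r h2)]
    · intro v u u' h1 h2
      rw [orthoTrans_add_right _ h1 h2, hf.map_mul _ (h.orthoTrans_pow_mem hn r h1) _
        (h.orthoTrans_pow_mem hn r h2)]
  obtain ⟨t, ht⟩ := hφ.exists_eq_sum (by rwa [Fintype.card_fin])
  refine ⟨t, fun v u hvu => (ht v u hvu).trans ?_⟩
  refine Finset.sum_congr rfl fun i _ => Finset.sum_congr rfl fun j _ => ?_
  rw [h.coeffMatrix_orthoTrans r.succ_ne_zero hvu, mul_comm]

/-- Induction on `r`; the base case is a check on the generators of `K`. In the step, consider `⁅y,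
z⁆` with `z` a generator: after conjugation and modulo the next term, `z` is an integral power of an
elementary matrix with coefficient `τ`. For such a matrix `z`, `y ↦ f ⁅y, z⁆` is a character of
lower degree, so by induction a linear form in the leading coefficients of `y`. Testing on
transvections shows this form to be a multiple of the trace, which vanishes. -/
theorem char_eq_zero_of_kill (hn : 3 ≤ n)
    (hE : ∀ Y : Matrix (Fin n) (Fin n) R, Y.det = 1 → Y ∈ elemMonoid R .univ) (r : ℕ)
    (f : Matrix.SpecialLinearGroup (Fin n) R → ℚ) (hf : IsGradedChar (slKer n a) r f)
    (hkill : ∀ v u : Fin n → ℤ, v ⬝ᵥ u = 0 → f (orthoTrans (τ ^ (r + 1)) v u) = 0)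
    {x : Matrix.SpecialLinearGroup (Fin n) R} (hx : x ∈ (slKer n a).lowerCentralSeries r) :
    f x = 0 := by
  have hcl := h.slKer_eq_closure hE
  induction r generalizing f x with
  | zero =>
    refine hf.eq_zero_of_closure hcl ?_ hx
    rintro _ ⟨γ, i, j, g, hij, rfl⟩
    obtain ⟨h1, h2⟩ := orthoTrans_conj γ (τ * g) (single_dotProduct_single hij)
    rw [h2]
    have := h.char_orthoTrans hn hf hkill h1 g
    rwa [zero_add, pow_one] at this
  | succ p ih =>
    -- Stated for every `f`, since it is applied below to a conjugate of the given character.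
    have basic : ∀ f : Matrix.SpecialLinearGroup (Fin n) R → ℚ,
        IsGradedChar (slKer n a) (p + 1) f →
        (∀ v u : Fin n → ℤ, v ⬝ᵥ u = 0 → f (orthoTrans (τ ^ (p + 1 + 1)) v u) = 0) →
        ∀ i j : Fin n, i ≠ j → ∀ y ∈ (slKer n a).lowerCentralSeries p,
          f ⁅y, orthoTrans (τ ^ (0 + 1)) (Pi.single i 1) (Pi.single j 1)⁆ = 0 := by
      intro f hf hkill i j hij y hy
      have dij := single_dotProduct_single hij
      have hg := hf.commutator_right (p := p) (q := 0) (by omega) (h.orthoTrans_pow_mem hn 0 dij)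
      obtain ⟨t, ht⟩ := h.exists_char_sub hn hg
      have hsub := ih _ (hg.sub (h.isGradedChar_sum p t))
        (fun v u hvu => by rw [ht v u hvu, sub_self]) hy
      rw [sub_eq_zero] at hsub
      have ht' : ∀ v u : Fin n → ℤ, v ⬝ᵥ u = 0 →
          f ⁅orthoTrans (τ ^ (p + 1)) v u, orthoTrans (τ ^ (0 + 1)) (Pi.single i 1)
            (Pi.single j 1)⁆ = ∑ k, ∑ l, t k l * (v k * u l) := by
        intro v u hvu
        rw [ht v u hvu]
        refine Finset.sum_congr rfl fun k _ => Finset.sum_congr rfl fun l _ => ?_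
        rw [h.coeffMatrix_orthoTrans p.succ_ne_zero hvu]
      have hsingle : ∀ k l : Fin n, ∑ x, ∑ y, t x y * (((Pi.single k 1 : Fin n → ℤ) x : ℚ) *
          ((Pi.single l 1 : Fin n → ℤ) y : ℚ)) = t k l := by
        intro k l
        rw [Finset.sum_eq_single k, Finset.sum_eq_single l]
        · simp
        · intro x _ hx; simp [hx]
        · simp
        · intro x _ hx; simp [hx]
        · simp
      -- An off-diagonal entry is the value on a commutator of elementary matrices; this is again a
      -- transvection, except for an opposite pair, where `char_opposite_eq_zero` applies.
      have hoff : ∀ k l : Fin n, k ≠ l → t k l = 0 := by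
        intro k l hkl
        have dkl := single_dotProduct_single hkl
        rw [← hsingle k l, ← ht' _ _ dkl]
        by_cases hki : i = l
        · by_cases hlj : k = j
          · subst hki hlj
            exact h.char_opposite_eq_zero hn hf hkill (by omega) hkl
          · exact h.char_commutator_left hn hf hkill (by omega) dkl dij
              (single_dotProduct_single hlj)
        · exact h.char_commutator_right hn hf hkill (by omega) dkl dij
            (single_dotProduct_single hki)
      -- The pair `(𝐞 k - 𝐞 l, 𝐞 k + 𝐞 l)` compares two diagonal entries. The commutator formula
      -- needs `i` or `j` outside `{k, l}`; an index different from `i` and `j` then links all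
      -- entries.
      have hdiag' : ∀ k l : Fin n, k ≠ l → (i ≠ k ∧ i ≠ l ∨ j ≠ k ∧ j ≠ l) → t k k = t l l := by
        intro k l hkl hcase
        have dkl := single_dotProduct_single hkl
        have dlk := single_dotProduct_single hkl.symm
        have d : (Pi.single k 1 + -Pi.single l 1 : Fin n → ℤ) ⬝ᵥ (Pi.single k 1 + Pi.single l 1)
            = 0 := by
          rw [add_dotProduct, dotProduct_add, dotProduct_add, neg_dotProduct, neg_dotProduct, dkl,
            dlk, single_dotProduct, single_dotProduct, Pi.single_eq_same, Pi.single_eq_same]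
          norm_num
        have hval : f ⁅orthoTrans (τ ^ (p + 1)) (Pi.single k 1 + -Pi.single l 1 : Fin n → ℤ)
            (Pi.single k 1 + Pi.single l 1), orthoTrans (τ ^ (0 + 1)) (Pi.single i 1)
            (Pi.single j 1)⁆ = 0 := by
          rcases hcase with ⟨h1, h2⟩ | ⟨h1, h2⟩
          · refine h.char_commutator_right hn hf hkill (by omega) d dij ?_
            rw [dotProduct_add, single_dotProduct_single h1, single_dotProduct_single h2, add_zero]
          · refine h.char_commutator_left hn hf hkill (by omega) d dij ?_
            rw [add_dotProduct, neg_dotProduct, single_dotProduct_single h1.symm,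
              single_dotProduct_single h2.symm, neg_zero, add_zero]
        rw [ht' _ _ d] at hval
        have hexp : ∑ x, ∑ y, t x y *
            (((Pi.single k 1 + -Pi.single l 1 : Fin n → ℤ) x : ℚ) *
              ((Pi.single k 1 + Pi.single l 1 : Fin n → ℤ) y : ℚ)) =
            t k k + t k l - t l k - t l l := by
          rw [← hsingle k k, ← hsingle k l, ← hsingle l k, ← hsingle l l]
          simp only [← Finset.sum_add_distrib, ← Finset.sum_sub_distrib]
          refine Finset.sum_congr rfl fun x _ => Finset.sum_congr rfl fun y _ => ?_
          simp only [Pi.add_apply, Pi.neg_apply, Int.cast_add, Int.cast_neg]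
          ring
        rw [hexp, hoff k l hkl, hoff l k hkl.symm] at hval
        linarith
      have hdiag : ∀ k l : Fin n, t k k = t l l := by
        obtain ⟨m, hmi, hmj⟩ := TrivialSymbol.exists_third (by rwa [Fintype.card_fin]) i j
        have hm : ∀ k, t k k = t m m := by
          intro k
          by_cases hkm : k = m
          · rw [hkm]
          · refine hdiag' k m hkm ?_
            by_cases hik : i = k
            · exact Or.inr ⟨fun hjk => hij (hik.trans hjk.symm), hmj.symm⟩
            · exact Or.inl ⟨hik, hmi.symm⟩
        exact fun k l => (hm k).trans (hm l).symm
      rw [hsub]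
      have htr := trace_coeffMatrix p.succ_ne_zero (h.map_mem_seriesCongr hy)
      rw [trace] at htr
      have : ∀ k, ∑ l, t k l * coeffMatrix (p + 1) (Matrix.SpecialLinearGroup.map e y) k l =
          t i i * (coeffMatrix (p + 1) (Matrix.SpecialLinearGroup.map e y)).diag k := by
        intro k
        rw [Finset.sum_eq_single k, hdiag k i]
        · rfl
        · intro l _ hl; rw [hoff k l hl.symm, zero_mul]
        · simp
      rw [Finset.sum_congr rfl fun k _ => this k, ← Finset.mul_sum, htr, mul_zero]
    refine hf.eq_zero_of_commutator rfl hcl ?_ hx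
    rintro y hy _ ⟨γ, i, j, g, hij, rfl⟩
    have dij := single_dotProduct_single hij
    have hN : ((slKer n a).lowerCentralSeries p).Normal := inferInstance
    have hy' := hN.conj_mem y hy (slCast R γ)⁻¹
    rw [inv_inv] at hy'
    set y' := (slCast R γ)⁻¹ * y * slCast R γ with hy'def
    have hconj := hf.comp_conj (slCast R γ)
    have hkill' : ∀ v u : Fin n → ℤ, v ⬝ᵥ u = 0 →
        f (slCast R γ * orthoTrans (τ ^ (p + 1 + 1)) v u * (slCast R γ)⁻¹) = 0 :=
      fun v u hvu => h.char_comp_conj hn hf hkill γ hvu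
    have hrew : ⁅y, slCast R γ * orthoTrans (τ * g) (Pi.single i 1) (Pi.single j 1) *
        (slCast R γ)⁻¹⁆ = slCast R γ * ⁅y', orthoTrans (τ * g) (Pi.single i 1) (Pi.single j 1)⁆ *
          (slCast R γ)⁻¹ := by
      rw [conjugate_commutatorElement]
      congr 1
      rw [hy'def]; group
    rw [hrew]
    have hz := hconj.commutator_left (p := p) (q := 0) (by omega) hy'
    obtain ⟨w, hw⟩ := h.exists_eq g
    -- The `τ²` part lies in the second term of the series, so its commutator with `y'` is killed.
    have e1 : τ * g = τ ^ (0 + 1) * ((a g : ℤ) : R) + τ ^ (1 + 1) * w := by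
      conv_lhs => rw [hw]
      ring
    have h0 := basic _ hconj hkill' i j hij y' hy'
    have m1 := h.orthoTrans_mem_lowerCentralSeries hn 0 ((a g : ℤ) : R) dij
    have m2 := h.orthoTrans_mem_lowerCentralSeries hn 1 w dij
    have hpow : orthoTrans (τ ^ (0 + 1) * ((a g : ℤ) : R)) (Pi.single i 1) (Pi.single j 1) =
        orthoTrans (τ ^ (0 + 1)) (Pi.single i 1) (Pi.single j 1) ^ (a g) := by
      generalize a g = c
      induction c using Int.induction_on with
      | zero => rw [Int.cast_zero, mul_zero, orthoTrans_zero_coeff, zpow_zero]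
      | succ c ih =>
        rw [_root_.zpow_add_one, ← ih, ← orthoTrans_add_coeff _ _ dij]
        congr 1; push_cast; ring
      | pred c ih =>
        rw [_root_.zpow_sub_one, ← ih, ← orthoTrans_neg_coeff _ dij, ← orthoTrans_add_coeff _ _ dij]
        congr 1; push_cast; ring
    rw [e1, orthoTrans_add_coeff _ _ dij]
    have hadd := hz.map_mul _ m1 _ ((slKer n a).lowerCentralSeries_antitone (Nat.zero_le 1) m2)
    rw [hz.map_eq_zero _ m2, add_zero, hpow, hz.map_zpow (h.orthoTrans_pow_mem hn 0 dij), h0,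
      mul_zero] at hadd
    rw [hpow]
    exact hadd

/-- Every character is induced by a linear form on the leading coefficient matrix. -/
theorem char_eq_sum (hn : 3 ≤ n)
    (hE : ∀ Y : Matrix (Fin n) (Fin n) R, Y.det = 1 → Y ∈ elemMonoid R .univ) {r : ℕ}
    {f : Matrix.SpecialLinearGroup (Fin n) R → ℚ} (hf : IsGradedChar (slKer n a) r f) :
    ∃ t : Fin n → Fin n → ℚ, ∀ x ∈ (slKer n a).lowerCentralSeries r, f x =
      ∑ i, ∑ j, t i j * coeffMatrix (r + 1) (Matrix.SpecialLinearGroup.map e x) i j := by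
  obtain ⟨t, ht⟩ := h.exists_char_sub hn hf
  refine ⟨t, fun x hx => sub_eq_zero.1 ?_⟩
  exact h.char_eq_zero_of_kill hn hE r _ (hf.sub (h.isGradedChar_sum r t))
    (fun v u hvu => by rw [ht v u hvu, sub_self]) hx

/-- The congruence subgroups are the isolators of the terms of the lower central series. -/
theorem map_mem_seriesCongr_iff (hn : 3 ≤ n)
    (hE : ∀ Y : Matrix (Fin n) (Fin n) R, Y.det = 1 → Y ∈ elemMonoid R .univ) {r : ℕ}
    {x : Matrix.SpecialLinearGroup (Fin n) R} (hx : x ∈ slKer n a) :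
    Matrix.SpecialLinearGroup.map e x ∈ seriesCongr n (r + 1) ↔
      ∃ m : ℕ, 0 < m ∧ x ^ m ∈ (slKer n a).lowerCentralSeries r := by
  constructor
  · intro hxr
    induction r with
    | zero => exact ⟨1, one_pos, by rwa [pow_one]⟩
    | succ r ih =>
      obtain ⟨m, hm, hxm⟩ := ih (seriesCongr_antitone (by omega) hxr)
      -- The relevant leading coefficient of `x ^ m` vanishes, so all characters do, and a further
      -- power reaches the next term.
      obtain ⟨k, hk, hxk⟩ := IsGradedChar.exists_pow_mem hxm fun f hf => by
        obtain ⟨t, ht⟩ := h.char_eq_sum hn hE hf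
        have h2 : Matrix.SpecialLinearGroup.map e (x ^ m) ∈ seriesCongr n (r + 1 + 1) := by
          rw [map_pow]; exact pow_mem hxr m
        rw [ht _ hxm, ((mem_seriesCongr_succ r.succ_ne_zero).1 h2).2]
        simp
      exact ⟨m * k, Nat.mul_pos hm hk, by rwa [pow_mul]⟩
  · rintro ⟨m, hm, hxm⟩
    have hxm' := h.map_mem_seriesCongr hxm
    rw [map_pow] at hxm'
    -- Taking powers multiplies a leading coefficient by `m`, so it cannot raise the level.
    have key : ∀ s, s ≤ r → Matrix.SpecialLinearGroup.map e x ∈ seriesCongr n (s + 1) := by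
      intro s
      induction s with
      | zero => exact fun _ => h.map_mem_seriesCongr_one hx
      | succ s ih =>
        intro hs
        have hs' := ih (by omega)
        refine (mem_seriesCongr_succ s.succ_ne_zero).2 ⟨hs', ?_⟩
        have h1 := ((mem_seriesCongr_succ s.succ_ne_zero).1
          (seriesCongr_antitone (by omega : s + 1 + 1 ≤ r + 1) hxm')).2
        rw [coeffMatrix_pow s.succ_ne_zero hs'] at h1
        exact (smul_eq_zero.1 h1).resolve_left (by exact_mod_cast hm.ne')
    exact key r le_rfl

end IsExpansion

end Isolator

/-! ### Functions on groups that are killed by iterated differences -/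

section KilledByDifferences

open scoped commutatorElement

variable {G : Type*} [Group G] {N M : ℕ} {f h : G → ℚ}

theorem killedByDifferences_zero (N : ℕ) : KilledByDifferences N (0 : G → ℚ) := by
  induction N with
  | zero => rfl
  | succ N ih =>
    intro g
    simp only [Pi.zero_apply, sub_self]
    exact ih

namespace KilledByDifferences

theorem add (hf : KilledByDifferences N f) (hh : KilledByDifferences N h) :
    KilledByDifferences N (f + h) := by
  induction N generalizing f h with
  | zero => rw [KilledByDifferences] at *; rw [hf, hh, add_zero]
  | succ N ih =>
    intro g
    have := ih (hf g) (hh g)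
    convert this using 1
    ext x; simp only [Pi.add_apply]; ring

theorem const_smul (hf : KilledByDifferences N f) (c : ℚ) : KilledByDifferences N (c • f) := by
  induction N generalizing f with
  | zero => rw [KilledByDifferences] at *; rw [hf, smul_zero]
  | succ N ih =>
    intro g
    have := ih (hf g)
    convert this using 1
    ext x; simp only [Pi.smul_apply, smul_eq_mul]; ring

theorem sub (hf : KilledByDifferences N f) (hh : KilledByDifferences N h) :
    KilledByDifferences N (f - h) := by
  have := hf.add (hh.const_smul (-1))
  rwa [neg_one_smul, ← sub_eq_add_neg] at this

theorem succ (hf : KilledByDifferences N f) : KilledByDifferences (N + 1) f := by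
  induction N generalizing f with
  | zero =>
    rw [KilledByDifferences] at hf
    rw [hf]; exact killedByDifferences_zero 1
  | succ N ih => exact fun g => ih (hf g)

theorem mono (hNM : N ≤ M) (hf : KilledByDifferences N f) : KilledByDifferences M f := by
  induction hNM with
  | refl => exact hf
  | step _ ih => exact ih.succ

theorem sum {κ : Type*} (s : Finset κ) {F : κ → G → ℚ}
    (hF : ∀ i ∈ s, KilledByDifferences N (F i)) : KilledByDifferences N (∑ i ∈ s, F i) := by
  classical
  induction s using Finset.induction_on with
  | empty => exact killedByDifferences_zero N
  | insert i s hi ih =>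
    rw [Finset.sum_insert hi]
    exact (hF i (by simp)).add (ih fun j hj => hF j (by simp [hj]))

theorem mul (hf : KilledByDifferences N f) (hh : KilledByDifferences M h) :
    KilledByDifferences (N + M) (f * h) := by
  obtain ⟨k, hk⟩ : ∃ k, k = N + M := ⟨_, rfl⟩
  induction k generalizing N M f h with
  | zero =>
    obtain ⟨rfl, rfl⟩ : N = 0 ∧ M = 0 := by omega
    rw [KilledByDifferences] at *; rw [hf, zero_mul]
  | succ k ih =>
    rcases N with _ | N
    · rw [KilledByDifferences] at hf
      rw [hf, zero_mul]; exact killedByDifferences_zero _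
    rcases M with _ | M
    · rw [KilledByDifferences] at hh
      rw [hh, mul_zero]; exact killedByDifferences_zero _
    intro g
    have h1 := ih (hf g) hh (by omega)
    have h2 := ih hf (hh g) (by omega)
    have h3 := ih (hf g) (hh g).succ (by omega)
    have := ((h1.mono (by omega : N + (M + 1) ≤ N + 1 + M)).add h2).add
      (h3.mono (by omega : N + (M + 1) ≤ N + 1 + M))
    change KilledByDifferences (N + 1 + M) _
    convert this using 1
    ext x; simp only [Pi.add_apply, Pi.mul_apply]; ring

theorem translate (hf : KilledByDifferences N f) (g : G) :
    KilledByDifferences N (fun x => f (x * g)) := by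
  rcases N with _ | N
  · rw [KilledByDifferences] at *; rw [hf]; rfl
  · have := hf.add (hf g).succ
    convert this using 1
    ext x; simp

theorem comp {H : Type*} [Group H] (hf : KilledByDifferences N f) (φ : H →* G) :
    KilledByDifferences N (f ∘ φ) := by
  induction N generalizing f with
  | zero => rw [KilledByDifferences] at *; rw [hf]; rfl
  | succ N ih =>
    intro g
    have := ih (hf (φ g))
    convert this using 1
    ext x; simp

theorem const (c : ℚ) : KilledByDifferences 1 (fun _ : G => c) := by
  intro g
  simp only [sub_self]
  rfl

/-- Invariance under a power of `w` implies invariance under `w`. -/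
theorem invariant_of_pow (hf : KilledByDifferences N f) {w : G} {m : ℕ} (hm : 0 < m)
    (hw : ∀ x, f (x * w ^ m) = f x) (x : G) : f (x * w) = f x := by
  induction N generalizing f x with
  | zero => rw [KilledByDifferences] at hf; rw [hf]; rfl
  | succ N ih =>
    -- The difference of `f` along `w` is again invariant under `w ^ m`, hence under `w` by
    -- induction. So `f` is affine along powers of `w`, and invariance under `w ^ m` makes the slope
    -- zero.
    have hinv : ∀ x, f (x * w * w) - f (x * w) = f (x * w) - f x := fun x => ih (hf w) (fun x => by
      rw [mul_assoc, ← pow_succ, pow_succ', ← mul_assoc, hw, hw]) x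
    have hj : ∀ j : ℕ, f (x * w ^ j) = f x + j * (f (x * w) - f x) ∧
        f (x * w ^ j * w) - f (x * w ^ j) = f (x * w) - f x := by
      intro j
      induction j with
      | zero => simp
      | succ j ihj =>
        rw [pow_succ, ← mul_assoc]
        refine ⟨?_, (hinv _).trans ihj.2⟩
        have := ihj.2
        push_cast
        linarith [ihj.1]
    have h1 := (hj m).1
    rw [hw] at h1
    have h2 : (m : ℚ) * (f (x * w) - f x) = 0 := by linarith
    exact sub_eq_zero.1 ((mul_eq_zero.1 h2).resolve_left (by exact_mod_cast hm.ne'))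

/-- Differences along the lower central series lower the degree. -/
theorem diff_lowerCentral {r : ℕ} {g : G} (hg : g ∈ lowerCentral G r)
    (hf : KilledByDifferences N f) :
    KilledByDifferences (N - (r + 1)) (fun x => f (x * g) - f x) := by
  induction r generalizing g N f with
  | zero =>
    rcases N with _ | N
    · rw [KilledByDifferences] at hf
      rw [hf]
      simp only [Pi.zero_apply, sub_self]
      exact killedByDifferences_zero _
    · exact hf g
  | succ r ih =>
    rw [lowerCentral, Subgroup.lowerCentralSeries_succ, Subgroup.commutator_def] at hg
    induction hg using Subgroup.closure_induction generalizing f with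
    | mem g hg =>
      obtain ⟨a, ha, b, -, rfl⟩ := hg
      -- For `F` this translate of `f`, the difference along `⁅a, b⁆` is `(ab - ba) F = ((a - 1)(b -
      -- 1) - (b - 1)(a - 1)) F`.
      have h1 := hf.translate (a⁻¹ * b⁻¹)
      have hb : ∀ {N : ℕ} {f : G → ℚ}, KilledByDifferences N f →
          KilledByDifferences (N - 1) (fun x => f (x * b) - f x) := by
        intro N f hf
        rcases N with _ | N
        · rw [KilledByDifferences] at hf
          rw [hf]
          simp only [Pi.zero_apply, sub_self]
          exact killedByDifferences_zero _
        · exact hf b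
      have h2 := ih ha (hb h1)
      have h3 := hb (ih ha h1)
      have := (h2.mono (by omega : _ ≤ N - (r + 1 + 1))).sub (h3.mono (by omega))
      convert this using 1
      ext x
      simp only [Pi.sub_apply, commutatorElement_def, mul_assoc]
      rw [show b * (a * (a⁻¹ * b⁻¹)) = 1 by group, mul_one]
      ring
    | one =>
      simp only [mul_one, sub_self]
      exact killedByDifferences_zero _
    | mul a b _ _ ha hb =>
      have := (ha (hf.translate b)).add (hb hf)
      convert this using 1
      ext x; simp only [Pi.add_apply, mul_assoc]; ring
    | inv a _ ha =>
      have := (ha (hf.translate a⁻¹)).const_smul (-1)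
      convert this using 1
      ext x; simp

theorem invariant_of_mem_lowerCentral {g : G} (hf : KilledByDifferences N f)
    (hg : g ∈ lowerCentral G N) (x : G) : f (x * g) = f x := by
  have := hf.diff_lowerCentral hg
  rw [show N - (N + 1) = 0 by omega, KilledByDifferences] at this
  exact sub_eq_zero.1 (congrFun this x)

theorem iterate_eq_zero (hf : KilledByDifferences N f) (g : G) :
    (fun (F : G → ℚ) x => F (x * g) - F x)^[N] f = 0 := by
  induction N generalizing f with
  | zero => exact hf
  | succ N ih => rw [Function.iterate_succ_apply]; exact ih (hf g)

theorem iterate (hf : KilledByDifferences N f) (g : G) (m : ℕ) :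
    KilledByDifferences N ((fun (F : G → ℚ) x => F (x * g) - F x)^[m] f) := by
  induction m generalizing f with
  | zero => exact hf
  | succ m ih =>
    rw [Function.iterate_succ_apply]
    exact ih ((hf.translate g).sub hf)

end KilledByDifferences

end KilledByDifferences

/-! ### Roots and approximation in the group of power series matrices -/

section Roots

open Matrix PowerSeries
open scoped commutatorElement

/-- A group of matrices containing the multiples of `v uᵀ` for orthogonal pairs contains all
matrices of trace zero. -/
theorem mem_of_trace_eq_zero {ι : Type*} [Fintype ι] [DecidableEq ι] {C : Set ℚ}
    {S : AddSubgroup (Matrix ι ι ℚ)}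
    (hS : ∀ c ∈ C, ∀ v u : ι → ℤ, v ⬝ᵥ u = 0 → c • rankOne ℚ v u ∈ S)
    {A : Matrix ι ι ℚ} (hA : ∀ i j, A i j ∈ C) (htr : A.trace = 0) : A ∈ S := by
  rcases isEmpty_or_nonempty ι with hι | ⟨⟨o⟩⟩
  · rw [show A = 0 from Subsingleton.elim _ _]; exact zero_mem S
  have hsingle : ∀ i j : ι, rankOne ℚ (Pi.single i 1) (Pi.single j 1) = Matrix.single i j 1 := by
    intro i j
    ext k l
    rw [rankOne_apply, Matrix.single_apply, Pi.single_apply, Pi.single_apply]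
    simp only [eq_comm (a := k), eq_comm (a := l)]
    by_cases hk : i = k <;> by_cases hl : j = l <;> simp [hk, hl]
  have hoff : ∀ i j, i ≠ j → ∀ c ∈ C, c • Matrix.single i j (1 : ℚ) ∈ S := by
    intro i j hij c hc
    rw [← hsingle]
    exact hS c hc _ _ (single_dotProduct_single hij)
  have hdiag : ∀ i, ∀ c ∈ C, c • (Matrix.single i i (1 : ℚ) - Matrix.single o o 1) ∈ S := by
    intro i c hc
    by_cases hio : i = o
    · rw [hio, sub_self, smul_zero]; exact zero_mem S
    have d : (Pi.single i 1 + -Pi.single o 1 : ι → ℤ) ⬝ᵥ (Pi.single i 1 + Pi.single o 1) = 0 := by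
      rw [add_dotProduct, dotProduct_add, dotProduct_add, neg_dotProduct, neg_dotProduct,
        single_dotProduct_single hio, single_dotProduct_single (Ne.symm hio), single_dotProduct,
        single_dotProduct, Pi.single_eq_same, Pi.single_eq_same]
      norm_num
    have h1 := hS c hc _ _ d
    have hneg : rankOne ℚ (-Pi.single o 1 : ι → ℤ) = fun u => -rankOne ℚ (Pi.single o 1) u := by
      ext u i j; simp [rankOne_apply]
    rw [rankOne_add_left, rankOne_add_right, hneg] at h1
    simp only [rankOne_add_right, hsingle] at h1
    have h2 := sub_mem (add_mem h1 (hoff o i (Ne.symm hio) c hc)) (hoff i o hio c hc)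
    convert h2 using 1
    module
  have hdecomp : A = ∑ i, ∑ j, (if i = j then A i i • (Matrix.single i i (1 : ℚ) -
      Matrix.single o o 1) else A i j • Matrix.single i j 1) := by
    have h1 : ∀ i, ∑ j, (if i = j then A i i • (Matrix.single i i (1 : ℚ) -
        Matrix.single o o 1) else A i j • Matrix.single i j 1) =
        ∑ j, A i j • Matrix.single i j 1 - A i i • Matrix.single o o 1 := by
      intro i
      rw [eq_sub_iff_add_eq]
      have : A i i • Matrix.single o o (1 : ℚ) = ∑ j, if i = j then A i i • Matrix.single o o 1
          else (0 : Matrix ι ι ℚ) := by simp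
      rw [this, ← Finset.sum_add_distrib]
      refine Finset.sum_congr rfl fun j _ => ?_
      by_cases hij : i = j
      · subst hij; simp [smul_sub]
      · simp [hij]
    rw [Finset.sum_congr rfl fun i _ => h1 i, Finset.sum_sub_distrib, ← Finset.sum_smul]
    have h2 : ∑ i, A i i = 0 := htr
    rw [h2, zero_smul, sub_zero]
    conv_lhs => rw [matrix_eq_sum_single A]
    simp
  rw [hdecomp]
  refine sum_mem fun i _ => sum_mem fun j _ => ?_
  split_ifs with hij
  · exact hdiag i _ (hA i i)
  · exact hoff i j hij _ (hA i j)

variable {n : ℕ}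

local notation "SL" => Matrix.SpecialLinearGroup (Fin n) ℚ⟦X⟧

/-- The leading coefficients of the elements of a subgroup. -/
noncomputable def leadingCoeffs (H : Subgroup SL) {r : ℕ} (hr : r ≠ 0)
    (hH : H ≤ seriesCongr n r) : AddSubgroup (Matrix (Fin n) (Fin n) ℚ) where
  carrier := {A | ∃ x ∈ H, coeffMatrix r x = A}
  zero_mem' := ⟨1, one_mem _, coeffMatrix_one hr⟩
  add_mem' := by
    rintro _ _ ⟨x, hx, rfl⟩ ⟨y, hy, rfl⟩
    exact ⟨x * y, mul_mem hx hy,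
      coeffMatrix_mul hr (seriesCongr_antitone (by omega) (hH hx)) (hH hy)⟩
  neg_mem' := by
    rintro _ ⟨x, hx, rfl⟩
    exact ⟨x⁻¹, inv_mem hx, coeffMatrix_inv hr (hH hx)⟩

/-- Every rational matrix of trace zero is a leading coefficient. -/
theorem exists_coeffMatrix_eq {r : ℕ} (hr : r ≠ 0) {A : Matrix (Fin n) (Fin n) ℚ}
    (hA : A.trace = 0) : ∃ x ∈ seriesCongr n r, coeffMatrix r x = A := by
  refine mem_of_trace_eq_zero (S := leadingCoeffs (seriesCongr n r) hr le_rfl) (C := Set.univ)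
    (fun c _ v u hvu => ?_) (fun _ _ => Set.mem_univ _) hA
  have h1 : (orthoTrans (X ^ r * C c : ℚ⟦X⟧) v u : Matrix (Fin n) (Fin n) ℚ⟦X⟧) =
      1 + (X : ℚ⟦X⟧) ^ r • ((C c : ℚ⟦X⟧) • rankOne ℚ⟦X⟧ v u) := by
    rw [coe_orthoTrans _ hvu, smul_smul]
  refine ⟨orthoTrans (X ^ r * C c) v u, mem_seriesCongr_iff_exists.2 ⟨_, h1⟩, ?_⟩
  ext i j
  rw [coeffMatrix_of_eq hr h1]
  simp [rankOne_apply]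

/-- Modulo the next level, elements of level `s` are central. -/
theorem mul_pow_congr {s : ℕ} {y w : SL} (hy : y ∈ seriesCongr n 1) (hw : w ∈ seriesCongr n s)
    (m : ℕ) : (y ^ m * w ^ m)⁻¹ * (y * w) ^ m ∈ seriesCongr n (s + 1) := by
  rw [← QuotientGroup.eq]
  let q := QuotientGroup.mk' (seriesCongr n (s + 1))
  change q (y ^ m * w ^ m) = q ((y * w) ^ m)
  have hc : Commute (q y) (q w) := by
    rw [← commutatorElement_eq_one_iff_commute, ← map_commutatorElement]
    refine (QuotientGroup.eq_one_iff _).2 ?_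
    rw [add_comm]
    exact seriesCongr_commutator_mem hy hw
  rw [map_mul, map_pow, map_pow, map_pow, map_mul, hc.mul_pow]

/-- Level by level: the leading coefficient of `y⁻¹ * x` is multiplied by `m` on passing to powers,
and this is injective over `ℚ`. -/
theorem congr_of_pow_congr {x y : SL} (hx : x ∈ seriesCongr n 1) (hy : y ∈ seriesCongr n 1)
    {m : ℕ} (hm : m ≠ 0) {N : ℕ} (h : (y ^ m)⁻¹ * x ^ m ∈ seriesCongr n N) :
    y⁻¹ * x ∈ seriesCongr n N := by
  have key : ∀ s, s + 1 ≤ N → y⁻¹ * x ∈ seriesCongr n (s + 1) := by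
    intro s
    induction s with
    | zero => exact fun _ => mul_mem (inv_mem hy) hx
    | succ s ih =>
      intro hs
      have hw := ih (by omega)
      have h1 := mul_pow_congr hy hw m
      rw [mul_inv_cancel_left] at h1
      have h2 : (y⁻¹ * x) ^ m ∈ seriesCongr n (s + 1 + 1) := by
        have := mul_mem (seriesCongr_antitone hs h) (inv_mem h1)
        rwa [show (y ^ m)⁻¹ * x ^ m * ((y ^ m * (y⁻¹ * x) ^ m)⁻¹ * x ^ m)⁻¹ = (y⁻¹ * x) ^ m by
          group] at this
      have h3 := ((mem_seriesCongr_succ s.succ_ne_zero).1 h2).2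
      rw [coeffMatrix_pow s.succ_ne_zero hw] at h3
      exact (mem_seriesCongr_succ s.succ_ne_zero).2
        ⟨hw, (smul_eq_zero.1 h3).resolve_left (by exact_mod_cast hm)⟩
  rcases N with _ | N
  · rw [seriesCongr_zero]; trivial
  · exact key N le_rfl

/-- The error of an approximate root is corrected by an element with leading coefficient `1 / m`
times that of the error, which exists because the trace is zero. -/
theorem exists_root_congr {y : SL} (hy : y ∈ seriesCongr n 1) {m : ℕ} (hm : m ≠ 0) (N : ℕ) :
    ∃ z ∈ seriesCongr n 1, (z ^ m)⁻¹ * y ∈ seriesCongr n (N + 1) := by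
  induction N with
  | zero => exact ⟨1, one_mem _, by simpa using hy⟩
  | succ N ih =>
    obtain ⟨z, hz, hzy⟩ := ih
    obtain ⟨w, hw, hwA⟩ := exists_coeffMatrix_eq N.succ_ne_zero
      (A := (m : ℚ)⁻¹ • coeffMatrix (N + 1) ((z ^ m)⁻¹ * y)) (by
        rw [trace_smul, trace_coeffMatrix N.succ_ne_zero hzy, smul_zero])
    have hw1 : w ∈ seriesCongr n 1 := seriesCongr_antitone (by omega) hw
    refine ⟨z * w, mul_mem hz hw1, ?_⟩
    have h1 := mul_pow_congr hz hw m
    have h2 : (w ^ m)⁻¹ * ((z ^ m)⁻¹ * y) ∈ seriesCongr n (N + 1 + 1) := by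
      refine (mem_seriesCongr_succ N.succ_ne_zero).2 ⟨mul_mem (inv_mem (pow_mem hw m)) hzy, ?_⟩
      rw [coeffMatrix_mul N.succ_ne_zero (inv_mem (pow_mem hw1 m)) hzy,
        coeffMatrix_inv N.succ_ne_zero (pow_mem hw m), coeffMatrix_pow N.succ_ne_zero hw, hwA,
        smul_smul, mul_inv_cancel₀ (by exact_mod_cast hm), one_smul, neg_add_cancel]
    have := mul_mem (inv_mem h1) h2
    rwa [show ((z ^ m * w ^ m)⁻¹ * (z * w) ^ m)⁻¹ * ((w ^ m)⁻¹ * ((z ^ m)⁻¹ * y)) =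
      ((z * w) ^ m)⁻¹ * y by group] at this

namespace IsExpansion

variable {R : Type} [CommRing R] {a : R →+* ℤ} {e : R →+* ℚ⟦X⟧} {τ : R}
  (h : IsExpansion a e τ)

include h

/-- Every integral matrix of trace zero is the leading coefficient of an element of the
congruence kernel over `R`. -/
theorem exists_coeffMatrix_eq (hn : 3 ≤ n) {r : ℕ} (hr : r ≠ 0)
    {A : Matrix (Fin n) (Fin n) ℚ} (hA : A.trace = 0) (hAint : ∀ i j, ∃ c : ℤ, A i j = c) :
    ∃ x ∈ slKer n a, Matrix.SpecialLinearGroup.map e x ∈ seriesCongr n r ∧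
      coeffMatrix r (Matrix.SpecialLinearGroup.map e x) = A := by
  obtain ⟨r, rfl⟩ := Nat.exists_eq_succ_of_ne_zero hr
  have hle : ((slKer n a).lowerCentralSeries r).map (Matrix.SpecialLinearGroup.map e) ≤
      seriesCongr n (r + 1) := by
    rintro _ ⟨x, hx, rfl⟩
    exact h.map_mem_seriesCongr hx
  have := mem_of_trace_eq_zero (S := leadingCoeffs _ r.succ_ne_zero hle)
    (C := Set.range (Int.cast : ℤ → ℚ)) (A := A) ?_
    (fun i j => by obtain ⟨c, hc⟩ := hAint i j; exact ⟨c, hc.symm⟩) hA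
  · obtain ⟨_, ⟨x, hx, rfl⟩, hxA⟩ := this
    exact ⟨x, (slKer n a).lowerCentralSeries_antitone (Nat.zero_le r) hx,
      h.map_mem_seriesCongr hx, hxA⟩
  · rintro _ ⟨c, rfl⟩ v u hvu
    have hcvu : (c • v) ⬝ᵥ u = 0 := by rw [smul_dotProduct, hvu, smul_zero]
    refine ⟨_, ⟨_, h.orthoTrans_pow_mem hn r hcvu, rfl⟩, ?_⟩
    ext i j
    rw [h.coeffMatrix_orthoTrans r.succ_ne_zero hcvu, Matrix.smul_apply, rankOne_apply,
      Pi.smul_apply, smul_eq_mul, smul_eq_mul, Int.cast_mul, mul_assoc]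

/-- Elements of the completion have powers that are approximated by elements of `K`. -/
theorem exists_pow_congr (hn : 3 ≤ n) {y : SL} (hy : y ∈ seriesCongr n 1) (N : ℕ) :
    ∃ m : ℕ, 0 < m ∧ ∃ k ∈ slKer n a,
      (Matrix.SpecialLinearGroup.map e k)⁻¹ * y ^ m ∈ seriesCongr n (N + 1) := by
  induction N with
  | zero => exact ⟨1, one_pos, 1, one_mem _, by simpa using hy⟩
  | succ N ih =>
    obtain ⟨m, hm, k, hk, hky⟩ := ih
    set w := (Matrix.SpecialLinearGroup.map e k)⁻¹ * y ^ m with hw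
    have hk1 := h.map_mem_seriesCongr_one hk
    -- A common denominator: `D` times the leading coefficient of the error is integral, hence
    -- attained in the congruence kernel, and the `D`-th power multiplies that coefficient by `D`.
    let D : ℕ := ∏ i, ∏ j, (coeffMatrix (N + 1) w i j).den
    have hD : 0 < D := Finset.prod_pos fun i _ => Finset.prod_pos fun j _ =>
      (coeffMatrix (N + 1) w i j).den_pos
    obtain ⟨k', hk', hk'N, hk'A⟩ := h.exists_coeffMatrix_eq hn N.succ_ne_zero
      (A := (D : ℚ) • coeffMatrix (N + 1) w)
      (by rw [trace_smul, trace_coeffMatrix N.succ_ne_zero hky, smul_zero]) (fun i j => by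
        have h1 : (coeffMatrix (N + 1) w i j).den ∣ D :=
          (Finset.dvd_prod_of_mem (fun j => (coeffMatrix (N + 1) w i j).den)
            (Finset.mem_univ j)).trans (Finset.dvd_prod_of_mem
              (fun i => ∏ j, (coeffMatrix (N + 1) w i j).den) (Finset.mem_univ i))
        obtain ⟨q, hq⟩ := h1
        refine ⟨q * (coeffMatrix (N + 1) w i j).num, ?_⟩
        rw [Matrix.smul_apply, smul_eq_mul, hq]
        push_cast
        rw [mul_comm ((coeffMatrix (N + 1) w i j).den : ℚ), mul_assoc, Rat.den_mul_eq_num])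
    refine ⟨m * D, Nat.mul_pos hm hD, k ^ D * k', mul_mem (pow_mem hk D) hk', ?_⟩
    have h1 := mul_pow_congr hk1 hky D
    rw [hw, mul_inv_cancel_left, ← hw, ← pow_mul] at h1
    have h2 : (Matrix.SpecialLinearGroup.map e k')⁻¹ * w ^ D ∈ seriesCongr n (N + 1 + 1) := by
      refine (mem_seriesCongr_succ N.succ_ne_zero).2
        ⟨mul_mem (inv_mem hk'N) (pow_mem hky D), ?_⟩
      rw [coeffMatrix_mul N.succ_ne_zero
        (inv_mem (seriesCongr_antitone (by omega) hk'N)) (pow_mem hky D),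
        coeffMatrix_inv N.succ_ne_zero hk'N, coeffMatrix_pow N.succ_ne_zero hky, hk'A,
        neg_add_cancel]
    have := mul_mem h2 h1
    rwa [show (Matrix.SpecialLinearGroup.map e k')⁻¹ * w ^ D *
      ((Matrix.SpecialLinearGroup.map e k ^ D * w ^ D)⁻¹ * y ^ (m * D)) =
      (Matrix.SpecialLinearGroup.map e (k ^ D * k'))⁻¹ * y ^ (m * D) by
        rw [map_mul, map_pow]; group] at this

end IsExpansion

end Roots

/-! ### The completion as an inverse limit -/

section Limit

open Matrix PowerSeries
open scoped commutatorElement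

theorem mem_lowerCentral_iff {G : Type*} [Group G] {K : Subgroup G} {r : ℕ} {x : K} :
    x ∈ lowerCentral K r ↔ (x : G) ∈ K.lowerCentralSeries r := by
  rw [← Subgroup.top_subtype_lowerCentralSeries]
  exact (Subgroup.mem_map_iff_mem K.subtype_injective).symm

theorem coe_mem_seriesCongr_one {n : ℕ} (x : seriesKer n) : x.1 ∈ seriesCongr n 1 := by
  rw [← seriesKer_eq]; exact x.2

/-- The congruence subgroup of level `r` as a subgroup of `seriesKer n`. -/
noncomputable abbrev seriesKerCongr (n r : ℕ) : Subgroup (seriesKer n) :=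
  (seriesCongr n r).subgroupOf (seriesKer n)

theorem lowerCentral_seriesKer_le (n r : ℕ) :
    lowerCentral (seriesKer n) r ≤ seriesKerCongr n (r + 1) := by
  induction r with
  | zero => exact fun x _ => coe_mem_seriesCongr_one x
  | succ r ih =>
    rw [lowerCentral, Subgroup.lowerCentralSeries_succ, Subgroup.commutator_le]
    exact fun x hx y _ => seriesCongr_commutator_mem (ih hx) (coe_mem_seriesCongr_one y)

/-- A compatible sequence of matrices modulo powers of `T` comes from a matrix of power series. -/
theorem exists_series_limit {n : ℕ} (x : ℕ → seriesKer n)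
    (hx : ∀ r, (x r)⁻¹ * x (r + 1) ∈ seriesKerCongr n (r + 1)) :
    ∃ y : seriesKer n, ∀ r, y⁻¹ * x r ∈ seriesKerCongr n (r + 1) := by
  have hstep : ∀ r m, m < r + 1 → coeffMatrix m (x r).1 = coeffMatrix m (x (r + 1)).1 :=
    fun r => inv_mul_mem_seriesCongr_iff.1 (hx r)
  have hstable : ∀ m r, m ≤ r → coeffMatrix m (x r).1 = coeffMatrix m (x m).1 := by
    intro m r hr
    induction r, hr using Nat.le_induction with
    | base => rfl
    | succ r hr ih => rw [← ih, hstep r m (by omega)]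
  let M : Matrix (Fin n) (Fin n) ℚ⟦X⟧ :=
    Matrix.of fun i j => PowerSeries.mk fun m => coeffMatrix m (x m).1 i j
  have hM : ∀ r i j, (X : ℚ⟦X⟧) ^ (r + 1) ∣ M i j - (x r).1 i j := by
    intro r i j
    rw [X_pow_dvd_iff]
    intro m hm
    rw [map_sub, sub_eq_zero]
    change coeff m (PowerSeries.mk fun m => coeffMatrix m (x m).1 i j) = coeffMatrix m (x r).1 i j
    rw [coeff_mk, hstable m r (by omega)]
  have hdet : M.det = 1 := by
    have key : ∀ r, (X : ℚ⟦X⟧) ^ (r + 1) ∣ M.det - 1 := by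
      intro r
      rw [← Ideal.mem_span_singleton, ← Ideal.Quotient.eq, ← (x r).1.2, RingHom.map_det,
        RingHom.map_det]
      congr 1
      ext i j
      exact Ideal.Quotient.eq.2 (Ideal.mem_span_singleton.2 (hM r i j))
    rw [← sub_eq_zero]
    ext m
    rw [X_pow_dvd_iff.1 (key m) m (by omega), map_zero]
  let y : Matrix.SpecialLinearGroup (Fin n) ℚ⟦X⟧ := ⟨M, hdet⟩
  have hy : ∀ r, y⁻¹ * (x r).1 ∈ seriesCongr n (r + 1) := by
    intro r
    rw [inv_mul_mem_seriesCongr_iff]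
    intro m hm
    ext i j
    have := X_pow_dvd_iff.1 (hM r i j) m hm
    rwa [map_sub, sub_eq_zero] at this
  have hyU : y ∈ seriesKer n := by
    rw [seriesKer_eq]
    have := mul_mem (coe_mem_seriesCongr_one (x 0)) (inv_mem (hy 0))
    rwa [_root_.mul_inv_rev, inv_inv, mul_inv_cancel_left] at this
  exact ⟨⟨y, hyU⟩, hy⟩

theorem seriesKer_quotient_nilpotent (n r : ℕ) :
    Group.IsNilpotent (seriesKer n ⧸ seriesKerCongr n (r + 1)) := by
  rw [Subgroup.nilpotent_iff_lowerCentralSeries]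
  refine ⟨r, ?_⟩
  have h1 := Subgroup.map_lowerCentralSeries (S := (⊤ : Subgroup (seriesKer n)))
    (QuotientGroup.mk' (seriesKerCongr n (r + 1))) r
  rw [Subgroup.map_top_of_surjective _ (QuotientGroup.mk'_surjective _)] at h1
  rw [← h1, Subgroup.map_eq_bot_iff, QuotientGroup.ker_mk']
  exact lowerCentral_seriesKer_le n r

theorem seriesKer_quotient_pow_bijective (n r : ℕ) {m : ℕ} (hm : m ≠ 0) :
    Function.Bijective (fun y : seriesKer n ⧸ seriesKerCongr n (r + 1) => y ^ m) := by
  constructor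
  · intro x y hxy
    induction x using QuotientGroup.induction_on with | H x => ?_
    induction y using QuotientGroup.induction_on with | H y => ?_
    change ((x ^ m : seriesKer n) : seriesKer n ⧸ seriesKerCongr n (r + 1)) =
      (y ^ m : seriesKer n) at hxy
    rw [QuotientGroup.eq] at hxy ⊢
    exact congr_of_pow_congr (coe_mem_seriesCongr_one y) (coe_mem_seriesCongr_one x) hm hxy
  · intro y
    induction y using QuotientGroup.induction_on with | H y => ?_
    obtain ⟨z, hz, hzy⟩ := exists_root_congr (coe_mem_seriesCongr_one y) hm r
    rw [← seriesKer_eq] at hz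
    refine ⟨QuotientGroup.mk ⟨z, hz⟩, ?_⟩
    change (((⟨z, hz⟩ : seriesKer n) ^ m : seriesKer n) : seriesKer n ⧸ seriesKerCongr n (r + 1))
      = (y : seriesKer n)
    rw [QuotientGroup.eq]
    exact hzy

namespace IsExpansion

variable {n : ℕ} {R : Type} [CommRing R] {a : R →+* ℤ} {e : R →+* ℚ⟦X⟧} {τ : R}
  (h : IsExpansion a e τ)

include h

theorem kerToSeriesKer_injective :
    Function.Injective (kerToSeriesKer n a e h.constantCoeff_eq) := by
  intro x y hxy
  apply Subtype.ext
  ext i j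
  have h1 := congrArg (fun z : seriesKer n => z.1 i j) hxy
  exact h.injective h1

/-- The congruence subgroups are the isolators of the terms of the lower central series. -/
theorem kerToSeriesKer_mem_iff (hn : 3 ≤ n)
    (hE : ∀ Y : Matrix (Fin n) (Fin n) R, Y.det = 1 → Y ∈ elemMonoid R .univ) {r : ℕ}
    (x : slKer n a) : kerToSeriesKer n a e h.constantCoeff_eq x ∈ seriesKerCongr n (r + 1) ↔
      ∃ m : ℕ, 0 < m ∧ x ^ m ∈ lowerCentral (slKer n a) r := by
  simp only [mem_lowerCentral_iff]
  exact h.map_mem_seriesCongr_iff hn hE x.2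

/-- The completion of `K / Γ^(r+1) K` is modelled by `𝒰` modulo level `r + 1`: the isolator property
identifies the kernel, `exists_pow_congr` gives the powers, and `T`-adic completeness gives the
limit. -/
theorem isMalcevLimit (hn : 3 ≤ n)
    (hE : ∀ Y : Matrix (Fin n) (Fin n) R, Y.det = 1 → Y ∈ elemMonoid R .univ) :
    IsMalcevLimit (kerToSeriesKer n a e h.constantCoeff_eq) := by
  set φ := kerToSeriesKer n a e h.constantCoeff_eq with hφ
  have hle : ∀ r, lowerCentral (slKer n a) r ≤ (seriesKerCongr n (r + 1)).comap φ :=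
    fun r x hx => (h.kerToSeriesKer_mem_iff hn hE x).2 ⟨1, one_pos, by rwa [pow_one]⟩
  have hle' : ∀ r, seriesKerCongr n (r + 1 + 1) ≤
      (seriesKerCongr n (r + 1)).comap (MonoidHom.id _) :=
    fun r x hx => seriesCongr_antitone (by omega : r + 1 ≤ r + 1 + 1) hx
  refine ⟨fun r => seriesKer n ⧸ seriesKerCongr n (r + 1), fun r => inferInstance,
    fun r => QuotientGroup.map _ _ φ (hle r), fun r => QuotientGroup.map _ _ (.id _) (hle' r),
    fun r => QuotientGroup.mk' _, fun r => ⟨seriesKer_quotient_nilpotent n r,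
      fun m hm => seriesKer_quotient_pow_bijective n r hm, fun g => ?_, fun y => ?_⟩,
    fun r g => rfl, fun r m => rfl, fun r g => rfl, fun y hy => ?_⟩
  · induction g using QuotientGroup.induction_on with | H g => ?_
    rw [QuotientGroup.map_mk, QuotientGroup.eq_one_iff, h.kerToSeriesKer_mem_iff hn hE,
      isOfFinOrder_iff_pow_eq_one]
    refine exists_congr fun m => and_congr_right fun _ => ?_
    rw [← QuotientGroup.mk_pow, QuotientGroup.eq_one_iff]
  · induction y using QuotientGroup.induction_on with | H y => ?_
    obtain ⟨m, hm, k, hk, hky⟩ := h.exists_pow_congr hn (coe_mem_seriesCongr_one y) r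
    refine ⟨m, hm.ne', QuotientGroup.mk ⟨k, hk⟩, ?_⟩
    rw [QuotientGroup.map_mk, ← QuotientGroup.mk_pow, QuotientGroup.eq]
    exact hky
  · choose x hx using fun r => QuotientGroup.mk_surjective (y r)
    have hx' : ∀ r, (x r)⁻¹ * x (r + 1) ∈ seriesKerCongr n (r + 1) := by
      intro r
      rw [← QuotientGroup.eq, hx, ← hy, ← hx]
      rfl
    obtain ⟨z, hz⟩ := exists_series_limit x hx'
    refine ⟨z, fun r => ?_, fun z' hz' => ?_⟩
    · rw [← hx r]
      exact QuotientGroup.eq.2 (hz r)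
    · apply Subtype.ext
      refine eq_of_forall_seriesCongr fun r => seriesCongr_antitone (Nat.le_succ r) ?_
      have h1 : (z' : seriesKer n ⧸ seriesKerCongr n (r + 1)) = z := by
        refine (hz' r).trans ?_
        rw [← hx r]
        exact (QuotientGroup.eq.2 (hz r)).symm
      have h2 := QuotientGroup.eq.1 h1
      exact h2

end IsExpansion

end Limit

/-! ### The group of power series matrices is prounipotent -/

section Prounipotent

open Matrix PowerSeries

variable {n : ℕ}

/-- The coordinate functions. -/
noncomputable def seriesCoord (i j : Fin n) (k : ℕ) (x : seriesKer n) : ℚ := coeff k (x.1 i j)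

theorem seriesCoord_mem (i j : Fin n) (k : ℕ) : seriesCoord i j k ∈ seriesKerFunctions n :=
  Algebra.subset_adjoin ⟨(i, j, k), rfl⟩

theorem seriesKerFunctions_induction {p : (seriesKer n → ℚ) → Prop}
    (hcoord : ∀ i j k, p (seriesCoord i j k)) (hconst : ∀ c : ℚ, p (fun _ => c))
    (hadd : ∀ f g, f ∈ seriesKerFunctions n → g ∈ seriesKerFunctions n → p f → p g → p (f + g))
    (hmul : ∀ f g, f ∈ seriesKerFunctions n → g ∈ seriesKerFunctions n → p f → p g → p (f * g))
    {f : seriesKer n → ℚ} (hf : f ∈ seriesKerFunctions n) : p f := by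
  induction hf using Algebra.adjoin_induction with
  | mem f hf => obtain ⟨⟨i, j, k⟩, rfl⟩ := hf; exact hcoord i j k
  | algebraMap c => exact hconst c
  | add f g hf hg h1 h2 => exact hadd f g hf hg h1 h2
  | mul f g hf hg h1 h2 => exact hmul f g hf hg h1 h2

theorem seriesCoord_zero (i j : Fin n) (x : seriesKer n) :
    seriesCoord i j 0 x = (1 : Matrix (Fin n) (Fin n) ℚ) i j := by
  have h1 := mem_slKer_iff.1 x.2 i j
  rw [map_sub, sub_eq_zero] at h1
  rw [seriesCoord, coeff_zero_eq_constantCoeff_apply, h1]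
  by_cases h : i = j
  · rw [h, one_apply_eq, one_apply_eq, map_one]
  · rw [one_apply_ne h, one_apply_ne h, map_zero]

theorem seriesCoord_mul (i j : Fin n) (k : ℕ) (x y : seriesKer n) :
    seriesCoord i j k (x * y) = ∑ l : Fin n, ∑ p ∈ Finset.HasAntidiagonal.antidiagonal k,
      seriesCoord i l p.1 x * seriesCoord l j p.2 y := by
  have h1 : (x * y).1 i j = ∑ l, x.1 i l * y.1 l j := by
    rw [Subgroup.coe_mul, Matrix.SpecialLinearGroup.coe_mul, mul_apply]
  rw [seriesCoord, h1, map_sum]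
  refine Finset.sum_congr rfl fun l _ => ?_
  rw [coeff_mul]
  rfl

theorem seriesKer_ext {x y : seriesKer n} (h : ∀ i j k, seriesCoord i j k x = seriesCoord i j k y) :
    x = y := by
  apply Subtype.ext
  ext i j k
  exact h i j k

/-- The functions with values in power series whose coefficients are regular. -/
noncomputable def regularSeries (n : ℕ) : Subring (seriesKer n → ℚ⟦X⟧) where
  carrier := {F | ∀ k, (fun x => coeff k (F x)) ∈ seriesKerFunctions n}
  zero_mem' k := by
    convert zero_mem (seriesKerFunctions n) using 1
    ext x; simp
  one_mem' k := by
    have := (seriesKerFunctions n).algebraMap_mem (coeff k (1 : ℚ⟦X⟧))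
    exact this
  add_mem' {F H} hF hH k := by
    convert add_mem (hF k) (hH k) using 1
    ext x; simp
  neg_mem' {F} hF k := by
    convert neg_mem (hF k) using 1
    ext x; simp
  mul_mem' {F H} hF hH k := by
    have : (fun x => coeff k ((F * H) x)) = ∑ p ∈ Finset.HasAntidiagonal.antidiagonal k,
        (fun x => coeff p.1 (F x)) * (fun x => coeff p.2 (H x)) := by
      ext x
      rw [Pi.mul_apply, coeff_mul, Finset.sum_apply]
      rfl
    rw [this]
    exact sum_mem fun p _ => mul_mem (hF p.1) (hH p.2)

/-- Evaluation at a point. -/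
noncomputable def regularSeriesEval (x : seriesKer n) : regularSeries n →+* ℚ⟦X⟧ :=
  (Pi.evalRingHom (fun _ => ℚ⟦X⟧) x).comp (regularSeries n).subtype

/-- The universal matrix. -/
noncomputable def genericMatrix (n : ℕ) : Matrix (Fin n) (Fin n) (regularSeries n) :=
  Matrix.of fun i j => ⟨fun x => x.1 i j, fun k => seriesCoord_mem i j k⟩

theorem genericMatrix_map (x : seriesKer n) :
    (regularSeriesEval x).mapMatrix (genericMatrix n) = x.1 := by
  ext i j
  rfl

theorem regularSeries_ext {F H : regularSeries n}
    (h : ∀ x, regularSeriesEval x F = regularSeriesEval x H) : F = H :=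
  Subtype.ext (funext h)

theorem genericMatrix_det : (genericMatrix n).det = 1 := by
  refine regularSeries_ext fun x => ?_
  rw [RingHom.map_det, genericMatrix_map, x.1.2, map_one]

/-- The action of a character on functions with values in power series. -/
noncomputable def charSeries (χ : seriesKerFunctions n →ₐ[ℚ] ℚ) : regularSeries n →+* ℚ⟦X⟧ where
  toFun F := PowerSeries.mk fun k => χ ⟨fun x => coeff k (F.1 x), F.2 k⟩
  map_one' := by
    ext k
    rw [coeff_mk]
    exact χ.commutes (coeff k (1 : ℚ⟦X⟧))
  map_zero' := by
    ext k
    rw [coeff_mk, map_zero, ← map_zero χ]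
    congr 1
  map_add' F H := by
    ext k
    rw [map_add, coeff_mk, coeff_mk, coeff_mk, ← map_add]
    congr 1
  map_mul' F H := by
    ext k
    rw [coeff_mul, coeff_mk]
    simp only [coeff_mk, ← map_mul, ← map_sum]
    congr 1
    apply Subtype.ext
    ext x
    rw [AddSubmonoidClass.coe_finsetSum, Finset.sum_apply]
    change coeff k (F.1 x * H.1 x) = _
    rw [coeff_mul]
    rfl

/-- Applying the character to the coefficients of the generic matrix gives the point; determinant
one survives because `charSeries` is a ring homomorphism. -/
theorem exists_point (χ : seriesKerFunctions n →ₐ[ℚ] ℚ) :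
    ∃! x : seriesKer n, ∀ f : seriesKerFunctions n, χ f = (f : seriesKer n → ℚ) x := by
  let M : Matrix (Fin n) (Fin n) ℚ⟦X⟧ := (charSeries χ).mapMatrix (genericMatrix n)
  have hdet : M.det = 1 := by rw [← RingHom.map_det, genericMatrix_det, map_one]
  have hcoeff : ∀ i j k, coeff k (M i j) = χ ⟨seriesCoord i j k, seriesCoord_mem i j k⟩ := by
    intro i j k
    exact coeff_mk k fun k => χ ⟨seriesCoord i j k, seriesCoord_mem i j k⟩
  let x : Matrix.SpecialLinearGroup (Fin n) ℚ⟦X⟧ := ⟨M, hdet⟩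
  have hx : x ∈ seriesKer n := by
    rw [mem_slKer_iff]
    intro i j
    rw [map_sub, sub_eq_zero]
    change constantCoeff (M i j) = _
    have h1 : (⟨seriesCoord i j 0, seriesCoord_mem i j 0⟩ : seriesKerFunctions n) =
        algebraMap ℚ _ ((1 : Matrix (Fin n) (Fin n) ℚ) i j) := by
      apply Subtype.ext
      ext y
      exact seriesCoord_zero i j y
    rw [← coeff_zero_eq_constantCoeff_apply, hcoeff, h1, AlgHom.commutes]
    by_cases h : i = j
    · rw [h, one_apply_eq, one_apply_eq, map_one]; rfl
    · rw [one_apply_ne h, one_apply_ne h, map_zero]; rfl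
  have main : ∀ f (hf : f ∈ seriesKerFunctions n), χ ⟨f, hf⟩ = f ⟨x, hx⟩ := by
    intro f hf
    suffices ∃ hf' : f ∈ seriesKerFunctions n, χ ⟨f, hf'⟩ = f ⟨x, hx⟩ from this.2
    refine seriesKerFunctions_induction
      (p := fun f => ∃ hf' : f ∈ seriesKerFunctions n, χ ⟨f, hf'⟩ = f ⟨x, hx⟩) ?_ ?_ ?_ ?_ hf
    · exact fun i j k => ⟨seriesCoord_mem i j k, (hcoeff i j k).symm⟩
    · exact fun c => ⟨(seriesKerFunctions n).algebraMap_mem c, χ.commutes c⟩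
    · rintro f g hf hg ⟨_, h1⟩ ⟨_, h2⟩
      refine ⟨add_mem hf hg, ?_⟩
      rw [Pi.add_apply, ← h1, ← h2, ← map_add]
      rfl
    · rintro f g hf hg ⟨_, h1⟩ ⟨_, h2⟩
      refine ⟨mul_mem hf hg, ?_⟩
      rw [Pi.mul_apply, ← h1, ← h2, ← map_mul]
      rfl
  refine ⟨⟨x, hx⟩, fun f => main f.1 f.2, fun y hy => seriesKer_ext fun i j k => ?_⟩
  rw [← main _ (seriesCoord_mem i j k)]
  exact (hy ⟨_, seriesCoord_mem i j k⟩).symm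

/-- As `g ≡ 1` modulo `T`, the difference of a coefficient along `g` involves only coefficients of
lower order; that of order zero is constant, whence `k + 1`. -/
theorem seriesCoord_killed (i j : Fin n) (k : ℕ) :
    KilledByDifferences (k + 1) (seriesCoord i j k) := by
  induction k using Nat.strong_induction_on generalizing i j with
  | _ k ih =>
    intro g
    have h1 : (fun x => seriesCoord i j k (x * g) - seriesCoord i j k x) =
        ∑ l : Fin n, ∑ p ∈ Finset.HasAntidiagonal.antidiagonal k,
          (seriesCoord l j p.2 g - coeff p.2 ((1 : Matrix (Fin n) (Fin n) ℚ⟦X⟧) l j)) •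
            seriesCoord i l p.1 := by
      ext x
      have h2 := seriesCoord_mul i j k x 1
      rw [mul_one] at h2
      rw [seriesCoord_mul, h2, ← Finset.sum_sub_distrib, Finset.sum_apply]
      refine Finset.sum_congr rfl fun l _ => ?_
      rw [← Finset.sum_sub_distrib, Finset.sum_apply]
      refine Finset.sum_congr rfl fun p _ => ?_
      rw [Pi.smul_apply, smul_eq_mul, ← mul_sub, mul_comm]
      rfl
    rw [h1]
    refine KilledByDifferences.sum _ fun l _ => KilledByDifferences.sum _ fun p hp => ?_
    rw [Finset.HasAntidiagonal.mem_antidiagonal] at hp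
    rcases Nat.eq_zero_or_pos p.2 with h0 | h0
    · have : seriesCoord l j p.2 g - coeff p.2 ((1 : Matrix (Fin n) (Fin n) ℚ⟦X⟧) l j) = 0 := by
        rw [h0, seriesCoord_zero, sub_eq_zero, coeff_zero_eq_constantCoeff_apply]
        by_cases h : l = j
        · rw [h, one_apply_eq, one_apply_eq, map_one]
        · rw [one_apply_ne h, one_apply_ne h, map_zero]
      rw [this, zero_smul]
      exact killedByDifferences_zero _
    · exact ((ih p.1 (by omega) i l).const_smul _).mono (by omega)

theorem seriesKerFunctions_killed {f : seriesKer n → ℚ} (hf : f ∈ seriesKerFunctions n) :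
    ∃ N, KilledByDifferences N f := by
  refine seriesKerFunctions_induction (p := fun f => ∃ N, KilledByDifferences N f)
    (fun i j k => ⟨_, seriesCoord_killed i j k⟩) (fun c => ⟨1, .const c⟩) ?_ ?_ hf
  · rintro f g - - ⟨N, hN⟩ ⟨M, hM⟩
    exact ⟨N + M, (hN.mono (by omega)).add (hM.mono (by omega))⟩
  · rintro f g - - ⟨N, hN⟩ ⟨M, hM⟩
    exact ⟨N + M, hN.mul hM⟩

theorem seriesKerFunctions_antipode {f : seriesKer n → ℚ} (hf : f ∈ seriesKerFunctions n) :
    (fun x => f x⁻¹) ∈ seriesKerFunctions n := by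
  refine seriesKerFunctions_induction
    (p := fun f => (fun x => f x⁻¹) ∈ seriesKerFunctions n) ?_ ?_ ?_ ?_ hf
  · intro i j k
    convert ((genericMatrix n).adjugate i j).2 k using 1
    ext x
    change coeff k ((x⁻¹ : seriesKer n).1 i j) =
      coeff k (((regularSeriesEval x).mapMatrix (genericMatrix n).adjugate) i j)
    rw [RingHom.map_adjugate, genericMatrix_map, Subgroup.coe_inv]
    rfl
  · exact fun c => (seriesKerFunctions n).algebraMap_mem c
  · exact fun f g _ _ h1 h2 => add_mem h1 h2
  · exact fun f g _ _ h1 h2 => mul_mem h1 h2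

theorem seriesKerFunctions_comul {f : seriesKer n → ℚ} (hf : f ∈ seriesKerFunctions n) :
    ∃ (m : ℕ) (a b : Fin m → seriesKer n → ℚ), (∀ i, a i ∈ seriesKerFunctions n) ∧
      (∀ i, b i ∈ seriesKerFunctions n) ∧ ∀ x y, f (x * y) = ∑ i, a i x * b i y := by
  suffices ∃ (κ : Type) (_ : Fintype κ) (a b : κ → seriesKer n → ℚ),
      (∀ i, a i ∈ seriesKerFunctions n) ∧ (∀ i, b i ∈ seriesKerFunctions n) ∧
      ∀ x y, f (x * y) = ∑ i, a i x * b i y by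
    obtain ⟨κ, _, a, b, ha, hb, hab⟩ := this
    let E := (Fintype.equivFin κ).symm
    refine ⟨Fintype.card κ, a ∘ E, b ∘ E, fun i => ha _, fun i => hb _, fun x y => ?_⟩
    rw [hab]
    exact (E.sum_comp (fun i => a i x * b i y)).symm
  refine seriesKerFunctions_induction (p := fun f => ∃ (κ : Type) (_ : Fintype κ)
    (a b : κ → seriesKer n → ℚ), (∀ i, a i ∈ seriesKerFunctions n) ∧
    (∀ i, b i ∈ seriesKerFunctions n) ∧ ∀ x y, f (x * y) = ∑ i, a i x * b i y) ?_ ?_ ?_ ?_ hf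
  · intro i j k
    refine ⟨Fin n × Finset.HasAntidiagonal.antidiagonal k, inferInstance, fun t => seriesCoord i t.1 t.2.1.1,
      fun t => seriesCoord t.1 j t.2.1.2, fun t => seriesCoord_mem _ _ _,
      fun t => seriesCoord_mem _ _ _, fun x y => ?_⟩
    rw [seriesCoord_mul, Fintype.sum_prod_type]
    refine Finset.sum_congr rfl fun l _ => ?_
    exact (Finset.sum_coe_sort (Finset.HasAntidiagonal.antidiagonal k)
      (fun p => seriesCoord i l p.1 x * seriesCoord l j p.2 y)).symm
  · intro c
    exact ⟨Unit, inferInstance, fun _ _ => c, fun _ _ => 1,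
      fun _ => (seriesKerFunctions n).algebraMap_mem c, fun _ => one_mem _, by simp⟩
  · rintro f g - - ⟨κ, _, a, b, ha, hb, hab⟩ ⟨κ', _, a', b', ha', hb', hab'⟩
    refine ⟨κ ⊕ κ', inferInstance, Sum.elim a a', Sum.elim b b', ?_, ?_, fun x y => ?_⟩
    · rintro (i | i)
      exacts [ha i, ha' i]
    · rintro (i | i)
      exacts [hb i, hb' i]
    · simp [hab, hab']
  · rintro f g - - ⟨κ, _, a, b, ha, hb, hab⟩ ⟨κ', _, a', b', ha', hb', hab'⟩
    refine ⟨κ × κ', inferInstance, fun t => a t.1 * a' t.2, fun t => b t.1 * b' t.2,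
      fun t => mul_mem (ha _) (ha' _), fun t => mul_mem (hb _) (hb' _), fun x y => ?_⟩
    rw [Pi.mul_apply, hab, hab', Finset.sum_mul_sum, Fintype.sum_prod_type]
    refine Finset.sum_congr rfl fun i _ => Finset.sum_congr rfl fun j _ => ?_
    simp only [Pi.mul_apply]
    ring

theorem isProunipotent_seriesKer (n : ℕ) : IsProunipotent (seriesKerFunctions n) :=
  ⟨fun _ hf => seriesKerFunctions_comul hf, fun _ hf => seriesKerFunctions_antipode hf,
    exists_point, fun _ hf => seriesKerFunctions_killed hf⟩

end Prounipotent

/-! ### Extension of polynomial functions and the universal property -/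

section Extension

variable {G : Type*} [Group G]

/-- The difference operator. -/
def diffOp (g : G) (F : G → ℚ) : G → ℚ := fun x => F (x * g) - F x

theorem diffOp_iterate_sub (g : G) (d : ℕ) (F H : G → ℚ) :
    (diffOp g)^[d] (F - H) = (diffOp g)^[d] F - (diffOp g)^[d] H := by
  induction d generalizing F H with
  | zero => rfl
  | succ d ih =>
    rw [Function.iterate_succ_apply, Function.iterate_succ_apply, Function.iterate_succ_apply, ← ih]
    congr 1
    ext x; simp only [diffOp, Pi.sub_apply]; ring

theorem diffOp_iterate_mul {g : G} {h : G → ℚ} (hh : diffOp g h = 0) (d : ℕ) (F : G → ℚ) :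
    (diffOp g)^[d] (h * F) = h * (diffOp g)^[d] F := by
  induction d generalizing F with
  | zero => rfl
  | succ d ih =>
    rw [Function.iterate_succ_apply, Function.iterate_succ_apply, ← ih]
    congr 1
    ext x
    have : h (x * g) = h x := sub_eq_zero.1 (congrFun hh x)
    simp only [diffOp, Pi.mul_apply, this]; ring

theorem diffOp_iterate_comp {g : G} {z : G → ℚ} (hz : ∀ x, z (x * g) = z x + 1) (d : ℕ)
    (p : ℚ → ℚ) : (diffOp g)^[d] (p ∘ z) = ((fwdDiff 1)^[d] p) ∘ z := by
  induction d generalizing p with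
  | zero => rfl
  | succ d ih =>
    rw [Function.iterate_succ_apply, Function.iterate_succ_apply, ← ih]
    congr 1
    ext x; simp only [diffOp, fwdDiff, Function.comp_apply, hz]

/-- If every polynomial function that is invariant under `M` belongs to an algebra of polynomial
functions, then so does every polynomial function that is invariant under the kernel of a
function of the algebra that is additive along `M`. -/
theorem mem_of_invariant_ker {A : Subalgebra ℚ (G → ℚ)}
    (hA : ∀ f ∈ A, ∃ N, KilledByDifferences N f) {M : Subgroup G} {c : G → ℚ} (hcA : c ∈ A)
    (hc : ∀ x, ∀ w ∈ M, c (x * w) = c x + c w)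
    (hM : ∀ (F : G → ℚ) (N : ℕ), KilledByDifferences N F →
      (∀ x, ∀ w ∈ M, F (x * w) = F x) → F ∈ A)
    {F : G → ℚ} {N : ℕ} (hF : KilledByDifferences N F)
    (hinv : ∀ x, ∀ w ∈ M, c w = 0 → F (x * w) = F x) : F ∈ A := by
  by_cases h0 : ∀ w ∈ M, c w = 0
  · exact hM F N hF fun x w hw => hinv x w hw (h0 w hw)
  push Not at h0
  obtain ⟨g, hg, hcg⟩ := h0
  have hc1 : c 1 = 0 := by
    have := hc 1 1 (one_mem M)
    rw [mul_one] at this; linarith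
  have hcinv : ∀ w ∈ M, c w⁻¹ = -c w := by
    intro w hw
    have := hc w⁻¹ w hw
    rw [inv_mul_cancel, hc1] at this; linarith
  have hcpow : ∀ w ∈ M, ∀ m : ℕ, c (w ^ m) = m * c w := by
    intro w hw m
    induction m with
    | zero => simp [hc1]
    | succ m ih => rw [pow_succ, hc _ w hw, ih]; push_cast; ring
  have hczpow : ∀ w ∈ M, ∀ m : ℤ, c (w ^ m) = m * c w := by
    intro w hw m
    obtain ⟨k, rfl | rfl⟩ := m.eq_nat_or_neg
    · rw [zpow_natCast, hcpow w hw]; simp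
    · rw [zpow_neg, zpow_natCast, hcinv _ (pow_mem hw k), hcpow w hw]; simp
  have hconj : ∀ w ∈ M, c (g⁻¹ * w * g) = c w := by
    intro w hw
    rw [hc _ g hg, hc _ w hw, hcinv g hg]; ring
  set z : G → ℚ := (c g)⁻¹ • c with hz
  have hzg : ∀ x, z (x * g) = z x + 1 := by
    intro x
    rw [hz, Pi.smul_apply, Pi.smul_apply, hc x g hg, smul_add, smul_eq_mul, smul_eq_mul,
      inv_mul_cancel₀ hcg]
  have hzA : z ∈ A := A.smul_mem hcA _
  have hdiff : ∀ F : G → ℚ, (∀ x, ∀ w ∈ M, c w = 0 → F (x * w) = F x) →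
      ∀ d x, ∀ w ∈ M, c w = 0 → (diffOp g)^[d] F (x * w) = (diffOp g)^[d] F x := by
    intro F hF d
    induction d generalizing F with
    | zero => exact hF
    | succ d ih =>
      rw [Function.iterate_succ_apply]
      refine ih _ fun x w hw hcw => ?_
      have h1 := hF (x * g) (g⁻¹ * w * g) (mul_mem (mul_mem (inv_mem hg) hw) hg)
        ((hconj w hw).trans hcw)
      rw [show x * g * (g⁻¹ * w * g) = x * w * g by group] at h1
      rw [diffOp, diffOp, h1, hF x w hw hcw]
  -- Induction on the degree along `g`: the top difference `h` is removed by subtracting `h z^d /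
  -- d!`, where `z` grows by one along `g`.
  have key : ∀ (d N : ℕ) (F : G → ℚ), KilledByDifferences N F →
      (∀ x, ∀ w ∈ M, c w = 0 → F (x * w) = F x) → (diffOp g)^[d] F = 0 → F ∈ A := by
    intro d
    induction d with
    | zero =>
      intro N F _ _ h
      rw [Function.iterate_zero_apply] at h
      rw [h]; exact zero_mem A
    | succ d ih =>
      intro N F hF hinv hd
      set h := (diffOp g)^[d] F with hh
      rw [Function.iterate_succ_apply', ← hh] at hd
      have hhN : KilledByDifferences N h := hF.iterate g d
      have hhg : ∀ x, h (x * g) = h x := fun x => sub_eq_zero.1 (congrFun hd x)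
      have hhg' : ∀ x, h (x * g⁻¹) = h x := fun x => by
        rw [← hhg (x * g⁻¹), inv_mul_cancel_right]
      have hhz : ∀ (b : ℤ) x, h (x * g ^ b) = h x := by
        intro b
        induction b using Int.induction_on with
        | zero => intro x; rw [zpow_zero, mul_one]
        | succ b ih => intro x; rw [zpow_add_one, ← mul_assoc, hhg, ih]
        | pred b ih => intro x; rw [zpow_sub_one, ← mul_assoc, hhg', ih]
      -- As `c` is rational-valued, `w` and `g` are commensurable modulo its kernel on `M`. So `h`,
      -- being invariant under `g` and under that kernel, is invariant under a power of `w`, hence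
      -- under `w`.
      have hhM : ∀ x, ∀ w ∈ M, h (x * w) = h x := by
        intro x w hw
        set q : ℚ := c w / c g with hq
        refine hhN.invariant_of_pow (m := q.den) q.den_pos (fun x => ?_) x
        have hmem : w ^ q.den * (g ^ q.num)⁻¹ ∈ M := mul_mem (pow_mem hw _)
          (inv_mem (zpow_mem hg _))
        have hzero : c (w ^ q.den * (g ^ q.num)⁻¹) = 0 := by
          rw [hc _ _ (inv_mem (zpow_mem hg _)), hcinv _ (zpow_mem hg _), hczpow g hg, hcpow w hw]
          have h1 : (q.den : ℚ) * q = q.num := by rw [mul_comm, Rat.mul_den_eq_num]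
          have h2 : c w = q * c g := by rw [hq, div_mul_cancel₀ _ hcg]
          rw [h2, ← h1]; ring
        have h3 := hdiff F hinv d x _ hmem hzero
        rw [← hh] at h3
        rw [← h3, ← hhz q.num (x * (w ^ q.den * (g ^ q.num)⁻¹)), mul_assoc, mul_assoc,
          inv_mul_cancel, mul_one]
      have hhA : h ∈ A := hM h N hhN hhM
      set u : G → ℚ := ((d.factorial : ℚ)⁻¹) • z ^ d with hu
      have huA : u ∈ A := A.smul_mem (pow_mem hzA d) _
      obtain ⟨N', hN'⟩ := hA _ (mul_mem hhA huA)
      have hzinv : ∀ x, ∀ w ∈ M, c w = 0 → z (x * w) = z x := by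
        intro x w hw hcw
        rw [hz, Pi.smul_apply, Pi.smul_apply, hc x w hw, hcw, add_zero]
      have hud : (diffOp g)^[d] u = 1 := by
        have h1 : u = (fun t : ℚ => (d.factorial : ℚ)⁻¹ • t ^ d) ∘ z := by
          ext x; simp [hu]
        rw [h1, diffOp_iterate_comp hzg]
        have h2 : (fun t : ℚ => (d.factorial : ℚ)⁻¹ • t ^ d) =
            (d.factorial : ℚ)⁻¹ • (fun t : ℚ => t ^ d) := rfl
        rw [h2, fwdDiff_iter_const_smul, fwdDiff_iter_eq_factorial]
        ext x
        have : (d.factorial : ℚ) ≠ 0 := by exact_mod_cast d.factorial_ne_zero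
        simp [this]
      have hres : F - h * u ∈ A := by
        refine ih (max N N') _ ((hF.mono (le_max_left _ _)).sub (hN'.mono (le_max_right _ _))) ?_ ?_
        · intro x w hw hcw
          simp only [Pi.sub_apply, Pi.mul_apply, hu, Pi.smul_apply, Pi.pow_apply,
            hinv x w hw hcw, hhM x w hw, hzinv x w hw hcw]
        · rw [diffOp_iterate_sub, diffOp_iterate_mul hd, hud, mul_one, ← hh, sub_self]
      have := add_mem hres (mul_mem hhA huA)
      rwa [sub_add_cancel] at this
  exact key N N F hF hinv (hF.iterate_eq_zero g)

end Extension

/-! ### Density of `K`, extension of functions and the universal property. -/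

section Universal

universe u

open PowerSeries

variable {n : ℕ}

theorem seriesCoord_mul_of_mem {s : ℕ} (hs : s ≠ 0) (i j : Fin n) (x : seriesKer n)
    {w : seriesKer n} (hw : w ∈ seriesKerCongr n s) :
    seriesCoord i j s (x * w) = seriesCoord i j s x + seriesCoord i j s w := by
  have := coeffMatrix_mul hs (coe_mem_seriesCongr_one x) hw
  exact congrFun (congrFun this i) j

theorem seriesCoord_invariant {s : ℕ} (i j : Fin n) (x : seriesKer n)
    {w : seriesKer n} (hw : w ∈ seriesKerCongr n (s + 1)) :
    seriesCoord i j s (x * w) = seriesCoord i j s x := by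
  have := coeffMatrix_mul_of_le (s := s) s.succ_ne_zero (by omega) (coe_mem_seriesCongr_one x) hw
  rw [if_neg (by omega), add_zero] at this
  exact congrFun (congrFun this i) j

/-- A regular function depends only on finitely many coefficients. -/
theorem seriesKerFunctions_invariant {f : seriesKer n → ℚ} (hf : f ∈ seriesKerFunctions n) :
    ∃ s, ∀ x, ∀ w ∈ seriesKerCongr n (s + 1), f (x * w) = f x := by
  refine seriesKerFunctions_induction
    (p := fun f => ∃ s, ∀ x, ∀ w ∈ seriesKerCongr n (s + 1), f (x * w) = f x)
    (fun i j k => ⟨k, fun x w hw => seriesCoord_invariant i j x hw⟩)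
    (fun c => ⟨0, fun _ _ _ => rfl⟩) ?_ ?_ hf
  · rintro f g - - ⟨s, hs⟩ ⟨t, ht⟩
    refine ⟨max s t, fun x w hw => ?_⟩
    rw [Pi.add_apply, Pi.add_apply,
      hs x w (seriesCongr_antitone (by omega : s + 1 ≤ max s t + 1) hw),
      ht x w (seriesCongr_antitone (by omega : t + 1 ≤ max s t + 1) hw)]
  · rintro f g - - ⟨s, hs⟩ ⟨t, ht⟩
    refine ⟨max s t, fun x w hw => ?_⟩
    rw [Pi.mul_apply, Pi.mul_apply,
      hs x w (seriesCongr_antitone (by omega : s + 1 ≤ max s t + 1) hw),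
      ht x w (seriesCongr_antitone (by omega : t + 1 ≤ max s t + 1) hw)]

theorem sum_smul_mem {P ι : Type*} [Fintype ι] {A : Subalgebra ℚ (P → ℚ)} {a : ι → P → ℚ}
    (ha : ∀ i, a i ∈ A) (b : ι → ℚ) : (fun x => ∑ i, a i x * b i) ∈ A := by
  have : (fun x => ∑ i, a i x * b i) = ∑ i, b i • a i := by
    ext x
    rw [Finset.sum_apply]
    exact Finset.sum_congr rfl fun i _ => mul_comm _ _
  rw [this]
  exact sum_mem fun i _ => A.smul_mem (ha i) _

theorem IsProunipotent.right_translate {P : Type*} [Group P] {A : Subalgebra ℚ (P → ℚ)}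
    (hA : IsProunipotent A) {f : P → ℚ} (hf : f ∈ A) (g : P) : (fun x => f (x * g)) ∈ A := by
  obtain ⟨m, a, b, ha, -, hab⟩ := hA.comul f hf
  simp only [hab]
  exact sum_smul_mem ha _

theorem IsProunipotent.left_translate {P : Type*} [Group P] {A : Subalgebra ℚ (P → ℚ)}
    (hA : IsProunipotent A) {f : P → ℚ} (hf : f ∈ A) (g : P) : (fun x => f (g * x)) ∈ A := by
  obtain ⟨m, a, b, -, hb, hab⟩ := hA.comul f hf
  simp only [hab, mul_comm (a _ g)]
  exact sum_smul_mem hb _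

theorem IsProunipotent.ext_point {P : Type*} [Group P] {A : Subalgebra ℚ (P → ℚ)}
    (hA : IsProunipotent A) {x y : P} (h : ∀ f ∈ A, f x = f y) : x = y := by
  let χ : A →ₐ[ℚ] ℚ := (Pi.evalAlgHom ℚ (fun _ : P => ℚ) x).comp A.val
  exact (hA.points χ).unique (fun f => rfl) (fun f => h f.1 f.2)

namespace IsExpansion

variable {R : Type} [CommRing R] {a : R →+* ℤ} {e : R →+* ℚ⟦X⟧} {τ : R}
  (h : IsExpansion a e τ)

include h

/-- The image of `K` is Zariski dense. -/
theorem eq_zero_of_comp_eq_zero (hn : 3 ≤ n) {N s : ℕ} {f : seriesKer n → ℚ}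
    (hf : KilledByDifferences N f) (hs : ∀ x, ∀ w ∈ seriesKerCongr n (s + 1), f (x * w) = f x)
    (hzero : ∀ k, f (kerToSeriesKer n a e h.constantCoeff_eq k) = 0) : f = 0 := by
  set φ := kerToSeriesKer n a e h.constantCoeff_eq with hφ
  induction N generalizing f with
  | zero => exact hf
  | succ N ih =>
    -- Differences along the image of `K` vanish on `K`, so by induction `f` is right invariant
    -- under that image.
    have hinv : ∀ k x, f (x * φ k) = f x := by
      intro k x
      have := ih (hf (φ k)) (fun x w hw => ?_) (fun k' => ?_)
      · exact sub_eq_zero.1 (congrFun this x)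
      · have hw' : (φ k)⁻¹ * w * φ k ∈ seriesKerCongr n (s + 1) := by
          have := (inferInstance : (seriesKerCongr n (s + 1)).Normal).conj_mem w hw (φ k)⁻¹
          rwa [inv_inv] at this
        have h1 := hs (x * φ k) _ hw'
        rw [show x * φ k * ((φ k)⁻¹ * w * φ k) = x * w * φ k by group] at h1
        rw [h1, hs x w hw]
      · rw [← map_mul, hzero, hzero, sub_zero]
    ext y
    -- A power of `y` agrees with an element of `K` modulo a level that `f` does not see. So `f` is
    -- invariant under that power, hence under `y`, and `f y = f 1`.
    obtain ⟨m, hm, k, hk, hky⟩ := h.exists_pow_congr hn (coe_mem_seriesCongr_one y) s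
    have hmem : (φ ⟨k, hk⟩)⁻¹ * y ^ m ∈ seriesKerCongr n (s + 1) := hky
    have h1 := hf.invariant_of_pow (w := y) hm (fun x => by
      have h2 := hs (x * φ ⟨k, hk⟩) _ hmem
      rwa [mul_assoc, mul_inv_cancel_left, hinv] at h2) 1
    rw [one_mul] at h1
    rw [h1, Pi.zero_apply, ← map_one φ]
    exact hzero 1

theorem eq_of_comp_eq (hn : 3 ≤ n) {f g : seriesKer n → ℚ} (hf : f ∈ seriesKerFunctions n)
    (hg : g ∈ seriesKerFunctions n) (hfg : ∀ k, f (kerToSeriesKer n a e h.constantCoeff_eq k) =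
      g (kerToSeriesKer n a e h.constantCoeff_eq k)) : f = g := by
  have hsub := sub_mem hf hg
  obtain ⟨N, hN⟩ := seriesKerFunctions_killed hsub
  obtain ⟨s, hs⟩ := seriesKerFunctions_invariant hsub
  refine sub_eq_zero.1 (h.eq_zero_of_comp_eq_zero hn hN hs fun k => ?_)
  rw [Pi.sub_apply, hfg, sub_self]

/-- Every polynomial function on `K` extends to a regular function. -/
theorem exists_extension (hn : 3 ≤ n)
    (hE : ∀ Y : Matrix (Fin n) (Fin n) R, Y.det = 1 → Y ∈ elemMonoid R .univ) {N : ℕ}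
    {F : slKer n a → ℚ} (hF : KilledByDifferences N F) :
    ∃ f ∈ seriesKerFunctions n, ∀ k, f (kerToSeriesKer n a e h.constantCoeff_eq k) = F k := by
  set φ := kerToSeriesKer n a e h.constantCoeff_eq with hφ
  let A : Subalgebra ℚ (slKer n a → ℚ) := (seriesKerFunctions n).map
    (AlgHom.pi fun k => Pi.evalAlgHom ℚ (fun _ => ℚ) (φ k))
  have hAmem : ∀ f ∈ seriesKerFunctions n, f ∘ φ ∈ A := fun f hf => ⟨f, hf, rfl⟩
  have hA : ∀ f ∈ A, ∃ N, KilledByDifferences N f := by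
    rintro _ ⟨f, hf, rfl⟩
    obtain ⟨N, hN⟩ := seriesKerFunctions_killed hf
    exact ⟨N, hN.comp φ⟩
  suffices F ∈ A by
    obtain ⟨f, hf, rfl⟩ := this
    exact ⟨f, hf, fun k => rfl⟩
  -- Induction on the level fixing `F`: between consecutive levels the entries of the next
  -- coefficient matrix are admitted one at a time through `mem_of_invariant_ker`.
  have key : ∀ (s : ℕ) (F : slKer n a → ℚ) (N : ℕ), KilledByDifferences N F →
      (∀ x w, φ w ∈ seriesKerCongr n (s + 1) → F (x * w) = F x) → F ∈ A := by
    intro s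
    induction s with
    | zero =>
      intro F N _ hinv
      have : F = fun _ => F 1 := by
        ext x
        have := hinv 1 x (coe_mem_seriesCongr_one _)
        rwa [one_mul] at this
      rw [this]
      exact A.algebraMap_mem _
    | succ s ih =>
      have chain : ∀ (S : Finset (Fin n × Fin n)) (F : slKer n a → ℚ) (N : ℕ),
          KilledByDifferences N F → (∀ x w, φ w ∈ seriesKerCongr n (s + 1) →
            (∀ p ∈ S, seriesCoord p.1 p.2 (s + 1) (φ w) = 0) → F (x * w) = F x) → F ∈ A := by
        intro S
        induction S using Finset.induction_on with
        | empty => exact fun F N hF hinv => ih F N hF fun x w hw => hinv x w hw (by simp)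
        | insert p S hp ihS =>
          intro F N hF hinv
          let M : Subgroup (slKer n a) :=
            { carrier := {w | φ w ∈ seriesKerCongr n (s + 1) ∧
                ∀ p ∈ S, seriesCoord p.1 p.2 (s + 1) (φ w) = 0}
              one_mem' := by
                refine ⟨by rw [map_one]; exact one_mem _, fun p _ => ?_⟩
                rw [map_one]
                exact coeff_one_apply s.succ_ne_zero p.1 p.2
              mul_mem' := by
                rintro x y ⟨h1, h2⟩ ⟨h3, h4⟩
                refine ⟨by rw [map_mul]; exact mul_mem h1 h3, fun p hp => ?_⟩
                rw [map_mul, seriesCoord_mul_of_mem s.succ_ne_zero _ _ _ h3, h2 p hp, h4 p hp,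
                  add_zero]
              inv_mem' := by
                rintro x ⟨h1, h2⟩
                refine ⟨by rw [map_inv]; exact inv_mem h1, fun p hp => ?_⟩
                have := seriesCoord_mul_of_mem s.succ_ne_zero p.1 p.2 (φ x)⁻¹ h1
                rw [inv_mul_cancel, h2 p hp, add_zero] at this
                rw [map_inv, ← this]
                exact coeff_one_apply s.succ_ne_zero p.1 p.2 }
          refine mem_of_invariant_ker hA (M := M) (c := seriesCoord p.1 p.2 (s + 1) ∘ φ)
            (hAmem _ (seriesCoord_mem _ _ _)) ?_ ?_ hF ?_
          · intro x w hw
            rw [Function.comp_apply, map_mul, seriesCoord_mul_of_mem s.succ_ne_zero _ _ _ hw.1]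
            rfl
          · exact fun F N hF hinv => ihS F N hF fun x w h1 h2 => hinv x w ⟨h1, h2⟩
          · intro x w hw hcw
            refine hinv x w hw.1 fun q hq => ?_
            rcases Finset.mem_insert.1 hq with rfl | hq
            · exact hcw
            · exact hw.2 q hq
      intro F N hF hinv
      refine chain Finset.univ F N hF fun x w hw hw0 => hinv x w ?_
      refine (mem_seriesCongr_succ s.succ_ne_zero).2 ⟨hw, ?_⟩
      ext i j
      exact hw0 (i, j) (Finset.mem_univ _)
  refine key N F N hF fun x w hw => ?_
  -- `F` is fixed by `Γ^(N+1)`, hence by its isolator, the congruence subgroup of level `N + 1`.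
  obtain ⟨m, hm, hwm⟩ := (h.kerToSeriesKer_mem_iff hn hE w).1 hw
  exact hF.invariant_of_pow hm (fun y => hF.invariant_of_mem_lowerCentral hwm y) x

/-- Pullback along `ψ`, followed by the unique extension from `K` to `𝒰`, is an algebra homomorphism
by uniqueness. Composed with evaluation at `y` it is a character of `B`, that is, the point `Φ y` of
`Q`. -/
theorem isMalcevCompletion (hn : 3 ≤ n)
    (hE : ∀ Y : Matrix (Fin n) (Fin n) R, Y.det = 1 → Y ∈ elemMonoid R .univ) :
    IsMalcevCompletion.{0, 0, u} (seriesKerFunctions n)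
      (kerToSeriesKer n a e h.constantCoeff_eq) := by
  refine ⟨isProunipotent_seriesKer n, fun Q _ B hB ψ => ?_⟩
  set φ := kerToSeriesKer n a e h.constantCoeff_eq with hφ
  have hex : ∀ f : B, ∃ f' ∈ seriesKerFunctions n, ∀ k, f' (φ k) = (f : Q → ℚ) (ψ k) := by
    rintro ⟨f, hf⟩
    obtain ⟨N, hN⟩ := hB.unipotent f hf
    exact h.exists_extension hn hE (hN.comp ψ)
  choose E hEmem hEval using hex
  have hEuniq : ∀ (f : B) (f' : seriesKer n → ℚ), f' ∈ seriesKerFunctions n →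
      (∀ k, f' (φ k) = (f : Q → ℚ) (ψ k)) → E f = f' := fun f f' hf' hval =>
    h.eq_of_comp_eq hn (hEmem f) hf' fun k => (hEval f k).trans (hval k).symm
  let χ : seriesKer n → (B →ₐ[ℚ] ℚ) := fun y =>
    { toFun := fun f => E f y
      map_one' := congrFun (hEuniq 1 1 (one_mem _) fun k => rfl) y
      map_mul' := fun f g => congrFun (hEuniq (f * g) (E f * E g) (mul_mem (hEmem f) (hEmem g))
        fun k => by rw [Pi.mul_apply, hEval, hEval]; rfl) y
      map_zero' := congrFun (hEuniq 0 0 (zero_mem _) fun k => rfl) y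
      map_add' := fun f g => congrFun (hEuniq (f + g) (E f + E g) (add_mem (hEmem f) (hEmem g))
        fun k => by rw [Pi.add_apply, hEval, hEval]; rfl) y
      commutes' := fun c => congrFun (hEuniq (algebraMap ℚ B c) (algebraMap ℚ _ c)
        (Subalgebra.algebraMap_mem _ c) fun k => rfl) y }
  choose Φ hΦ using fun y => (hB.points (χ y)).exists
  have hΦ' : ∀ y (f : Q → ℚ) (hf : f ∈ B), f (Φ y) = E ⟨f, hf⟩ y :=
    fun y f hf => (hΦ y ⟨f, hf⟩).symm
  have hcomp : ∀ k, Φ (φ k) = ψ k := fun k =>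
    hB.ext_point fun f hf => by rw [hΦ' _ f hf, hEval]
  have hpro := isProunipotent_seriesKer n
  have hmul : ∀ x y, Φ (x * y) = Φ x * Φ y := by
    intro x y
    refine hB.ext_point fun f hf => ?_
    obtain ⟨m, b, c, hb, hc, hbc⟩ := hB.comul f hf
    rw [hbc, hΦ' _ f hf]
    simp only [hΦ' _ _ (hb _), hΦ' _ _ (hc _)]
    have hfE := hEmem ⟨f, hf⟩
    -- The identity holds on the image of `K` in both variables; density extends it first in the
    -- right variable, then in the left.
    have h1 : ∀ k y, E ⟨f, hf⟩ (φ k * y) = ∑ i, E ⟨b i, hb i⟩ (φ k) * E ⟨c i, hc i⟩ y := by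
      intro k y
      refine congrFun (h.eq_of_comp_eq hn (hpro.left_translate hfE (φ k))
        (g := fun y => ∑ i, E ⟨b i, hb i⟩ (φ k) * E ⟨c i, hc i⟩ y) ?_ fun k' => ?_) y
      · simp only [mul_comm (E ⟨b _, hb _⟩ _)]
        exact sum_smul_mem (fun i => hEmem _) _
      · change E ⟨f, hf⟩ (φ k * φ k') = ∑ i, E ⟨b i, hb i⟩ (φ k) * E ⟨c i, hc i⟩ (φ k')
        rw [← map_mul, hEval]
        simp only [hEval]
        rw [map_mul]
        exact hbc _ _
    refine congrFun (h.eq_of_comp_eq hn (hpro.right_translate hfE y)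
      (g := fun x => ∑ i, E ⟨b i, hb i⟩ x * E ⟨c i, hc i⟩ y) ?_ fun k => h1 k y) x
    exact sum_smul_mem (fun i => hEmem _) _
  refine ⟨MonoidHom.mk' Φ hmul, ⟨fun f hf => ?_, MonoidHom.ext hcomp⟩, ?_⟩
  · have : f ∘ (MonoidHom.mk' Φ hmul) = E ⟨f, hf⟩ := by
      ext y
      exact hΦ' y f hf
    rw [this]
    exact hEmem _
  · rintro Φ' ⟨hreg, hΦ'ψ⟩
    refine MonoidHom.ext fun y => hB.ext_point fun f hf => ?_
    have h1 := hEuniq ⟨f, hf⟩ (f ∘ Φ') (hreg f hf) fun k =>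
      congrArg f (DFunLike.congr_fun hΦ'ψ k)
    exact (congrFun h1 y).symm.trans (hΦ' y f hf).symm

end IsExpansion

end Universal

/-! ### The rings `ℤ[t]` and `ℤ[t, t⁻¹]` -/

section Examples

open Matrix

theorem IsExpansion.kerToSeriesKer_mem_seriesKerCongr_iff {n : ℕ} {R : Type} [CommRing R]
    {a : R →+* ℤ} {e : R →+* ℚ⟦X⟧} {τ : R} (h : IsExpansion a e τ) {r : ℕ} (x : slKer n a) :
    kerToSeriesKer n a e h.constantCoeff_eq x ∈ seriesKerCongr n r ↔
      x ∈ (slKer n (Ideal.Quotient.mk (Ideal.span {τ} ^ r))).subgroupOf (slKer n a) := by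
  rw [seriesKerCongr, Subgroup.mem_subgroupOf, Subgroup.mem_subgroupOf, mem_slKer_iff,
    mem_seriesCongr]
  refine forall_congr' fun i => forall_congr' fun j => ?_
  rw [Ideal.Quotient.eq_zero_iff_mem, Ideal.span_singleton_pow, Ideal.mem_span_singleton,
    h.dvd_iff, map_sub]
  have h1 : e ((1 : Matrix (Fin n) (Fin n) R) i j) = (1 : Matrix (Fin n) (Fin n) ℚ⟦X⟧) i j := by
    by_cases h : i = j
    · rw [h, one_apply_eq, one_apply_eq, map_one]
    · rw [one_apply_ne h, one_apply_ne h, map_zero]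
  rw [h1]
  rfl

theorem polyExpand_eq_coe (p : ℤ[X]) :
    polyExpand p = ((p.map (Int.castRingHom ℚ) : ℚ[X]) : ℚ⟦X⟧) := by
  have : polyExpand = (Polynomial.coeToPowerSeries.ringHom (R := ℚ)).comp
      (Polynomial.mapRingHom (Int.castRingHom ℚ)) := by
    refine Polynomial.ringHom_ext' (Subsingleton.elim _ _) ?_
    simp [polyExpand]
  exact DFunLike.congr_fun this p

theorem polyExpand_injective : Function.Injective polyExpand := by
  intro p q hpq
  rw [polyExpand_eq_coe, polyExpand_eq_coe, Polynomial.coe_inj] at hpq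
  exact Polynomial.map_injective _ Int.cast_injective hpq

theorem isExpansion_polynomial : IsExpansion polyAug polyExpand Polynomial.X where
  constantCoeff_eq := constantCoeff_polyExpand
  map_uniformizer := by simp [polyExpand]
  dvd_of_map_eq_zero x hx := by
    rw [Polynomial.X_dvd_iff, Polynomial.coeff_zero_eq_eval_zero]
    exact hx
  injective := polyExpand_injective

theorem laurentExpand_toLaurent (p : ℤ[X]) :
    laurentExpand (Polynomial.toLaurent p) = polyExpand (p.comp (1 + Polynomial.X)) := by
  rw [laurentExpand, LaurentPolynomial.eval₂_toLaurent, polyExpand, Polynomial.coe_eval₂RingHom,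
    Polynomial.eval₂_comp]
  simp

theorem isExpansion_laurent :
    IsExpansion laurentAug laurentExpand (LaurentPolynomial.T 1 - 1) where
  constantCoeff_eq := constantCoeff_laurentExpand
  map_uniformizer := by
    rw [map_sub, map_one, ← Polynomial.toLaurent_X, laurentExpand_toLaurent, Polynomial.X_comp]
    simp [polyExpand]
  dvd_of_map_eq_zero x hx := by
    obtain ⟨k, p, hp⟩ := LaurentPolynomial.exists_T_pow x
    rw [← (LaurentPolynomial.isUnit_T (R := ℤ) k).dvd_mul_right, ← hp]
    have h1 : p.eval 1 = 0 := by
      have := congrArg laurentAug hp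
      rw [map_mul, hx, zero_mul, laurentAug, LaurentPolynomial.eval₂_toLaurent] at this
      simpa using this
    have := map_dvd Polynomial.toLaurent (Polynomial.dvd_iff_isRoot.2 h1)
    simpa using this
  injective := by
    rw [injective_iff_map_eq_zero]
    intro x hx
    obtain ⟨k, p, hp⟩ := LaurentPolynomial.exists_T_pow x
    rw [← (LaurentPolynomial.isUnit_T (R := ℤ) k).mul_left_eq_zero, ← hp]
    have h1 := congrArg laurentExpand hp
    rw [map_mul, hx, zero_mul, laurentExpand_toLaurent] at h1
    have h2 := polyExpand_injective (h1.trans (map_zero _).symm)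
    -- The substitution `t ↦ t - 1` undoes `t ↦ 1 + t`.
    have h3 := congrArg (Polynomial.comp · (Polynomial.X - 1)) h2
    simp only [Polynomial.comp_assoc, Polynomial.zero_comp] at h3
    simp only [Polynomial.add_comp, Polynomial.one_comp, Polynomial.X_comp, add_sub_cancel,
      Polynomial.comp_X] at h3
    rw [h3, map_zero]

end Examples

theorem theorem3p6 (n : ℕ) (hn : 3 ≤ n) :
    (Function.Injective (polyIncl n) ∧
      IsMalcevCompletion.{0, 0, w} (seriesKerFunctions n) (polyIncl n) ∧
      IsMalcevLimit (polyIncl n) ∧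
      ∀ (r : ℕ) (x : polyKer n),
        x ∈ polyCongr n (r + 1) ↔ ∃ m : ℕ, 0 < m ∧ x ^ m ∈ lowerCentral (polyKer n) r) ∧
    (Function.Injective (laurentIncl n) ∧
      IsMalcevCompletion.{0, 0, w} (seriesKerFunctions n) (laurentIncl n) ∧
      IsMalcevLimit (laurentIncl n) ∧
      ∀ (r : ℕ) (x : laurentKer n),
        x ∈ laurentCongr n (r + 1) ↔ ∃ m : ℕ, 0 < m ∧ x ^ m ∈ lowerCentral (laurentKer n) r) := by
  have hcard : 3 ≤ Fintype.card (Fin n) := by rwa [Fintype.card_fin]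
  have hP := isExpansion_polynomial
  have hL := isExpansion_laurent
  have hEP : ∀ Y : Matrix (Fin n) (Fin n) ℤ[X], Y.det = 1 → Y ∈ elemMonoid ℤ[X] .univ :=
    fun Y hY => mem_elemMonoid_polynomial_int hcard hY
  have hEL : ∀ Y : Matrix (Fin n) (Fin n) ℤ[T;T⁻¹], Y.det = 1 → Y ∈ elemMonoid ℤ[T;T⁻¹] .univ :=
    fun Y hY => mem_elemMonoid_laurent_int hcard hY
  exact ⟨⟨hP.kerToSeriesKer_injective, hP.isMalcevCompletion hn hEP, hP.isMalcevLimit hn hEP,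
      fun r x => (hP.kerToSeriesKer_mem_seriesKerCongr_iff x).symm.trans
        (hP.kerToSeriesKer_mem_iff hn hEP x)⟩,
    hL.kerToSeriesKer_injective, hL.isMalcevCompletion hn hEL, hL.isMalcevLimit hn hEL,
      fun r x => (hL.kerToSeriesKer_mem_seriesKerCongr_iff x).symm.trans
        (hL.kerToSeriesKer_mem_iff hn hEL x)⟩
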